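/- Let $F=(f,g_1,g_2)\colon\mathbb R\times\mathbb R^2\to\mathbb R\times\mathbb R^2$ be a $C^\infty$ vector field in the coordinates $(x,y)=(x,y_1,y_2)$, and assume: (i) $F(0,y)=0$ for all $y\in\mathbb R^2$; (ii) $\partial_x f(0)=0$; (iii) $\partial_{y_1}\partial_x f(0)>0$ and $\partial_{y_2}\partial_x f(0)=0$; (iv) $\partial_x g_1(0)=0$; (v) $\kappa:=\partial_{y_1}\partial_x f(0)\,\partial_{y_2}\partial_x g_1(0)+\partial_{y_2}^2\partial_x f(0)\,\partial_x g_2(0)\neq 0$; (vi) $\partial_x g_2(0)>0$. Put $a=\operatorname{sign}\kappa\in\{-1,+1\}$. A point $(0,y)$ with $\partial_xf(0,y)=0$ is called transcritical. Then for every $N\in\mathbb N$ and every neighbourhood $O$ of the origin there is an open neighbourhood $U\subseteq O$ of the origin with the following properties. (1) On $U$ the vector field $F$ is flow-equivalent to the cusp normal form $$\dot z_0=0,\qquad \dot z_1=0,\qquad \dot z_2=a z_2^3+z_1z_2+z_0+r(z),\qquad r(z)=\mathcal O(z_2^N),$$ on an open neighbourhood $V$ of the origin: there are a $C^\infty$ function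 $r$ on $V$ with $|r(z)|\le C|z_2|^N$ on $V$ for a constant $C$, and a $C^\infty$ diffeomorphism $U\to V$ fixing the origin which transforms $F$ into the normal form up to a positive $C^\infty$ factor (so it maps trajectories to trajectories and preserves the direction of time). (2) If $a=-1$, the forward trajectory of every point of $U$ stays in $U$ and converges to an equilibrium $(0,y)\in U$. If $a=+1$, the same holds for backward trajectories. (3) The transcritical points in $U$ form a smooth curve $\gamma=\{(0,\vartheta(s),s):\alpha<s<\beta\}$ with $\alpha<0<\beta$ and $\vartheta(0)=0$. Let $\gamma_1$ ($s>0$) and $\gamma_2$ ($s<0$) be the two components of $\gamma\setminus\{0\}$. For $j=1,2$ let $W_j$ be the unstable (if $a=-1$) or stable (if $a=+1$) set of $\gamma_j$ in $U$, i.e. the set of points of $U$ the backward (respectively forward) trajectory of which stays in $U$ and converges to a point of $\gamma_j$. Then $W_j$ is a smooth embedded surface with boundary $\gamma_j$; $W_j\setminus\gamma_j$ consists of heteroclinic orbits between points of $\gamma_j$ and other equilibria, every point of $\gamma_j$ is an end point of such an orbit, and $W_1\setminus\gamma_1$, $W_2\setminus\gamma_2$ lie on opposite sides of the plane $\{x=0\}$.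 Let $\sigma_j$ be the set of limits of the trajectories of the points of $W_j\setminus\gamma_j$ in forward time (if $a=-1$) or backward time (if $a=+1$). Then $\sigma_1\cup\{0\}\cup\sigma_2$ is a smooth curve $\{(0,\theta(s),s):\alpha'<s<\beta'\}$ with $\alpha'<0<\beta'$ and $\theta(0)=0$, where $\sigma_1$ is the part $s<0$ and $\sigma_2$ the part $s>0$, and it is tangent to $\gamma$ at the origin, $\theta'(0)=\vartheta'(0)$. -/

import Mathlib

open Set Filter
open scoped ContDiff Topology

namespace DriftSing

/-- Phase space `ℝ³` with coordinates `(x, y₁, y₂)`, also used for `(z₀, z₁, z₂)`. -/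
abbrev R3 : Type := ℝ × ℝ × ℝ

/-- Partial derivative with respect to the first coordinate `x`. -/
noncomputable def dx (u : R3 → ℝ) : R3 → ℝ := fun p => deriv (fun t => u (t, p.2.1, p.2.2)) p.1

/-- Partial derivative with respect to the second coordinate `y₁`. -/
noncomputable def dy₁ (u : R3 → ℝ) : R3 → ℝ := fun p => deriv (fun t => u (p.1, t, p.2.2)) p.2.1

/-- Partial derivative with respect to the third coordinate `y₂`. -/
noncomputable def dy₂ (u : R3 → ℝ) : R3 → ℝ := fun p => deriv (fun t => u (p.1, p.2.1, t)) p.2.2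

/-- The vector field `F = (f, g₁, g₂)`. -/
def field (f g₁ g₂ : R3 → ℝ) : R3 → R3 := fun p => (f p, g₁ p, g₂ p)

/-- The quantity `∂_{y₁}∂_x f(0) ∂_{y₂}∂_x g₁(0) + ∂_{y₂}²∂_x f(0) ∂_x g₂(0)`,
the sign of which is the sign of the cubic term. -/
noncomputable def kappa (f g₁ g₂ : R3 → ℝ) : ℝ :=
  dy₁ (dx f) 0 * dy₂ (dx g₁) 0 + dy₂ (dy₂ (dx f)) 0 * dx g₂ 0

/-- The vector field `F` on `U` is smoothly flow-equivalent to `G` on `V`, with base point `0`: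
a smooth diffeomorphism `U → V` fixing the origin maps trajectories to trajectories and preserves
the direction of time, that is, it transforms `F` into `G` up to a smooth positive factor. -/
def FlowEquivalentOn (F : R3 → R3) (U : Set R3) (G : R3 → R3) (V : Set R3) : Prop :=
  ∃ H : OpenPartialHomeomorph R3 R3, H.source = U ∧ H.target = V ∧ H 0 = 0 ∧
    ContDiffOn ℝ ∞ H U ∧ ContDiffOn ℝ ∞ H.symm V ∧
    ∃ μ : R3 → ℝ, ContDiffOn ℝ ∞ μ U ∧ (∀ p ∈ U, 0 < μ p) ∧
      ∀ p ∈ U, fderiv ℝ H p (F p) = μ p • G (H p)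

/-- The cusp family `ż₂ = a z₂³ + z₁ z₂ + z₀ + r(z)`, with parameters `ż₀ = ż₁ = 0`. -/
def cuspField (a : ℝ) (r : R3 → ℝ) : R3 → R3 :=
  fun z => (0, 0, a * z.2.2 ^ 3 + z.2.1 * z.2.2 + z.1 + r z)

/-- The forward trajectory of `F` through `p` stays in `U` and converges to `q`.
(The fields considered are smooth, so the trajectory is unique.) -/
def ConvergesForward (F : R3 → R3) (U : Set R3) (p q : R3) : Prop :=
  ∃ φ : ℝ → R3, φ 0 = p ∧ IsIntegralCurveOn φ (fun _ => F) (Ici 0) ∧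
    (∀ t ∈ Ici (0 : ℝ), φ t ∈ U) ∧ Tendsto φ atTop (𝓝 q)

/-- The backward trajectory of `F` through `p` stays in `U` and converges to `q`. -/
def ConvergesBackward (F : R3 → R3) (U : Set R3) (p q : R3) : Prop :=
  ∃ φ : ℝ → R3, φ 0 = p ∧ IsIntegralCurveOn φ (fun _ => F) (Iic 0) ∧
    (∀ t ∈ Iic (0 : ℝ), φ t ∈ U) ∧ Tendsto φ atBot (𝓝 q)

/-- The curve `{(0, ϑ(s), s) : s ∈ I}` in the plane `{x = 0}`. -/
def planeGraph (ϑ : ℝ → ℝ) (I : Set ℝ) : Set R3 := (fun s => ((0, ϑ s, s) : R3)) '' I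

/-- `S` is a smooth embedded surface in `ℝ³` with boundary `B ⊆ S`. -/
def IsSmoothSurfaceWithBoundary (S B : Set R3) : Prop :=
  B ⊆ S ∧
  (∀ p ∈ S \ B, ∃ O : Set R3, IsOpen O ∧ p ∈ O ∧ ∃ Ψ : R3 → ℝ, ContDiffOn ℝ ∞ Ψ O ∧
    fderiv ℝ Ψ p ≠ 0 ∧ S ∩ O = {q ∈ O | Ψ q = 0}) ∧
  (∀ p ∈ B, ∃ O : Set R3, IsOpen O ∧ p ∈ O ∧ ∃ Ψ χ : R3 → ℝ,
    ContDiffOn ℝ ∞ Ψ O ∧ ContDiffOn ℝ ∞ χ O ∧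
    LinearIndependent ℝ ![fderiv ℝ Ψ p, fderiv ℝ χ p] ∧
    S ∩ O = {q ∈ O | Ψ q = 0 ∧ 0 ≤ χ q} ∧ B ∩ O = {q ∈ O | Ψ q = 0 ∧ χ q = 0})

/-- The points of `U` that `rel` connects to a point of `γ`: the unstable set of `γ` in `U` if
`rel` is backward convergence, the stable set if `rel` is forward convergence. -/
def limitSet (rel : R3 → R3 → Prop) (U γ : Set R3) : Set R3 := {p ∈ U | ∃ q ∈ γ, rel p q}

/-- The end points, in the time direction of `rel`, of the trajectories through points of `W`. -/
def targets (rel : R3 → R3 → Prop) (W : Set R3) : Set R3 := {q | ∃ p ∈ W, rel p q}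

/-- All points of `W` lie on heteroclinic orbits joining a point of `γ` to a different point
of `σ`, and every point of `γ` is an end point of such an orbit. -/
def IsHeteroclinicFamily (src tgt : R3 → R3 → Prop) (W γ σ : Set R3) : Prop :=
  (∀ p ∈ W, ∃ q ∈ γ, ∃ q' ∈ σ, q ≠ q' ∧ src p q ∧ tgt p q') ∧ ∀ q ∈ γ, ∃ p ∈ W, src p q

/-- The local dynamics in `U` near a plane `{x = 0}` of equilibria with set `T` of
transcritical points, for the two relations `src` and `tgt` of convergence in opposite
directions of time.

All trajectories converge to an equilibrium in the direction `tgt`. The transcritical points in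
`U` form a curve through `0` with branches `γ₁`, `γ₂`. The sets `W₁`, `W₂` of points
converging to them in the direction `src` are surfaces of heteroclinic orbits (with boundary
`γ₁`, `γ₂`) on opposite sides of the plane, and the targets of these orbits are the two branches
`σ₁`, `σ₂` of a curve through `0` which is tangent there to the curve of transcritical points. -/
def LocalDynamics (U T : Set R3) (src tgt : R3 → R3 → Prop) : Prop :=
  (∀ p ∈ U, ∃ y₁ y₂ : ℝ, (0, y₁, y₂) ∈ U ∧ tgt p (0, y₁, y₂)) ∧
  ∃ (ϑ θ : ℝ → ℝ) (α β α' β' : ℝ) (γ₁ γ₂ W₁ W₂ σ₁ σ₂ : Set R3),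
    α < 0 ∧ 0 < β ∧ ContDiffOn ℝ ∞ ϑ (Ioo α β) ∧ ϑ 0 = 0 ∧
    T ∩ U = planeGraph ϑ (Ioo α β) ∧
    γ₁ = planeGraph ϑ (Ioo 0 β) ∧ γ₂ = planeGraph ϑ (Ioo α 0) ∧
    W₁ = limitSet src U γ₁ ∧ W₂ = limitSet src U γ₂ ∧
    IsSmoothSurfaceWithBoundary W₁ γ₁ ∧ IsSmoothSurfaceWithBoundary W₂ γ₂ ∧
    IsHeteroclinicFamily src tgt (W₁ \ γ₁) γ₁ σ₁ ∧
    IsHeteroclinicFamily src tgt (W₂ \ γ₂) γ₂ σ₂ ∧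
    (((∀ p ∈ W₁ \ γ₁, 0 < p.1) ∧ ∀ p ∈ W₂ \ γ₂, p.1 < 0) ∨
      ((∀ p ∈ W₁ \ γ₁, p.1 < 0) ∧ ∀ p ∈ W₂ \ γ₂, 0 < p.1)) ∧
    σ₁ = targets tgt (W₁ \ γ₁) ∧ σ₂ = targets tgt (W₂ \ γ₂) ∧
    α' < 0 ∧ 0 < β' ∧ ContDiffOn ℝ ∞ θ (Ioo α' β') ∧ θ 0 = 0 ∧
    σ₁ = planeGraph θ (Ioo α' 0) ∧ σ₂ = planeGraph θ (Ioo 0 β') ∧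
    σ₁ ∪ {0} ∪ σ₂ = planeGraph θ (Ioo α' β') ∧
    deriv θ 0 = deriv ϑ 0

end DriftSing

/-! Since `F` vanishes on the plane `{x = 0}`, it is `x • G` with `G` smooth, and `G 0 = (0, 0, c)`
with `c = dx g₂ 0 > 0`. The field `G` has no zero near the origin, so its flow, started on the
section `y₂ = 0`, gives coordinates `w = (u₀, u₁, τ)` in which `G` is `∂_τ` and `F` is `X ∂_τ`,
where `X` is the coordinate `x` written as a function of `w` (`exists_flowBox`). Everything thus
becomes a family of scalar equations `τ' = X (u, τ)` with parameters `u`. The `τ`-derivatives of `X`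
are iterated derivatives of `x` along `G`: at the origin the first two vanish and the third is `c *
kappa`, while conditions (iii) and (vi) make `X` a versal unfolding of this cubic zero
(`IsCuspUnfolding`).

Normal form (`exists_normalForm`): divide `X (u, s + t)` by `a t³ + z₁ t + z₀`, with `s, z₀, z₁`
free and up to a high power of `t`. The three coefficients of the quadratic remainder can be made
zero by the implicit function theorem, which determines `s, z₀, z₁` as functions of `u`. The
quotient is positive and becomes the time factor. This is a finite-order form of the preparation
theorem and needs only Hadamard's lemma.

Dynamics: transcritical points are the points where `X` and `∂_τ X` both vanish. They form a curve
`t ↦ (a t, b t, t)`, and on the line through such a point `X` behaves like `(m / 6) (τ - t)² (τ + 2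
t)`, with `m` the third derivative. So there is exactly one further zero `ρ t` nearby, with `ρ' (0)
= -2` (`exists_foldCurve`). If `m < 0`, then `ρ t` attracts along its line, `t` is half-stable, and
the unstable set of `t` is the segment from `ρ t` (excluded) to `t` (included), by
`unstable_iff_signed`. The surface `W_j` is the union of these segments over one branch of the
curve, and its targets are the points with `τ = ρ t`. As `ρ` reverses sign, `σ_1` lies in `s < 0`.
Both curves have velocity along the `y₂`-axis at the origin, which gives the tangency. On `W_j` the
coordinate `x` is `X`, whose sign is opposite on the two branches. The neighbourhood is a box on
whose ends `τ = ±δ` the field points inwards (`IsFoldCurve.exists_cuspBox`). The case `m > 0`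
follows by reversing time. -/

open Set Filter
open scoped ContDiff Topology unitInterval

namespace DriftSing

/-! ### Inverse and implicit functions of class `C^∞`. -/

section Smooth

variable {E F : Type*} [NormedAddCommGroup E] [NormedSpace ℝ E] [NormedAddCommGroup F]
  [NormedSpace ℝ F]

/-- Smooth inverse function theorem, with an inverse that is smooth on its whole domain. -/
theorem exists_smooth_inverse [CompleteSpace E] {f : E → F} (hf : ContDiff ℝ ∞ f) {a : E}
    (f' : E ≃L[ℝ] F) (hf' : HasFDerivAt f (f' : E →L[ℝ] F) a) :
    ∃ e : OpenPartialHomeomorph E F, a ∈ e.source ∧ (∀ x, e x = f x) ∧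
      ContDiffOn ℝ ∞ e.symm e.target := by
  have h1 : (∞ : WithTop ℕ∞) ≠ 0 := by simp
  set e₀ := hf.contDiffAt.toOpenPartialHomeomorph f hf' h1 with he₀
  -- Smoothness of the inverse at the image of `a` alone is not enough. Invertibility of the
  -- derivative is an open condition, and restricting to it makes the inverse smooth at every point
  -- of the target.
  set s : Set E := {x | fderiv ℝ f x ∈ range ((↑) : (E ≃L[ℝ] F) → E →L[ℝ] F)} with hs
  have hso : IsOpen s :=
    (ContinuousLinearEquiv.isOpen (E := E) (F := F) (𝕜 := ℝ)).preimage (hf.continuous_fderiv h1)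
  refine ⟨e₀.restrOpen s hso, ?_, fun x => rfl, ?_⟩
  · refine ⟨hf.contDiffAt.mem_toOpenPartialHomeomorph_source hf' h1, ?_⟩
    exact ⟨f', hf'.fderiv.symm⟩
  · intro y hy
    have hy' : (e₀.restrOpen s hso).symm y ∈ (e₀.restrOpen s hso).source :=
      (e₀.restrOpen s hso).map_target hy
    obtain ⟨g, hg⟩ := hy'.2
    refine ((e₀.restrOpen s hso).contDiffAt_symm (f₀' := g) hy ?_ ?_).contDiffWithinAt
    · rw [hg]
      exact ((hf.differentiable h1) _).hasFDerivAt
    · exact hf.contDiffAt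

/-- A function that is smooth near `a` agrees near `a` with a globally smooth function. -/
theorem exists_contDiff_eventuallyEq [FiniteDimensional ℝ E] {f : E → F} {s : Set E}
    {a : E} (hs : s ∈ 𝓝 a) (hf : ContDiffOn ℝ ∞ f s) :
    ∃ g : E → F, ContDiff ℝ ∞ g ∧ g =ᶠ[𝓝 a] f := by
  obtain ⟨ε, hε, hεs⟩ := Metric.mem_nhds_iff.1 hs
  -- The bump vanishes outside radius `ε / 2`, so the product is smooth inside the `ε`-ball and
  -- locally zero outside the half-size closed ball; these two open sets cover `E`.
  let b : ContDiffBump a := ⟨ε / 4, ε / 2, by positivity, by linarith⟩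
  refine ⟨fun x => b x • f x, ?_, ?_⟩
  · rw [contDiff_iff_contDiffAt]
    intro x
    by_cases hx : x ∈ Metric.ball a ε
    · exact b.contDiffAt.smul
        ((hf.contDiffAt (mem_of_superset (Metric.isOpen_ball.mem_nhds hx) hεs)))
    · have : (fun x => b x • f x) =ᶠ[𝓝 x] fun _ => 0 := by
        have h2 : (Metric.closedBall a (ε / 2))ᶜ ∈ 𝓝 x := by
          refine Metric.isClosed_closedBall.isOpen_compl.mem_nhds ?_
          intro h
          apply hx
          rw [Metric.mem_closedBall] at h
          rw [Metric.mem_ball]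
          linarith
        filter_upwards [h2] with y hy
        have : b y = 0 := by
          apply b.zero_of_le_dist
          rw [mem_compl_iff, Metric.mem_closedBall, not_le] at hy
          exact hy.le
        simp [this]
      exact contDiffAt_const.congr_of_eventuallyEq this
  · filter_upwards [b.eventuallyEq_one] with x hx
    simp [hx]

/-- Smooth implicit function theorem at the origin, with a globally smooth implicit function. -/
theorem exists_smooth_implicit [FiniteDimensional ℝ E] [CompleteSpace F]
    {Q : E × F → F} (hQ : ContDiff ℝ ∞ Q) (h0 : Q 0 = 0) (L : F ≃L[ℝ] F)
    (hL : ∀ y, fderiv ℝ Q 0 (0, y) = L y) :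
    ∃ ψ : E → F, ContDiff ℝ ∞ ψ ∧ ψ 0 = 0 ∧ ∀ᶠ p in 𝓝 (0 : E × F), Q p = 0 ↔ p.2 = ψ p.1 := by
  have : CompleteSpace E := FiniteDimensional.complete ℝ E
  set Q' := fderiv ℝ Q 0 with hQ'
  have hQd : HasFDerivAt Q Q' 0 := (hQ.differentiable (by simp) 0).hasFDerivAt
  have hsplit : ∀ x y, Q' (x, y) = Q' (x, 0) + L y := by
    intro x y
    rw [← hL, ← map_add]; simp
  -- `Φ` flattens the zero set of `Q` to `F`-coordinate zero, so the implicit function is the second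
  -- component of its inverse on `(x, 0)`.
  let Φ : E × F → E × F := fun p => (p.1, Q p)
  have hΦ : ContDiff ℝ ∞ Φ := contDiff_fst.prodMk hQ
  let T : (E × F) ≃L[ℝ] (E × F) := ContinuousLinearEquiv.equivOfInverse
    ((ContinuousLinearMap.fst ℝ E F).prod Q')
    ((ContinuousLinearMap.fst ℝ E F).prod
      ((L.symm : F →L[ℝ] F) ∘L (ContinuousLinearMap.snd ℝ E F -
        Q' ∘L (ContinuousLinearMap.inl ℝ E F) ∘L (ContinuousLinearMap.fst ℝ E F))))
    (by rintro ⟨x, y⟩; simp [hsplit x y]) (by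
      rintro ⟨x, y⟩
      have := hsplit x (L.symm y - L.symm (Q' (x, 0)))
      simp [this])
  have hT : HasFDerivAt Φ (T : E × F →L[ℝ] E × F) 0 := hasFDerivAt_fst.prodMk hQd
  obtain ⟨e, he0, hef, hes⟩ := exists_smooth_inverse hΦ T hT
  have hΦ0 : Φ 0 = 0 := by simp [Φ, h0]
  have ht0 : (0 : E × F) ∈ e.target := by
    have := e.map_source he0
    rwa [hef, hΦ0] at this
  have hsymm0 : e.symm 0 = 0 := by
    have := e.left_inv he0
    rwa [hef, hΦ0] at this
  let ψ₀ : E → F := fun x => (e.symm (x, 0)).2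
  have hcont : Continuous fun x : E => (x, (0 : F)) := by fun_prop
  have hs : {x : E | (x, (0 : F)) ∈ e.target} ∈ 𝓝 (0 : E) :=
    (e.open_target.preimage hcont).mem_nhds ht0
  have hψ₀ : ContDiffOn ℝ ∞ ψ₀ {x : E | (x, (0 : F)) ∈ e.target} := by
    refine contDiff_snd.comp_contDiffOn (hes.comp (by fun_prop) ?_)
    exact fun x hx => hx
  -- Only this cutoff needs `E` finite dimensional. `F` may be infinite dimensional, as in the flow
  -- construction, where it is `C(I, E)`.
  obtain ⟨ψ, hψ, hψeq⟩ := exists_contDiff_eventuallyEq hs hψ₀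
  refine ⟨ψ, hψ, ?_, ?_⟩
  · rw [hψeq.self_of_nhds]
    change (e.symm (0 : E × F)).2 = 0
    rw [hsymm0]; rfl
  · have h1 : ∀ᶠ p in 𝓝 (0 : E × F), ψ p.1 = ψ₀ p.1 :=
      (continuous_fst.tendsto (0 : E × F)).eventually hψeq
    have h2 : ∀ᶠ p in 𝓝 (0 : E × F), (p.1, (0 : F)) ∈ e.target :=
      (continuous_fst.tendsto (0 : E × F)).eventually hs
    filter_upwards [h1, h2, e.open_source.mem_nhds he0] with p hp1 hp2 hp3
    rw [hp1]
    constructor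
    · intro hq
      have h3 : e p = (p.1, 0) := by rw [hef]; simp [Φ, hq]
      have h4 := e.left_inv hp3
      rw [h3] at h4
      change p.2 = (e.symm (p.1, 0)).2
      rw [h4]
    · intro hq
      have h3 := e.right_inv hp2
      rw [hef] at h3
      have h5 : (Φ (e.symm (p.1, 0))).1 = p.1 := by rw [h3]
      have h6 : e.symm (p.1, 0) = p := Prod.ext h5 hq.symm
      rw [h6] at h3
      exact congrArg Prod.snd h3

end Smooth

/-! ### Composition operators on spaces of continuous maps. -/

section Superposition

variable {K : Type} [TopologicalSpace K] [CompactSpace K]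
  {E : Type} [NormedAddCommGroup E] [NormedSpace ℝ E]

/-- Pointwise application, as a continuous bilinear map on spaces of continuous maps. -/
noncomputable def applyCLM (K E F : Type) [TopologicalSpace K] [CompactSpace K]
    [NormedAddCommGroup E] [NormedSpace ℝ E] [NormedAddCommGroup F] [NormedSpace ℝ F] :
    C(K, E →L[ℝ] F) →L[ℝ] C(K, E) →L[ℝ] C(K, F) :=
  LinearMap.mkContinuous₂
    (LinearMap.mk₂ ℝ (fun (A : C(K, E →L[ℝ] F)) (h : C(K, E)) =>
        (⟨fun x => A x (h x), by fun_prop⟩ : C(K, F)))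
      (by intros; ext; simp) (by intros; ext; simp) (by intros; ext; simp) (by intros; ext; simp))
    1 (by
      intro A h
      rw [ContinuousMap.norm_le _ (by positivity)]
      intro x
      simp only [LinearMap.mk₂_apply, ContinuousMap.coe_mk, one_mul]
      exact (A x).le_opNorm_of_le (h.norm_coe_le_norm x) |>.trans
        (mul_le_mul_of_nonneg_right (A.norm_coe_le_norm x) (norm_nonneg _)))

/-- The superposition operator `γ ↦ g ∘ γ` of a `C¹` map is differentiable. -/
theorem hasFDerivAt_superposition {F : Type} [NormedAddCommGroup F] [NormedSpace ℝ F]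
    {g : E → F} (hg : ContDiff ℝ 1 g) (γ : C(K, E)) :
    HasFDerivAt (fun γ : C(K, E) => (⟨g, hg.continuous⟩ : C(E, F)).comp γ)
      (applyCLM K E F ((⟨fderiv ℝ g, hg.continuous_fderiv (by simp)⟩ :
        C(E, E →L[ℝ] F)).comp γ)) γ := by
  set g' : C(E, E →L[ℝ] F) := ⟨fderiv ℝ g, hg.continuous_fderiv (by simp)⟩
  rw [hasFDerivAt_iff_isLittleO_nhds_zero, Asymptotics.isLittleO_iff]
  intro ε hε
  have hc : Continuous fun γ : C(K, E) => g'.comp γ := ContinuousMap.continuous_postcomp g'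
  obtain ⟨δ, hδ, hδε⟩ := (Metric.continuousAt_iff (a := γ)
    (f := fun γ : C(K, E) => g'.comp γ)).1 hc.continuousAt ε hε
  filter_upwards [Metric.ball_mem_nhds (0 : C(K, E)) hδ] with h hh
  rw [ContinuousMap.norm_le _ (by positivity)]
  intro x
  have hx : ‖h x‖ < δ := (h.norm_coe_le_norm x).trans_lt (by simpa using hh)
  have key : ∀ z ∈ Metric.ball (γ x) δ, ‖fderiv ℝ g z - fderiv ℝ g (γ x)‖ ≤ ε := by
    intro z hz
    -- Shifting `γ` by the constant `z - γ x` gives a map `δ`-close to `γ` with value `z` at `x`.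
    -- Continuity of `γ ↦ g' ∘ γ` in the uniform norm thereby controls `g'` on a whole ball around
    -- each `γ x`, with one `δ` for all `x`.
    have h1 : dist (γ + ContinuousMap.const K (z - γ x)) γ < δ := by
      rw [dist_eq_norm, add_sub_cancel_left, ContinuousMap.norm_lt_iff _ hδ]
      intro y
      simpa [dist_eq_norm] using hz
    have h2 := ContinuousMap.dist_apply_le_dist (f := g'.comp (γ + ContinuousMap.const K (z - γ x)))
      (g := g'.comp γ) x
    have h3 := h2.trans (hδε h1).le
    rw [dist_eq_norm] at h3
    simpa [g'] using h3
  have := (convex_ball (γ x) δ).norm_image_sub_le_of_norm_fderiv_le' (𝕜 := ℝ) (f := g)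
    (φ := fderiv ℝ g (γ x)) (C := ε) (x := γ x) (y := γ x + h x)
    (fun z _ => hg.differentiable (by simp) z) key (Metric.mem_ball_self hδ)
    (by simpa [dist_eq_norm] using hx)
  rw [add_sub_cancel_left] at this
  exact this.trans (mul_le_mul_of_nonneg_left (h.norm_coe_le_norm x) hε.le)

/-- The derivative is the superposition operator of `fderiv ℝ g` followed by the continuous linear
map `applyCLM`, so induction on the order applies. `F` is quantified inside because it changes to `E
→L[ℝ] F` at each step. -/
theorem contDiff_superposition_nat (n : ℕ) : ∀ {F : Type} [NormedAddCommGroup F]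
    [NormedSpace ℝ F] {g : E → F} (hg : ContDiff ℝ ∞ g),
    ContDiff ℝ n (fun γ : C(K, E) => (⟨g, hg.continuous⟩ : C(E, F)).comp γ) := by
  induction n with
  | zero =>
    intro F _ _ g hg
    exact contDiff_zero.2 (ContinuousMap.continuous_postcomp _)
  | succ n ih =>
    intro F _ _ g hg
    have hg' : ContDiff ℝ ∞ (fderiv ℝ g) := hg.fderiv_right (by simp)
    have hd := hasFDerivAt_superposition (K := K) (hg.of_le (by simp) : ContDiff ℝ 1 g)
    refine contDiff_succ_iff_hasFDerivAt.2 ⟨_, ?_, hd⟩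
    exact (applyCLM K E F).contDiff.comp (ih hg')

/-- The superposition operator `γ ↦ g ∘ γ` of a smooth map is smooth. -/
theorem contDiff_superposition {F : Type} [NormedAddCommGroup F]
    [NormedSpace ℝ F] {g : E → F} (hg : ContDiff ℝ ∞ g) :
    ContDiff ℝ ∞ (fun γ : C(K, E) => (⟨g, hg.continuous⟩ : C(E, F)).comp γ) :=
  contDiff_infty.2 fun n => contDiff_superposition_nat n hg

end Superposition

end DriftSing

namespace DriftSing

/-! ### Hadamard's lemma and Taylor expansion with smooth remainder. -/

section Hadamard

/-- Integration over the unit interval, as a continuous linear functional. -/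
noncomputable def integralCLM (F : Type) [NormedAddCommGroup F] [NormedSpace ℝ F] :
    C(I, F) →L[ℝ] F :=
  LinearMap.mkContinuous
    { toFun := fun γ => ∫ t in (0 : ℝ)..1, IccExtend zero_le_one γ t
      map_add' := by
        intro γ η
        rw [← intervalIntegral.integral_add
          ((γ.continuous.Icc_extend' (h := zero_le_one)).intervalIntegrable _ _)
          ((η.continuous.Icc_extend' (h := zero_le_one)).intervalIntegrable _ _)]
        rfl
      map_smul' := by
        intro c γ
        rw [RingHom.id_apply, ← intervalIntegral.integral_smul]
        rfl } 1 (by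
      intro γ
      have := intervalIntegral.norm_integral_le_of_norm_le_const (a := 0) (b := 1)
        (C := ‖γ‖) (f := IccExtend zero_le_one γ) (fun t _ => γ.norm_coe_le_norm _)
      simpa using this)

variable {E : Type} [NormedAddCommGroup E] [NormedSpace ℝ E]
  {F : Type} [NormedAddCommGroup F] [NormedSpace ℝ F]

theorem integralCLM_apply (γ : C(I, F)) :
    integralCLM F γ = ∫ t in (0 : ℝ)..1, IccExtend zero_le_one γ t := rfl

/-- The map sending `x` to the segment `t ↦ A x + t • B x`. -/
noncomputable def segCLM (A B : E →L[ℝ] F) : E →L[ℝ] C(I, F) :=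
  LinearMap.mkContinuous
    { toFun := fun x => ⟨fun t => A x + (t : ℝ) • B x, by fun_prop⟩
      map_add' := by intro x y; ext t; simp; module
      map_smul' := by intro c x; ext t; simp; module } (‖A‖ + ‖B‖) (by
      intro x
      rw [ContinuousMap.norm_le _ (by positivity)]
      intro t
      simp only [LinearMap.coe_mk, AddHom.coe_mk, ContinuousMap.coe_mk]
      calc ‖A x + (t : ℝ) • B x‖ ≤ ‖A x‖ + |(t : ℝ)| * ‖B x‖ := by
            refine (norm_add_le _ _).trans ?_
            rw [norm_smul, Real.norm_eq_abs]
        _ ≤ ‖A‖ * ‖x‖ + 1 * (‖B‖ * ‖x‖) := by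
            gcongr
            · exact A.le_opNorm x
            · rw [abs_of_nonneg t.2.1]; exact t.2.2
            · exact B.le_opNorm x
        _ = (‖A‖ + ‖B‖) * ‖x‖ := by ring)

/-- Parametric integrals of smooth maps along segments are smooth. -/
theorem contDiff_integral_segment {G : Type} [NormedAddCommGroup G] [NormedSpace ℝ G]
    {g : F → G} (hg : ContDiff ℝ ∞ g) (A B : E →L[ℝ] F) :
    ContDiff ℝ ∞ fun x => ∫ t in (0 : ℝ)..1, g (A x + t • B x) := by
  -- The integral is a superposition operator between two continuous linear maps, so no
  -- differentiation under the integral sign is needed.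
  have h := (integralCLM G).contDiff.comp
    ((contDiff_superposition (K := I) hg).comp (segCLM A B).contDiff (n := ∞))
  convert! h using 1
  funext x
  simp only [Function.comp_apply, integralCLM_apply]
  apply intervalIntegral.integral_congr
  intro t ht
  rw [uIcc_of_le zero_le_one] at ht
  simp only [IccExtend_of_mem zero_le_one _ ht]
  rfl

/-- The increment of a smooth map along a segment is the integral of its derivative. -/
theorem sub_eq_integral_fderiv {g : E → F} [CompleteSpace F] (hg : ContDiff ℝ ∞ g) (a v : E) :
    g (a + v) - g a = ∫ t in (0 : ℝ)..1, fderiv ℝ g (a + t • v) v := by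
  have hd : ∀ t ∈ uIcc (0 : ℝ) 1, HasDerivAt (fun t : ℝ => g (a + t • v))
      (fderiv ℝ g (a + t • v) v) t := by
    intro t _
    have h1 : HasDerivAt (fun t : ℝ => a + t • v) v t := by
      simpa using ((hasDerivAt_id t).smul_const v).const_add a
    exact ((hg.differentiable (by simp) _).hasFDerivAt).comp_hasDerivAt t h1
  have hc : Continuous fun t : ℝ => fderiv ℝ g (a + t • v) v :=
    ((hg.continuous_fderiv (by simp)).comp (by fun_prop)).clm_apply continuous_const
  have := intervalIntegral.integral_eq_sub_of_hasDerivAt hd (hc.intervalIntegrable _ _)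
  rw [this]; simp

/-- Derivative in the last variable. -/
noncomputable def pd (A : E × ℝ → F) : E × ℝ → F := fun p => fderiv ℝ A p (0, 1)

theorem contDiff_pd {A : E × ℝ → F} (hA : ContDiff ℝ ∞ A) : ContDiff ℝ ∞ (pd A) :=
  (hA.fderiv_right (by simp)).clm_apply contDiff_const

/-- Hadamard's lemma in the last variable. -/
theorem exists_hadamard [CompleteSpace F] {A : E × ℝ → F} (hA : ContDiff ℝ ∞ A) :
    ∃ A₁ : E × ℝ → F, ContDiff ℝ ∞ A₁ ∧ ∀ e t, A (e, t) = A (e, 0) + t • A₁ (e, t) := by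
  refine ⟨fun x => ∫ t in (0 : ℝ)..1, pd A
    ((ContinuousLinearMap.inl ℝ E ℝ ∘L ContinuousLinearMap.fst ℝ E ℝ) x +
      t • (ContinuousLinearMap.inr ℝ E ℝ ∘L ContinuousLinearMap.snd ℝ E ℝ) x),
    contDiff_integral_segment (contDiff_pd hA) _ _, fun e t => ?_⟩
  have := sub_eq_integral_fderiv hA (e, 0) (0, t)
  simp only [Prod.mk_add_mk, add_zero, zero_add] at this
  rw [← sub_eq_iff_eq_add', this, ← intervalIntegral.integral_smul]
  apply intervalIntegral.integral_congr
  intro s _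
  have h0 : ((0 : E), t) = t • ((0 : E), (1 : ℝ)) := by simp
  simp [pd]
  rw [← map_smul, ← h0]

theorem hasDerivAt_slice {A : E × ℝ → F} (hA : ContDiff ℝ ∞ A) (e : E) (t : ℝ) :
    HasDerivAt (fun t => A (e, t)) (pd A (e, t)) t := by
  have h1 : HasDerivAt (fun t : ℝ => (e, t)) ((0 : E), (1 : ℝ)) t :=
    (hasDerivAt_const t e).prodMk (hasDerivAt_id t)
  exact ((hA.differentiable (by simp) _).hasFDerivAt).comp_hasDerivAt t h1

theorem pd_hadamard {A A₁ : E × ℝ → ℝ} (hA : ContDiff ℝ ∞ A) (hA₁ : ContDiff ℝ ∞ A₁)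
    {c : E → ℝ} {k : ℝ} (h : ∀ e t, A (e, t) = k * c e + t * A₁ (e, t)) (e : E) (t : ℝ) :
    pd A (e, t) = A₁ (e, t) + t * pd A₁ (e, t) := by
  have h1 := hasDerivAt_slice hA e t
  have h2 : HasDerivAt (fun t => k * c e + t * A₁ (e, t)) (1 * A₁ (e, t) + t * pd A₁ (e, t)) t :=
    ((hasDerivAt_id t).mul (hasDerivAt_slice hA₁ e t)).const_add _
  have h3 : (fun t => A (e, t)) = fun t => k * c e + t * A₁ (e, t) := funext (h e)
  rw [h3] at h1
  rw [h1.unique h2, one_mul]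

/-- Used repeatedly, this gives `∂ⁿ A = n ∂ⁿ⁻¹ A₁ + t ∂ⁿ A₁`. At `t = 0` it expresses the
derivatives of the Hadamard quotient `A₁` through those of `A`, which produces the factorials in
Taylor's formula. -/
theorem pd_hadamard_add {A B A₁ : E × ℝ → ℝ} {k : ℝ} (hA : ContDiff ℝ ∞ A)
    (hB : ContDiff ℝ ∞ B) (hA₁ : ContDiff ℝ ∞ A₁)
    (h : ∀ e t, A (e, t) = k * B (e, t) + t * A₁ (e, t)) (e : E) (t : ℝ) :
    pd A (e, t) = k * pd B (e, t) + A₁ (e, t) + t * pd A₁ (e, t) := by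
  have h1 := hasDerivAt_slice hA e t
  have h2 : HasDerivAt (fun t => k * B (e, t) + t * A₁ (e, t))
      (k * pd B (e, t) + (1 * A₁ (e, t) + t * pd A₁ (e, t))) t :=
    ((hasDerivAt_slice hB e t).const_mul k).add ((hasDerivAt_id t).mul (hasDerivAt_slice hA₁ e t))
  have h3 : (fun t => A (e, t)) = fun t => k * B (e, t) + t * A₁ (e, t) := funext (h e)
  rw [h3] at h1
  rw [h1.unique h2]; ring

/-- Taylor expansion of order three in the last variable, with smooth remainder. -/
theorem exists_taylor {A : E × ℝ → ℝ} (hA : ContDiff ℝ ∞ A) :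
    ∃ R : E × ℝ → ℝ, ContDiff ℝ ∞ R ∧ ∀ e t, A (e, t) = A (e, 0) + t * pd A (e, 0) +
      t ^ 2 * (pd (pd A) (e, 0) / 2) + t ^ 3 * (pd (pd (pd A)) (e, 0) / 6) + t ^ 4 * R (e, t) := by
  have expand : ∀ {A : E × ℝ → ℝ}, ContDiff ℝ ∞ A → ∃ A₁ : E × ℝ → ℝ, ContDiff ℝ ∞ A₁ ∧
      (∀ e t, A (e, t) = A (e, 0) + t * A₁ (e, t)) ∧ (∀ e, A₁ (e, 0) = pd A (e, 0)) ∧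
      (∀ e, pd A₁ (e, 0) = pd (pd A) (e, 0) / 2) ∧
      (∀ e, pd (pd A₁) (e, 0) = pd (pd (pd A)) (e, 0) / 3) := by
    intro A hA
    obtain ⟨A₁, hA₁, h⟩ := exists_hadamard hA
    simp only [smul_eq_mul] at h
    have d1 := pd_hadamard (c := fun e => A (e, 0)) (k := 1) hA hA₁
      (fun e t => by rw [one_mul]; exact h e t)
    have d2 := pd_hadamard_add (k := 1) (contDiff_pd hA) hA₁ (contDiff_pd hA₁)
      (fun e t => by rw [one_mul]; exact d1 e t)
    have d3 := pd_hadamard_add (k := 2) (contDiff_pd (contDiff_pd hA)) (contDiff_pd hA₁)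
      (contDiff_pd (contDiff_pd hA₁)) (fun e t => by rw [d2]; ring)
    refine ⟨A₁, hA₁, h, fun e => ?_, fun e => ?_, fun e => ?_⟩
    · rw [d1]; ring
    · rw [d2]; ring
    · rw [d3]; ring
  obtain ⟨A₁, hA₁, h1, a1, b1, c1⟩ := expand hA
  obtain ⟨A₂, hA₂, h2, a2, b2, c2⟩ := expand hA₁
  obtain ⟨A₃, hA₃, h3, a3, b3, c3⟩ := expand hA₂
  obtain ⟨A₄, hA₄, h4, a4, b4, c4⟩ := expand hA₃
  refine ⟨A₄, hA₄, fun e t => ?_⟩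
  rw [h1, h2, h3, h4, a3, a2, a1, b2, b1, c1]
  ring

end Hadamard

/-! ### Smooth dependence of the local flow, by the implicit function theorem in path space. -/

section Flow

variable {E : Type} [NormedAddCommGroup E] [NormedSpace ℝ E] [FiniteDimensional ℝ E]

/-- Volterra integration on the unit interval. -/
noncomputable def volterraCLM (F : Type) [NormedAddCommGroup F] [NormedSpace ℝ F] :
    C(I, F) →L[ℝ] C(I, F) :=
  LinearMap.mkContinuous
    { toFun := fun γ => ⟨fun s => ∫ t in (0 : ℝ)..s, IccExtend zero_le_one γ t,
        (intervalIntegral.continuous_primitive (fun a b =>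
          (γ.continuous.Icc_extend' (h := zero_le_one)).intervalIntegrable a b) 0).comp
          continuous_subtype_val⟩
      map_add' := by
        intro γ η
        ext s
        simp only [ContinuousMap.coe_mk, ContinuousMap.add_apply]
        rw [← intervalIntegral.integral_add
          ((γ.continuous.Icc_extend' (h := zero_le_one)).intervalIntegrable _ _)
          ((η.continuous.Icc_extend' (h := zero_le_one)).intervalIntegrable _ _)]
        rfl
      map_smul' := by
        intro c γ
        ext s
        simp only [ContinuousMap.coe_mk, ContinuousMap.smul_apply, RingHom.id_apply]
        rw [← intervalIntegral.integral_smul]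
        rfl } 1 (by
      intro γ
      rw [ContinuousMap.norm_le _ (by positivity)]
      intro s
      have := intervalIntegral.norm_integral_le_of_norm_le_const (a := 0) (b := s)
        (C := ‖γ‖) (f := IccExtend zero_le_one γ) (fun t _ => γ.norm_coe_le_norm _)
      refine this.trans ?_
      rw [sub_zero, abs_of_nonneg s.2.1, one_mul]
      exact mul_le_of_le_one_right (norm_nonneg _) s.2.2)

theorem volterraCLM_apply {F : Type} [NormedAddCommGroup F] [NormedSpace ℝ F] (γ : C(I, F))
    (s : I) : volterraCLM F γ s = ∫ t in (0 : ℝ)..s, IccExtend zero_le_one γ t := rfl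

/-- A smooth vector field has a smooth local flow. -/
theorem exists_smooth_flow {G : E → E} (hG : ContDiff ℝ ∞ G) :
    ∃ φ : ℝ × E → E, ContDiff ℝ ∞ φ ∧ (∀ᶠ p in 𝓝 (0 : E), φ (0, p) = p) ∧
      ∀ᶠ q in 𝓝 (0 : ℝ × E), HasDerivAt (fun t => φ (t, q.2)) (G (φ q)) q.1 := by
  have : CompleteSpace E := FiniteDimensional.complete ℝ E
  let S : C(I, E) → C(I, E) := fun γ => (⟨G, hG.continuous⟩ : C(E, E)).comp γ
  have hS : ContDiff ℝ ∞ S := contDiff_superposition hG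
  let cst : E →L[ℝ] C(I, E) := segCLM (ContinuousLinearMap.id ℝ E) 0
  have hcst : ∀ p s, cst p s = p := by intro p s; simp [cst, segCLM]
  -- A zero of `Q` at `((T, p), γ)` is a solution of `γ' = T G(γ)`, `γ 0 = p` on `[0, 1]`, that is,
  -- a trajectory run for time `T`. At `T = 0` the integral term drops out, so the partial
  -- derivative in `γ` is the identity. The flow is the end point `γ 1` of the implicit solution.
  let Q : (ℝ × E) × C(I, E) → C(I, E) := fun q => q.2 - cst q.1.2 - q.1.1 • volterraCLM E (S q.2)
  have hQ : ContDiff ℝ ∞ Q := by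
    refine (contDiff_snd.sub (cst.contDiff.comp (contDiff_snd.comp contDiff_fst))).sub
      ((contDiff_fst.comp contDiff_fst).smul ((volterraCLM E).contDiff.comp (hS.comp contDiff_snd)))
  have hQ0 : Q 0 = 0 := by simp [Q]
  have hQL : ∀ y, fderiv ℝ Q 0 (0, y) = ContinuousLinearEquiv.refl ℝ C(I, E) y := by
    intro y
    have h1 : HasDerivAt (fun t : ℝ => Q ((0, 0) + t • (0, y))) (fderiv ℝ Q 0 (0, y)) 0 := by
      have h2 : HasDerivAt (fun t : ℝ => ((0, 0) : (ℝ × E) × C(I, E)) + t • (0, y)) (0, y) 0 := by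
        simpa using ((hasDerivAt_id (0 : ℝ)).smul_const ((0, y) : (ℝ × E) × C(I, E))).const_add
          ((0, 0) : (ℝ × E) × C(I, E))
      have h3 := (hQ.differentiable (by simp) 0).hasFDerivAt
      have h4 : (0 : (ℝ × E) × C(I, E)) = (0, 0) + (0 : ℝ) • (0, y) := by simp; rfl
      rw [h4] at h3
      have h5 := h3.comp_hasDerivAt (0 : ℝ) h2
      rwa [← h4] at h5
    have h3 : (fun t : ℝ => Q ((0, 0) + t • (0, y))) = fun t => t • y := by
      funext t; simp [Q]
    rw [h3] at h1
    have h4 : HasDerivAt (fun t : ℝ => t • y) y 0 := by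
      simpa using (hasDerivAt_id (0 : ℝ)).smul_const y
    exact h1.unique h4
  obtain ⟨Γ, hΓ, hΓ0, hiff⟩ := exists_smooth_implicit hQ hQ0 _ hQL
  let φ : ℝ × E → E := fun q => Γ q 1
  have hev : ContDiff ℝ ∞ φ := (ContinuousMap.evalCLM ℝ (1 : I) : C(I, E) →L[ℝ] E).contDiff.comp hΓ
  -- a box on which the implicit function theorem applies
  obtain ⟨δ, hδ, hball⟩ := Metric.eventually_nhds_iff_ball.1 hiff
  have hΓc : ContinuousAt Γ 0 := hΓ.continuous.continuousAt
  have hsmall : ∀ᶠ q in 𝓝 (0 : ℝ × E), ‖Γ q‖ < δ := by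
    have := hΓc.norm
    rw [ContinuousAt, hΓ0, norm_zero] at this
    exact this.eventually (gt_mem_nhds hδ)
  obtain ⟨η, hη, hηball⟩ := Metric.eventually_nhds_iff_ball.1
    (hsmall.and (Metric.ball_mem_nhds (0 : ℝ × E) hδ))
  have hmem : ∀ q ∈ Metric.ball (0 : ℝ × E) η, ∀ γ : C(I, E), ‖γ‖ < δ →
      (Q (q, γ) = 0 ↔ γ = Γ q) := by
    intro q hq γ hγ
    refine hball (q, γ) ?_
    rw [mem_ball_zero_iff, Prod.norm_def, max_lt_iff]
    exact ⟨by simpa using (hηball q hq).2, hγ⟩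
  have heq : ∀ q ∈ Metric.ball (0 : ℝ × E) η, ∀ s : I,
      Γ q s = q.2 + q.1 • ∫ t in (0 : ℝ)..s, IccExtend zero_le_one (S (Γ q)) t := by
    intro q hq s
    have h1 := (hmem q hq (Γ q) (hηball q hq).1).2 rfl
    have h2 := DFunLike.congr_fun h1 s
    simp only [Q, ContinuousMap.sub_apply, hcst, ContinuousMap.smul_apply, volterraCLM_apply,
      ContinuousMap.zero_apply] at h2
    rw [sub_sub, sub_eq_zero] at h2
    exact h2
  -- The initial piece of the solution for time `T`, stretched from `[0, s]` to `[0, 1]`, solves the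
  -- equation for time `s T` and is no larger in norm. Local uniqueness in the implicit function
  -- theorem identifies it with the solution found there.
  have hscale : ∀ q ∈ Metric.ball (0 : ℝ × E) η, ∀ s : I, Γ q s = φ (s * q.1, q.2) := by
    intro q hq s
    have hq' : ((s : ℝ) * q.1, q.2) ∈ Metric.ball (0 : ℝ × E) η := by
      rw [mem_ball_zero_iff, Prod.norm_def, max_lt_iff] at hq ⊢
      refine ⟨?_, hq.2⟩
      rw [norm_mul, Real.norm_of_nonneg s.2.1]
      exact (mul_le_of_le_one_left (norm_nonneg _) s.2.2).trans_lt hq.1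
    let γ : C(I, E) := ⟨fun r => Γ q (s * r), by fun_prop⟩
    have hγ : ‖γ‖ < δ := by
      rw [ContinuousMap.norm_lt_iff _ hδ]
      intro r
      exact ((Γ q).norm_coe_le_norm _).trans_lt (hηball q hq).1
    have hγQ : Q (((s : ℝ) * q.1, q.2), γ) = 0 := by
      ext r
      simp only [Q, ContinuousMap.sub_apply, hcst, ContinuousMap.smul_apply, volterraCLM_apply,
        ContinuousMap.zero_apply]
      rw [sub_sub, sub_eq_zero]
      change Γ q (s * r) = _
      rw [heq q hq (s * r)]
      congr 1
      rw [mul_comm (s : ℝ) q.1, mul_smul]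
      congr 1
      have h1 : ∫ t in (0 : ℝ)..r, IccExtend zero_le_one (S γ) t =
          ∫ t in (0 : ℝ)..r, IccExtend zero_le_one (S (Γ q)) (s * t) := by
        apply intervalIntegral.integral_congr
        intro t ht
        rw [uIcc_of_le r.2.1] at ht
        have ht1 : t ∈ Icc (0 : ℝ) 1 := ⟨ht.1, ht.2.trans r.2.2⟩
        have ht2 : (s : ℝ) * t ∈ Icc (0 : ℝ) 1 :=
          ⟨mul_nonneg s.2.1 ht1.1, mul_le_one₀ s.2.2 ht1.1 ht1.2⟩
        simp only [IccExtend_of_mem zero_le_one _ ht1, IccExtend_of_mem zero_le_one _ ht2]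
        rfl
      rw [h1, intervalIntegral.smul_integral_comp_mul_left]
      simp
    have h3 := (hmem _ hq' γ hγ).1 hγQ
    have h4 := DFunLike.congr_fun h3 (1 : I)
    change Γ q (s * 1) = _ at h4
    rw [mul_one] at h4
    exact h4
  have hint : ∀ q ∈ Metric.ball (0 : ℝ × E) η,
      φ q = q.2 + ∫ t in (0 : ℝ)..q.1, G (φ (t, q.2)) := by
    intro q hq
    have h1 := heq q hq 1
    change φ q = _ at h1
    rw [h1]
    congr 1
    have h2 : ∫ t in (0 : ℝ)..(1 : I), IccExtend zero_le_one (S (Γ q)) t =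
        ∫ t in (0 : ℝ)..1, G (φ (t * q.1, q.2)) := by
      apply intervalIntegral.integral_congr
      intro t ht
      have ht' : t ∈ Icc (0 : ℝ) 1 := by simpa [uIcc_of_le] using ht
      simp only [IccExtend_of_mem zero_le_one _ ht']
      change G (Γ q ⟨t, ht'⟩) = _
      rw [hscale q hq]
    rw [h2, intervalIntegral.smul_integral_comp_mul_right (fun t => G (φ (t, q.2)))]
    simp
  refine ⟨φ, hev, ?_, ?_⟩
  · filter_upwards [Metric.ball_mem_nhds (0 : E) hη] with p hp
    have := hint (0, p) (by
      rw [mem_ball_zero_iff, Prod.norm_def, max_lt_iff]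
      exact ⟨by simpa using hη, by simpa using hp⟩)
    simpa using this
  · filter_upwards [Metric.ball_mem_nhds (0 : ℝ × E) hη] with q hq
    have hc : Continuous fun t => G (φ (t, q.2)) :=
      hG.continuous.comp (hev.continuous.comp (by fun_prop))
    have h1 : HasDerivAt (fun s => q.2 + ∫ t in (0 : ℝ)..s, G (φ (t, q.2))) (G (φ q)) q.1 :=
      (intervalIntegral.integral_hasDerivAt_right (hc.intervalIntegrable _ _)
        (hc.stronglyMeasurableAtFilter _ _) hc.continuousAt).const_add _
    refine h1.congr_of_eventuallyEq ?_
    have h2 : ∀ᶠ t in 𝓝 q.1, (t, q.2) ∈ Metric.ball (0 : ℝ × E) η :=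
      (Metric.isOpen_ball.preimage (by fun_prop : Continuous fun t : ℝ => (t, q.2))).mem_nhds hq
    filter_upwards [h2] with t ht
    exact hint (t, q.2) ht

end Flow

end DriftSing

namespace DriftSing

/-! ### Partial derivatives, and coordinates that straighten the trajectories. -/

section Partial

/-- Derivative of a function of `w = (u₀, u₁, τ)` with respect to `τ`. -/
noncomputable def dt (X : R3 → ℝ) : R3 → ℝ := fun w => fderiv ℝ X w (0, 0, 1)

theorem contDiff_dt {X : R3 → ℝ} (hX : ContDiff ℝ ∞ X) : ContDiff ℝ ∞ (dt X) :=
  (hX.fderiv_right (by simp)).clm_apply contDiff_const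

theorem dx_eq_fderiv {u : R3 → ℝ} (hu : ContDiff ℝ ∞ u) (p : R3) :
    dx u p = fderiv ℝ u p (1, 0, 0) := by
  have h1 : HasDerivAt (fun t : ℝ => ((t, p.2.1, p.2.2) : R3)) (1, 0, 0) p.1 :=
    (hasDerivAt_id p.1).prodMk ((hasDerivAt_const _ _).prodMk (hasDerivAt_const _ _))
  exact (((hu.differentiable (by simp) p).hasFDerivAt).comp_hasDerivAt p.1 h1).deriv

theorem dy₁_eq_fderiv {u : R3 → ℝ} (hu : ContDiff ℝ ∞ u) (p : R3) :
    dy₁ u p = fderiv ℝ u p (0, 1, 0) := by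
  have h1 : HasDerivAt (fun t : ℝ => ((p.1, t, p.2.2) : R3)) (0, 1, 0) p.2.1 :=
    (hasDerivAt_const _ _).prodMk ((hasDerivAt_id _).prodMk (hasDerivAt_const _ _))
  exact (((hu.differentiable (by simp) p).hasFDerivAt).comp_hasDerivAt p.2.1 h1).deriv

theorem hasDerivAt_dy₂ {u : R3 → ℝ} (hu : ContDiff ℝ ∞ u) (p : R3) :
    HasDerivAt (fun t => u (p.1, p.2.1, t)) (fderiv ℝ u p (0, 0, 1)) p.2.2 := by
  have h1 : HasDerivAt (fun t : ℝ => ((p.1, p.2.1, t) : R3)) (0, 0, 1) p.2.2 :=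
    (hasDerivAt_const _ _).prodMk ((hasDerivAt_const _ _).prodMk (hasDerivAt_id _))
  exact ((hu.differentiable (by simp) p).hasFDerivAt).comp_hasDerivAt p.2.2 h1

theorem dy₂_eq_fderiv {u : R3 → ℝ} (hu : ContDiff ℝ ∞ u) (p : R3) :
    dy₂ u p = fderiv ℝ u p (0, 0, 1) := (hasDerivAt_dy₂ hu p).deriv

theorem contDiff_dx {u : R3 → ℝ} (hu : ContDiff ℝ ∞ u) : ContDiff ℝ ∞ (dx u) := by
  rw [show dx u = fun p => fderiv ℝ u p (1, 0, 0) from funext (dx_eq_fderiv hu)]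
  exact (hu.fderiv_right (by simp)).clm_apply contDiff_const

theorem contDiff_dy₁ {u : R3 → ℝ} (hu : ContDiff ℝ ∞ u) : ContDiff ℝ ∞ (dy₁ u) := by
  rw [show dy₁ u = fun p => fderiv ℝ u p (0, 1, 0) from funext (dy₁_eq_fderiv hu)]
  exact (hu.fderiv_right (by simp)).clm_apply contDiff_const

theorem contDiff_dy₂ {u : R3 → ℝ} (hu : ContDiff ℝ ∞ u) : ContDiff ℝ ∞ (dy₂ u) := by
  rw [show dy₂ u = fun p => fderiv ℝ u p (0, 0, 1) from funext (dy₂_eq_fderiv hu)]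
  exact (hu.fderiv_right (by simp)).clm_apply contDiff_const

theorem fderiv_apply_eq {u : R3 → ℝ} (hu : ContDiff ℝ ∞ u) (p v : R3) :
    fderiv ℝ u p v = v.1 * dx u p + v.2.1 * dy₁ u p + v.2.2 * dy₂ u p := by
  have hv : v = v.1 • (1, 0, 0) + v.2.1 • (0, 1, 0) + v.2.2 • (0, 0, 1) := by
    ext <;> simp
  rw [dx_eq_fderiv hu, dy₁_eq_fderiv hu, dy₂_eq_fderiv hu]
  conv_lhs => rw [hv]
  simp only [map_add, map_smul, smul_eq_mul]

end Partial

/-- A smooth field vanishing on `{x = 0}` is `x` times a smooth field. -/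
theorem exists_eq_smul_field {f g₁ g₂ : R3 → ℝ}
    (hf : ContDiff ℝ ∞ f) (hg₁ : ContDiff ℝ ∞ g₁) (hg₂ : ContDiff ℝ ∞ g₂)
    (h_i : ∀ y₁ y₂ : ℝ, field f g₁ g₂ (0, y₁, y₂) = 0) :
    ∃ G : R3 → R3, ContDiff ℝ ∞ G ∧ (∀ p, field f g₁ g₂ p = p.1 • G p) ∧
      ∀ y₁ y₂, G (0, y₁, y₂) =
        (dx f (0, y₁, y₂), dx g₁ (0, y₁, y₂), dx g₂ (0, y₁, y₂)) := by
  have hF : ContDiff ℝ ∞ (field f g₁ g₂) := hf.prodMk (hg₁.prodMk hg₂)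
  set F := field f g₁ g₂ with hFdef
  have hD : ContDiff ℝ ∞ fun p => fderiv ℝ F p (1, 0, 0) :=
    (hF.fderiv_right (by simp)).clm_apply contDiff_const
  -- `A p + t • B p` runs from the projection of `p` to the plane `{x = 0}`, where the field
  -- vanishes, to `p` itself.
  let A : R3 →L[ℝ] R3 := ContinuousLinearMap.inr ℝ ℝ (ℝ × ℝ) ∘L ContinuousLinearMap.snd ℝ ℝ (ℝ × ℝ)
  let B : R3 →L[ℝ] R3 := ContinuousLinearMap.inl ℝ ℝ (ℝ × ℝ) ∘L ContinuousLinearMap.fst ℝ ℝ (ℝ × ℝ)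
  have hA : ∀ p, A p = (0, p.2.1, p.2.2) := fun p => rfl
  have hB : ∀ p, B p = (p.1, 0, 0) := fun p => rfl
  refine ⟨_, contDiff_integral_segment hD A B, fun p => ?_, fun y₁ y₂ => ?_⟩
  · have h1 := sub_eq_integral_fderiv hF (A p) (B p)
    have h2 : A p + B p = p := by rw [hA, hB]; ext <;> simp
    have h3 : F (A p) = 0 := h_i _ _
    rw [h2, h3, sub_zero] at h1
    rw [h1, ← intervalIntegral.integral_smul]
    apply intervalIntegral.integral_congr
    intro t _
    have h4 : B p = p.1 • (1, 0, 0) := by rw [hB]; ext <;> simp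
    exact (congrArg (fderiv ℝ F (A p + t • B p)) h4).trans (map_smul _ _ _)
  · have h5 : ∀ t : ℝ, A (0, y₁, y₂) + t • B (0, y₁, y₂) = (0, y₁, y₂) := by
      intro t; rw [hA, hB]; ext <;> simp
    simp only [h5, intervalIntegral.integral_const, sub_zero, one_smul]
    rw [dx_eq_fderiv hf, dx_eq_fderiv hg₁, dx_eq_fderiv hg₂]
    have h6 : HasFDerivAt F _ (0, y₁, y₂) :=
      (hf.differentiable (by simp) (0, y₁, y₂)).hasFDerivAt.prodMk
        ((hg₁.differentiable (by simp) (0, y₁, y₂)).hasFDerivAt.prodMk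
          (hg₂.differentiable (by simp) (0, y₁, y₂)).hasFDerivAt)
    rw [h6.fderiv]
    rfl

/-- Coordinates `w = (u₀, u₁, τ) = Θ p` that straighten the trajectories of `F`: in these
coordinates `F = (0, 0, X)`, where `X` is the coordinate `x` as a function of `w`. -/
structure IsFlowBox (F : R3 → R3) (Θ : OpenPartialHomeomorph R3 R3) (X : R3 → ℝ) : Prop where
  zero_mem : (0 : R3) ∈ Θ.source
  map_zero : Θ 0 = 0
  smooth : ContDiffOn ℝ ∞ Θ Θ.source
  smooth_symm : ContDiffOn ℝ ∞ Θ.symm Θ.target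
  smooth_X : ContDiff ℝ ∞ X
  fst_symm : ∀ w ∈ Θ.target, (Θ.symm w).1 = X w
  fderiv_symm : ∀ w ∈ Θ.target, fderiv ℝ Θ.symm w (0, 0, X w) = F (Θ.symm w)
  fderiv_map : ∀ p ∈ Θ.source, fderiv ℝ Θ p (F p) = (0, 0, X (Θ p))

/-- The cusp singularity at `w = 0` with nonzero third derivative `m`. -/
structure IsCuspUnfolding (X : R3 → ℝ) (m : ℝ) : Prop where
  smooth : ContDiff ℝ ∞ X
  zero : X 0 = 0
  du₀ : fderiv ℝ X 0 (1, 0, 0) ≠ 0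
  du₁ : fderiv ℝ X 0 (0, 1, 0) = 0
  dt_zero : dt X 0 = 0
  dtt_zero : dt (dt X) 0 = 0
  dttt : dt (dt (dt X)) 0 = m
  du₁_dt : fderiv ℝ (dt X) 0 (0, 1, 0) ≠ 0

theorem dt_comp_eq {G P : R3 → R3} (hP : ContDiff ℝ ∞ P) {s : Set R3} (hs : IsOpen s)
    (hPG : ∀ w ∈ s, fderiv ℝ P w (0, 0, 1) = G (P w)) {Y u : R3 → ℝ} (hu : ContDiff ℝ ∞ u)
    (hY : ∀ w ∈ s, Y w = u (P w)) {w : R3} (hw : w ∈ s) : dt Y w = fderiv ℝ u (P w) (G (P w)) := by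
  have h1 : Y =ᶠ[𝓝 w] u ∘ P := by
    filter_upwards [hs.mem_nhds hw] with v hv using hY v hv
  rw [dt, h1.fderiv_eq, fderiv_comp w (hu.differentiable (by simp) _)
    (hP.differentiable (by simp) _), ContinuousLinearMap.comp_apply, hPG w hw]

/-- The chart is the inverse of the flow map of `G` from the section `y₂ = 0`, where `F = x • G`.
Each `∂_τ` becomes a derivative along `G`. On the plane `{x = 0}` the first component of `G` is `∂_x
f`, which turns the hypotheses at the origin into conditions on the `τ`-derivatives of `X`. -/
theorem exists_flowBox {f g₁ g₂ : R3 → ℝ}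
    (hf : ContDiff ℝ ∞ f) (hg₁ : ContDiff ℝ ∞ g₁) (hg₂ : ContDiff ℝ ∞ g₂)
    (h_i : ∀ y₁ y₂ : ℝ, field f g₁ g₂ (0, y₁, y₂) = 0)
    (h_ii : dx f 0 = 0) (h_iii : 0 < dy₁ (dx f) 0 ∧ dy₂ (dx f) 0 = 0)
    (h_iv : dx g₁ 0 = 0) (h_vi : 0 < dx g₂ 0) :
    ∃ (Θ : OpenPartialHomeomorph R3 R3) (X : R3 → ℝ), IsFlowBox (field f g₁ g₂) Θ X ∧
      IsCuspUnfolding X (dx g₂ 0 * kappa f g₁ g₂) ∧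
      (∀ w ∈ Θ.target, X w = 0 → dt X w = dx f (Θ.symm w)) ∧
      fderiv ℝ Θ.symm 0 (0, 0, 1) = (0, 0, dx g₂ 0) := by
  obtain ⟨G, hG, hFG, hG0⟩ := exists_eq_smul_field hf hg₁ hg₂ h_i
  set F := field f g₁ g₂ with hF
  obtain ⟨φ, hφ, hφ0, hφt⟩ := exists_smooth_flow hG
  set c := dx g₂ 0 with hc
  have hG00 : G 0 = (0, 0, c) := by
    have := hG0 0 0
    rw [show ((0, 0, 0) : R3) = 0 from rfl, h_ii, h_iv] at this
    exact this
  let P : R3 → R3 := fun w => φ (w.2.2, (w.1, w.2.1, 0))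
  have hP : ContDiff ℝ ∞ P := hφ.comp (by fun_prop)
  have hlift : Continuous fun w : R3 => ((w.2.2, (w.1, w.2.1, 0)) : ℝ × R3) := by fun_prop
  have hPt : ∀ᶠ w in 𝓝 (0 : R3), fderiv ℝ P w (0, 0, 1) = G (P w) := by
    have h1 := (hlift.tendsto 0).eventually hφt
    filter_upwards [h1] with w hw
    have h2 : HasDerivAt (fun t : ℝ => ((w.1, w.2.1, t) : R3)) (0, 0, 1) w.2.2 :=
      (hasDerivAt_const _ _).prodMk ((hasDerivAt_const _ _).prodMk (hasDerivAt_id _))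
    have h3 := ((hP.differentiable (by simp) w).hasFDerivAt).comp_hasDerivAt w.2.2 h2
    exact h3.unique hw
  have hP0 : ∀ᶠ u in 𝓝 (0 : R3), P (u.1, u.2.1, 0) = (u.1, u.2.1, 0) := by
    have hc2 : Continuous fun w : R3 => ((w.1, w.2.1, 0) : R3) := by fun_prop
    exact (hc2.tendsto 0).eventually hφ0
  have hP00 : P 0 = 0 := hP0.self_of_nhds
  have hPd := (hP.differentiable (by simp) 0).hasFDerivAt
  have hPt0 : fderiv ℝ P 0 (0, 0, 1) = (0, 0, c) := by
    rw [hPt.self_of_nhds, hP00, hG00]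
  have hPu : ∀ a b : ℝ, fderiv ℝ P 0 (a, b, 0) = (a, b, 0) := by
    intro a b
    let J : R3 →L[ℝ] R3 := (ContinuousLinearMap.fst ℝ ℝ (ℝ × ℝ)).prod
      ((ContinuousLinearMap.fst ℝ ℝ ℝ ∘L ContinuousLinearMap.snd ℝ ℝ (ℝ × ℝ)).prod 0)
    have hJ0 : J 0 = 0 := by simp
    have h1 : HasFDerivAt (P ∘ J) (fderiv ℝ P 0 ∘L J) 0 := by
      refine HasFDerivAt.comp 0 ?_ J.hasFDerivAt
      rw [hJ0]; exact hPd
    have h2 : P ∘ J =ᶠ[𝓝 0] J := hP0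
    have h3 : HasFDerivAt J (fderiv ℝ P 0 ∘L J) 0 := h1.congr_of_eventuallyEq h2.symm
    have h4 := h3.unique J.hasFDerivAt
    have := DFunLike.congr_fun h4 (a, b, 0)
    simpa [J] using this
  have hPdiff : ∀ v : R3, fderiv ℝ P 0 v = (v.1, v.2.1, c * v.2.2) := by
    intro v
    have hv : v = (v.1, v.2.1, 0) + v.2.2 • (0, 0, 1) := by ext <;> simp
    conv_lhs => rw [hv]
    rw [map_add, map_smul, hPt0, hPu]
    ext <;> simp [mul_comm]
  let L : R3 ≃L[ℝ] R3 := ContinuousLinearEquiv.equivOfInverse (fderiv ℝ P 0)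
    ((ContinuousLinearMap.fst ℝ ℝ (ℝ × ℝ)).prod
      ((ContinuousLinearMap.fst ℝ ℝ ℝ ∘L ContinuousLinearMap.snd ℝ ℝ (ℝ × ℝ)).prod
        (c⁻¹ • (ContinuousLinearMap.snd ℝ ℝ ℝ ∘L ContinuousLinearMap.snd ℝ ℝ (ℝ × ℝ)))))
    (by intro v; rw [hPdiff]; ext <;> simp [h_vi.ne'])
    (by intro v; rw [hPdiff]; ext <;> simp [h_vi.ne'])
  obtain ⟨e₀, h0e₀, he₀, hsm₀⟩ := exists_smooth_inverse hP L hPd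
  obtain ⟨s, hss, hso, h0s⟩ := eventually_nhds_iff.1 hPt
  let e := e₀.restrOpen s hso
  have hes : e.source ⊆ s := fun w hw => hw.2
  have heP : ∀ w, e w = P w := he₀
  have h0e : (0 : R3) ∈ e.source := ⟨h0e₀, h0s⟩
  have heP' : (e : R3 → R3) = P := funext heP
  have hsm : ContDiffOn ℝ ∞ e.symm e.target := hsm₀.mono (fun y hy => hy.1)
  let ft : R3 → ℝ := fun p => (G p).1
  have hft : ContDiff ℝ ∞ ft := contDiff_fst.comp hG
  let X : R3 → ℝ := fun w => (P w).1
  have hX : ContDiff ℝ ∞ X := contDiff_fst.comp hP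
  have hfst : ∀ w v, fderiv ℝ X w v = (fderiv ℝ P w v).1 := by
    intro w v
    have h1 : HasFDerivAt X (ContinuousLinearMap.fst ℝ ℝ (ℝ × ℝ) ∘L fderiv ℝ P w) w :=
      (ContinuousLinearMap.fst ℝ ℝ (ℝ × ℝ)).hasFDerivAt.comp w
        (hP.differentiable (by simp) w).hasFDerivAt
    rw [h1.fderiv]; rfl
  have hdtX : ∀ w ∈ s, dt X w = ft (P w) := by
    intro w hw
    rw [dt, hfst, hss w hw]
  let lie : R3 → ℝ := fun p => fderiv ℝ ft p (G p)
  have hlie : ContDiff ℝ ∞ lie := (hft.fderiv_right (by simp)).clm_apply hG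
  have hdttX : ∀ w ∈ s, dt (dt X) w = lie (P w) := fun w hw => dt_comp_eq hP hso hss hft hdtX hw
  have hdtttX : ∀ w ∈ s, dt (dt (dt X)) w = fderiv ℝ lie (P w) (G (P w)) :=
    fun w hw => dt_comp_eq hP hso hss hlie hdttX hw
  have hft0 : ∀ y₁ y₂, ft (0, y₁, y₂) = dx f (0, y₁, y₂) := fun y₁ y₂ => by
    simp only [ft, hG0]
  have hft1 : ∀ y₁ y₂, dy₁ ft (0, y₁, y₂) = dy₁ (dx f) (0, y₁, y₂) := fun y₁ y₂ => by
    simp only [dy₁, hft0]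
  have hft2 : ∀ y₁ y₂, dy₂ ft (0, y₁, y₂) = dy₂ (dx f) (0, y₁, y₂) := fun y₁ y₂ => by
    simp only [dy₂, hft0]
  have hft00 : ft 0 = 0 := (hft0 0 0).trans h_ii
  -- As `G 0` points along the `y₂`-axis, the third derivative needs `lie` only on that axis.
  -- Differentiating this formula at `0`, the uncontrolled factor `dx ft` disappears because `dx f`
  -- and its `y₂`-derivative vanish there; what remains is `kappa`.
  have hlie_axis : ∀ t : ℝ, lie (0, 0, t) = dx f (0, 0, t) * dx ft (0, 0, t) +
      dx g₁ (0, 0, t) * dy₁ (dx f) (0, 0, t) + dx g₂ (0, 0, t) * dy₂ (dx f) (0, 0, t) := by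
    intro t
    simp only [lie]
    rw [fderiv_apply_eq hft, hG0, hft1, hft2]
  have hlie0 : lie 0 = 0 := by
    have := hlie_axis 0
    rw [show ((0, 0, 0) : R3) = 0 from rfl, h_ii, h_iv, h_iii.2] at this
    simpa using this
  have hlie_dt : fderiv ℝ lie 0 (0, 0, 1) = kappa f g₁ g₂ := by
    have e1 : HasDerivAt (fun t : ℝ => lie (0, 0, t)) (fderiv ℝ lie 0 (0, 0, 1)) 0 :=
      hasDerivAt_dy₂ hlie 0
    have hax : ∀ {u : R3 → ℝ}, ContDiff ℝ ∞ u →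
        HasDerivAt (fun t : ℝ => u (0, 0, t)) (dy₂ u 0) 0 := by
      intro u hu
      rw [dy₂_eq_fderiv hu]
      exact hasDerivAt_dy₂ hu 0
    have e2 := (((hax (contDiff_dx hf)).mul (hax (contDiff_dx hft))).add
      ((hax (contDiff_dx hg₁)).mul (hax (contDiff_dy₁ (contDiff_dx hf))))).add
      ((hax (contDiff_dx hg₂)).mul (hax (contDiff_dy₂ (contDiff_dx hf))))
    have e3 := e1.unique (e2.congr_of_eventuallyEq (Eventually.of_forall hlie_axis))
    rw [e3, show ((0, 0, 0) : R3) = 0 from rfl, h_ii, h_iv, h_iii.2, kappa]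
    ring
  have hsymm : e.symm.target = e.source := rfl
  have hleft : ∀ w ∈ e.source, (fderiv ℝ e.symm (P w)) ∘L (fderiv ℝ P w) =
      ContinuousLinearMap.id ℝ R3 := by
    intro w hw
    have hPw : P w ∈ e.target := by rw [← heP]; exact e.map_source hw
    have d1 : HasFDerivAt e.symm (fderiv ℝ e.symm (P w)) (P w) :=
      ((hsm.contDiffAt (e.open_target.mem_nhds hPw)).differentiableAt (by simp)).hasFDerivAt
    have d2 := d1.comp w (hP.differentiable (by simp) w).hasFDerivAt
    have d3 : (e.symm ∘ P) =ᶠ[𝓝 w] id := by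
      filter_upwards [e.open_source.mem_nhds hw] with v hv
      simp only [Function.comp_apply, id]
      rw [← heP, e.left_inv hv]
    exact d2.unique ((hasFDerivAt_id w).congr_of_eventuallyEq d3)
  have hPF : ∀ w ∈ e.source, fderiv ℝ P w (0, 0, X w) = F (P w) := by
    intro w hw
    have h1 : ((0, 0, X w) : R3) = X w • (0, 0, 1) := by ext <;> simp
    rw [h1, map_smul, hss w (hes hw), hFG]
  refine ⟨e.symm, X, ⟨?_, ?_, hsm, ?_, hX, ?_, ?_, ?_⟩, ⟨hX, ?_, ?_, ?_, ?_, ?_, ?_, ?_⟩, ?_, ?_⟩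
  · have := e.map_source h0e
    rwa [heP, hP00] at this
  · have := e.left_inv h0e
    rwa [heP, hP00] at this
  · change ContDiffOn ℝ ∞ e e.source
    rw [heP']; exact hP.contDiffOn
  · intro w _
    change (e w).1 = _
    rw [heP]
  · intro w hw
    change fderiv ℝ e w _ = F (e w)
    rw [heP']
    exact hPF w hw
  · intro p hp
    have hw : e.symm p ∈ e.source := e.map_target hp
    have hPw : P (e.symm p) = p := by rw [← heP, e.right_inv hp]
    have h1 := hPF _ hw
    have h2 := hleft _ hw
    rw [hPw] at h1 h2
    rw [← h1, ← ContinuousLinearMap.comp_apply, h2]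
    rfl
  · change (P 0).1 = 0
    rw [hP00]; rfl
  · rw [hfst, hPdiff]; simp
  · rw [hfst, hPdiff]
  · rw [hdtX 0 h0s, hP00, hft00]
  · rw [hdttX 0 h0s, hP00, hlie0]
  · have h1 : ((0, 0, c) : R3) = c • (0, 0, 1) := by ext <;> simp
    rw [hdtttX 0 h0s, hP00, hG00, h1, map_smul, hlie_dt, smul_eq_mul]
  · have h1 : dt X =ᶠ[𝓝 0] ft ∘ P := by
      filter_upwards [hso.mem_nhds h0s] with v hv using hdtX v hv
    have hftd : DifferentiableAt ℝ ft (P 0) := hft.differentiable (by simp) _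
    rw [h1.fderiv_eq, fderiv_comp 0 hftd (hP.differentiable (by simp) _),
      ContinuousLinearMap.comp_apply, hPdiff, hP00]
    have h2 := hft1 0 0
    rw [show ((0, 0, 0) : R3) = 0 from rfl, dy₁_eq_fderiv hft] at h2
    simp only [mul_zero]
    rw [h2]
    exact h_iii.1.ne'
  · intro w hw hXw
    change dt X w = dx f (e w)
    rw [hdtX w (hes hw), heP]
    have h1 : P w = (0, (P w).2.1, (P w).2.2) := Prod.ext hXw rfl
    rw [h1]
    exact hft0 _ _
  · change fderiv ℝ e 0 _ = _
    rw [heP', hPt0]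

end DriftSing

namespace DriftSing

/-! ### Finite-dimensional forms in which injectivity of the derivative suffices. -/

section FiniteDim

variable {E F : Type*} [NormedAddCommGroup E] [NormedSpace ℝ E] [NormedAddCommGroup F]
  [NormedSpace ℝ F] [FiniteDimensional ℝ E] [FiniteDimensional ℝ F]

theorem exists_equiv_of_injective (T : E →L[ℝ] E) (hT : ∀ v, T v = 0 → v = 0) :
    ∃ L : E ≃L[ℝ] E, (L : E →L[ℝ] E) = T := by
  have hinj : Function.Injective (T : E →ₗ[ℝ] E) :=
    (injective_iff_map_eq_zero (T : E →ₗ[ℝ] E)).2 hT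
  refine ⟨(LinearEquiv.ofInjectiveEndo (T : E →ₗ[ℝ] E) hinj).toContinuousLinearEquiv, ?_⟩
  ext v
  rfl

/-- Inverse function theorem for an endomorphism with injective derivative. -/
theorem exists_smooth_inverse_of_injective {f : E → E} (hf : ContDiff ℝ ∞ f) {a : E}
    (hinj : ∀ v, fderiv ℝ f a v = 0 → v = 0) :
    ∃ e : OpenPartialHomeomorph E E, a ∈ e.source ∧ (∀ x, e x = f x) ∧
      ContDiffOn ℝ ∞ e.symm e.target := by
  have : CompleteSpace E := FiniteDimensional.complete ℝ E
  obtain ⟨L, hL⟩ := exists_equiv_of_injective _ hinj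
  refine exists_smooth_inverse hf L ?_
  rw [hL]
  exact (hf.differentiable (by simp) a).hasFDerivAt

/-- Implicit function theorem for an injective partial derivative. -/
theorem exists_smooth_implicit_of_injective {Q : E × F → F} (hQ : ContDiff ℝ ∞ Q)
    (h0 : Q 0 = 0) (hinj : ∀ y, fderiv ℝ Q 0 (0, y) = 0 → y = 0) :
    ∃ ψ : E → F, ContDiff ℝ ∞ ψ ∧ ψ 0 = 0 ∧
      (∀ᶠ p in 𝓝 (0 : E × F), Q p = 0 ↔ p.2 = ψ p.1) ∧
      (∀ᶠ x in 𝓝 (0 : E), Q (x, ψ x) = 0) ∧ ∀ v, fderiv ℝ Q 0 (v, fderiv ℝ ψ 0 v) = 0 := by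
  have : CompleteSpace F := FiniteDimensional.complete ℝ F
  obtain ⟨L, hL⟩ := exists_equiv_of_injective
    (fderiv ℝ Q 0 ∘L ContinuousLinearMap.inr ℝ E F) (fun v hv => hinj v hv)
  obtain ⟨ψ, hψ, hψ0, hiff⟩ := exists_smooth_implicit hQ h0 L
    (fun y => (DFunLike.congr_fun hL y).symm)
  have hgc : Continuous fun x : E => (x, ψ x) := continuous_id.prodMk hψ.continuous
  have hev : ∀ᶠ x in 𝓝 (0 : E), Q (x, ψ x) = 0 := by
    have h1 : Tendsto (fun x : E => (x, ψ x)) (𝓝 0) (𝓝 (0 : E × F)) := by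
      have := hgc.tendsto 0
      rwa [hψ0] at this
    filter_upwards [h1.eventually hiff] with x hx
    exact hx.2 rfl
  refine ⟨ψ, hψ, hψ0, hiff, hev, fun v => ?_⟩
  have hg : HasFDerivAt (fun x : E => (x, ψ x))
      ((ContinuousLinearMap.id ℝ E).prod (fderiv ℝ ψ 0)) 0 :=
    (hasFDerivAt_id 0).prodMk (hψ.differentiable (by simp) 0).hasFDerivAt
  have hQd : HasFDerivAt Q (fderiv ℝ Q 0) ((0 : E), ψ 0) := by
    rw [hψ0]
    exact (hQ.differentiable (by simp) 0).hasFDerivAt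
  have hcomp := hQd.comp (0 : E) hg
  have hz : (Q ∘ fun x : E => (x, ψ x)) =ᶠ[𝓝 0] fun _ => 0 := hev
  have huniq := hcomp.unique ((hasFDerivAt_const (0 : F) (0 : E)).congr_of_eventuallyEq hz)
  have := DFunLike.congr_fun huniq v
  simpa using this

end FiniteDim

/-! ### Division by a cubic with parameters, and the cusp normal form. -/

section Division

variable {Λ : Type} [NormedAddCommGroup Λ] [NormedSpace ℝ Λ]

/-- Division of `τ ^ n` by the cubic `a τ³ + z₁ τ + z₀` with parameters. -/
theorem exists_pow_division {z₀ z₁ : Λ → ℝ} (hz₀ : ContDiff ℝ ∞ z₀) (hz₁ : ContDiff ℝ ∞ z₁)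
    {a : ℝ} (ha : a ≠ 0) (n : ℕ) :
    ∃ (D : Λ × ℝ → ℝ) (q₀ q₁ q₂ : Λ → ℝ), ContDiff ℝ ∞ D ∧ ContDiff ℝ ∞ q₀ ∧
      ContDiff ℝ ∞ q₁ ∧ ContDiff ℝ ∞ q₂ ∧ ∀ l t, t ^ n =
        D (l, t) * (a * t ^ 3 + z₁ l * t + z₀ l) + q₀ l + q₁ l * t + q₂ l * t ^ 2 := by
  induction n with
  | zero =>
    exact ⟨fun _ => 0, fun _ => 1, fun _ => 0, fun _ => 0, contDiff_const, contDiff_const,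
      contDiff_const, contDiff_const, fun l t => by simp⟩
  | succ n ih =>
    obtain ⟨D, q₀, q₁, q₂, hD, h₀, h₁, h₂, h⟩ := ih
    -- Multiply the identity for `n` by `t` and replace `q₂ t³` by `q₂ / a` times the cubic minus
    -- its lower terms.
    refine ⟨fun p => p.2 * D p + q₂ p.1 / a, fun l => - q₂ l * z₀ l / a,
      fun l => q₀ l - q₂ l * z₁ l / a, q₁, ?_, ?_, ?_, h₁, fun l t => ?_⟩
    · exact (contDiff_snd.mul hD).add ((h₂.comp contDiff_fst).div_const a)
    · exact (h₂.neg.mul hz₀).div_const a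
    · exact h₀.sub ((h₂.mul hz₁).div_const a)
    · rw [pow_succ, h l t]
      field_simp
      ring

/-- Division of a smooth function by a cubic with parameters, up to high order in `τ`. -/
theorem exists_division {z₀ z₁ : Λ → ℝ} (hz₀ : ContDiff ℝ ∞ z₀) (hz₁ : ContDiff ℝ ∞ z₁)
    {a : ℝ} (ha : a ≠ 0) {A : Λ × ℝ → ℝ} (hA : ContDiff ℝ ∞ A) (n : ℕ) :
    ∃ (D : Λ × ℝ → ℝ) (q₀ q₁ q₂ : Λ → ℝ) (R : Λ × ℝ → ℝ), ContDiff ℝ ∞ D ∧ ContDiff ℝ ∞ q₀ ∧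
      ContDiff ℝ ∞ q₁ ∧ ContDiff ℝ ∞ q₂ ∧ ContDiff ℝ ∞ R ∧ ∀ l t, A (l, t) =
        D (l, t) * (a * t ^ 3 + z₁ l * t + z₀ l) + q₀ l + q₁ l * t + q₂ l * t ^ 2 +
          t ^ n * R (l, t) := by
  induction n with
  | zero =>
    exact ⟨fun _ => 0, fun _ => 0, fun _ => 0, fun _ => 0, A, contDiff_const, contDiff_const,
      contDiff_const, contDiff_const, hA, fun l t => by simp⟩
  | succ n ih =>
    obtain ⟨D, q₀, q₁, q₂, R, hD, h₀, h₁, h₂, hR, h⟩ := ih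
    obtain ⟨D', p₀, p₁, p₂, hD', k₀, k₁, k₂, k⟩ := exists_pow_division hz₀ hz₁ ha n
    -- Hadamard's lemma splits `R` into `R (l, 0)`, whose product with `t ^ n` is divided by the
    -- cubic, and a multiple of `t`, which raises the order of the remainder.
    obtain ⟨R₁, hR₁, hRR⟩ := exists_hadamard hR
    have hR0 : ContDiff ℝ ∞ fun l => R (l, 0) := hR.comp (by fun_prop)
    refine ⟨fun p => D p + R (p.1, 0) * D' p, fun l => q₀ l + R (l, 0) * p₀ l,
      fun l => q₁ l + R (l, 0) * p₁ l, fun l => q₂ l + R (l, 0) * p₂ l, R₁,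
      hD.add ((hR0.comp contDiff_fst).mul hD'), h₀.add (hR0.mul k₀), h₁.add (hR0.mul k₁),
      h₂.add (hR0.mul k₂), hR₁, fun l t => ?_⟩
    have e1 := h l t
    have e2 := hRR l t
    have e3 := k l t
    rw [e1, e2, smul_eq_mul, pow_succ]
    linear_combination R (l, 0) * e3

/-- Evaluation at `0` kills the constant; the rest can be divided by `t` away from `0`, and
continuity extends the quotient identity to `0`. -/
theorem coeff_eq_zero {c₀ c₁ c₂ c₃ : ℝ} {r : ℝ → ℝ} (hr : Continuous r)
    (h : ∀ t, c₀ + c₁ * t + c₂ * t ^ 2 + c₃ * t ^ 3 + t ^ 4 * r t = 0) :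
    c₀ = 0 ∧ c₁ = 0 ∧ c₂ = 0 ∧ c₃ = 0 := by
  have step : ∀ {u : ℝ → ℝ} {c : ℝ}, Continuous u → (∀ t, c + t * u t = 0) →
      c = 0 ∧ ∀ t, u t = 0 := by
    intro u c hu hcu
    have hc : c = 0 := by simpa using hcu 0
    refine ⟨hc, fun t => ?_⟩
    have hdense : Dense {t : ℝ | t ≠ 0} := dense_compl_singleton 0
    refine congrFun (hu.ext_on hdense continuous_const (g := fun _ => (0 : ℝ)) ?_) t
    intro s hs
    have := hcu s
    rw [hc, zero_add] at this
    exact (mul_eq_zero.1 this).resolve_left hs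
  obtain ⟨h0, h'⟩ := step (c := c₀) (u := fun t => c₁ + t * (c₂ + t * (c₃ + t * r t)))
    (by fun_prop) (fun t => by rw [← h t]; ring)
  obtain ⟨h1, h'⟩ := step (c := c₁) (u := fun t => (c₂ + t * (c₃ + t * r t))) (by fun_prop) h'
  obtain ⟨h2, h'⟩ := step (c := c₂) (u := fun t => (c₃ + t * r t)) (by fun_prop) h'
  obtain ⟨h3, h'⟩ := step (c := c₃) (u := r) (by fun_prop) h'
  exact ⟨h0, h1, h2, h3⟩

end Division

/-- The linear factor vanishes at `0`, so the derivative of `e` does not contribute. Hence the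
division quotient and its `t`-derivatives enter the linearization only through their values at the
origin. -/
theorem fderiv_mul_of_zero {Λ : Type} [NormedAddCommGroup Λ] [NormedSpace ℝ Λ] {e : Λ → ℝ}
    (he : ContDiff ℝ ∞ e) (z : Λ →L[ℝ] ℝ) :
    HasFDerivAt (fun l => e l * z l) (e 0 • z) 0 := by
  have := (he.differentiable (by simp) 0).hasFDerivAt.mul (z.hasFDerivAt (x := 0))
  convert! this using 1
  simp

/-- Taylor expansion of `X (u₀, u₁, s + t)` in `t`. -/
theorem exists_taylor_shift {X : R3 → ℝ} (hX : ContDiff ℝ ∞ X) :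
    ∃ R : R3 × ℝ → ℝ, ContDiff ℝ ∞ R ∧ ∀ (w : R3) (t : ℝ), X (w.1, w.2.1, w.2.2 + t) =
      X w + t * dt X w + t ^ 2 * (dt (dt X) w / 2) + t ^ 3 * (dt (dt (dt X)) w / 6) +
        t ^ 4 * R (w, t) := by
  let S : R3 × ℝ → R3 := fun p => (p.1.1, p.1.2.1, p.1.2.2 + p.2)
  have hS : ContDiff ℝ ∞ S := by fun_prop
  have hpd : ∀ {Y : R3 → ℝ}, ContDiff ℝ ∞ Y → pd (fun p => Y (S p)) = fun p => dt Y (S p) := by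
    intro Y hY
    funext ⟨w, t⟩
    have h1 := hasDerivAt_slice (hY.comp hS) w t
    have h2 : HasDerivAt (fun t : ℝ => ((w.1, w.2.1, w.2.2 + t) : R3)) (0, 0, 1) t :=
      (hasDerivAt_const _ _).prodMk ((hasDerivAt_const _ _).prodMk
        ((hasDerivAt_id _).const_add _))
    exact h1.unique (((hY.differentiable (by simp) _).hasFDerivAt).comp_hasDerivAt t h2)
  obtain ⟨R, hR, h⟩ := exists_taylor (hX.comp hS)
  refine ⟨R, hR, fun w t => ?_⟩
  have h1 : pd (X ∘ S) = fun p => dt X (S p) := hpd hX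
  have h2 : pd (pd (X ∘ S)) = fun p => dt (dt X) (S p) := by rw [h1]; exact hpd (contDiff_dt hX)
  have h3 : pd (pd (pd (X ∘ S))) = fun p => dt (dt (dt X)) (S p) := by
    rw [h2]; exact hpd (contDiff_dt (contDiff_dt hX))
  have := h w t
  rw [h3, h2, h1] at this
  simpa [S] using this

/-- A cusp unfolding is equivalent to the cusp normal form up to high order. -/
theorem exists_normalForm {X : R3 → ℝ} {m : ℝ} (hX : IsCuspUnfolding X m) {a : ℝ}
    (ham : 0 < m / a) (N : ℕ) :
    ∃ (H : OpenPartialHomeomorph R3 R3) (μ r : R3 → ℝ), (0 : R3) ∈ H.source ∧ H 0 = 0 ∧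
      ContDiffOn ℝ ∞ H H.source ∧ ContDiffOn ℝ ∞ H.symm H.target ∧
      ContDiffOn ℝ ∞ μ H.source ∧ (∀ w ∈ H.source, 0 < μ w) ∧
      ContDiffOn ℝ ∞ r H.target ∧ (∀ z ∈ H.target, |r z| ≤ |z.2.2| ^ N) ∧
      ∀ w ∈ H.source, fderiv ℝ H w (0, 0, X w) = μ w • cuspField a r (H w) := by
  have ha : a ≠ 0 := by rintro rfl; simp at ham
  have hm : m ≠ 0 := by rintro rfl; simp at ham
  -- A parameter is `((u₀, u₁), (s, z₀, z₁))`: the transverse coordinates, a shift of `τ`, and the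
  -- coefficients of the cubic. The last three are the unknowns for the implicit function theorem.
  let Λ : Type := (ℝ × ℝ) × R3
  let z₀ : Λ →L[ℝ] ℝ := ContinuousLinearMap.fst ℝ ℝ ℝ ∘L ContinuousLinearMap.snd ℝ ℝ (ℝ × ℝ) ∘L
    ContinuousLinearMap.snd ℝ (ℝ × ℝ) R3
  let z₁ : Λ →L[ℝ] ℝ := ContinuousLinearMap.snd ℝ ℝ ℝ ∘L ContinuousLinearMap.snd ℝ ℝ (ℝ × ℝ) ∘L
    ContinuousLinearMap.snd ℝ (ℝ × ℝ) R3
  let π : Λ →L[ℝ] R3 :=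
    (ContinuousLinearMap.fst ℝ ℝ ℝ ∘L ContinuousLinearMap.fst ℝ (ℝ × ℝ) R3).prod
      ((ContinuousLinearMap.snd ℝ ℝ ℝ ∘L ContinuousLinearMap.fst ℝ (ℝ × ℝ) R3).prod
        (ContinuousLinearMap.fst ℝ ℝ (ℝ × ℝ) ∘L ContinuousLinearMap.snd ℝ (ℝ × ℝ) R3))
  have hz₀ : ContDiff ℝ ∞ z₀ := z₀.contDiff
  have hz₁ : ContDiff ℝ ∞ z₁ := z₁.contDiff
  let A : Λ × ℝ → ℝ := fun p => X ((π p.1).1, (π p.1).2.1, (π p.1).2.2 + p.2)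
  have hA : ContDiff ℝ ∞ A := by
    have hXs := hX.smooth
    have hπ : ContDiff ℝ ∞ π := π.contDiff
    refine hXs.comp ?_
    fun_prop
  -- The four powers beyond `N` serve twice: the coefficients of `1, t, t², t³` can be compared
  -- without the remainder, and near the origin the surplus `ζ ^ 4` absorbs `ρ / μ`, which leaves
  -- the constant `1` in the bound for `r`.
  obtain ⟨D, q₀, q₁, q₂, R, hD, hq₀, hq₁, hq₂, hR, hdiv⟩ :=
    exists_division hz₀ hz₁ ha hA (N + 4)
  obtain ⟨T, hT, htay⟩ := exists_taylor_shift hX.smooth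
  obtain ⟨D4, hD4, hDtay⟩ := exists_taylor hD
  -- comparison of the coefficients of `1, t, t², t³`
  have hcoef : ∀ l : Λ, q₀ l = X (π l) - D (l, 0) * z₀ l ∧
      q₁ l = dt X (π l) - pd D (l, 0) * z₀ l - D (l, 0) * z₁ l ∧
      q₂ l = dt (dt X) (π l) / 2 - pd (pd D) (l, 0) / 2 * z₀ l - pd D (l, 0) * z₁ l ∧
      dt (dt (dt X)) (π l) / 6 = a * D (l, 0) + pd (pd D) (l, 0) / 2 * z₁ l +
        pd (pd (pd D)) (l, 0) / 6 * z₀ l := by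
    intro l
    have hcont : Continuous fun t => T (π l, t) - t ^ N * R (l, t) -
        (a * (pd D (l, 0) + t * (pd (pd D) (l, 0) / 2) + t ^ 2 * (pd (pd (pd D)) (l, 0) / 6) +
          t ^ 3 * D4 (l, t)) + z₁ l * (pd (pd (pd D)) (l, 0) / 6 + t * D4 (l, t)) +
          z₀ l * D4 (l, t)) := by
      have c1 : Continuous fun t => T (π l, t) := hT.continuous.comp (by fun_prop)
      have c2 : Continuous fun t => R (l, t) := hR.continuous.comp (by fun_prop)
      have c3 : Continuous fun t => D4 (l, t) := hD4.continuous.comp (by fun_prop)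
      fun_prop
    obtain ⟨h0, h1, h2, h3⟩ := coeff_eq_zero (c₀ := X (π l) - D (l, 0) * z₀ l - q₀ l)
      (c₁ := dt X (π l) - pd D (l, 0) * z₀ l - D (l, 0) * z₁ l - q₁ l)
      (c₂ := dt (dt X) (π l) / 2 - pd (pd D) (l, 0) / 2 * z₀ l - pd D (l, 0) * z₁ l - q₂ l)
      (c₃ := dt (dt (dt X)) (π l) / 6 - (a * D (l, 0) + pd (pd D) (l, 0) / 2 * z₁ l +
        pd (pd (pd D)) (l, 0) / 6 * z₀ l)) hcont (fun t => by
          have e1 := hdiv l t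
          have e2 := htay (π l) t
          have e3 := hDtay l t
          change A (l, t) = _ at e2
          rw [e2, e3] at e1
          rw [pow_add] at e1
          linear_combination e1)
    exact ⟨by linarith, by linarith, by linarith, by linarith⟩
  have hz₀0 : z₀ 0 = 0 := map_zero _
  have hz₁0 : z₁ 0 = 0 := map_zero _
  have hπ0 : π 0 = 0 := map_zero _
  set ε₀ := D (0, 0) with hε₀
  set ε₁ := pd D (0, 0) with hε₁
  set ε₂ := pd (pd D) (0, 0) / 2 with hε₂
  -- Comparison of the `t³` coefficients at the origin gives `m / 6 = a ε₀`. This is where the sign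
  -- of `a` must match that of `m`: `ε₀` is the value at `0` of the time factor.
  have hε₀pos : 0 < ε₀ := by
    have := (hcoef 0).2.2.2
    rw [hπ0, hz₀0, hz₁0, hX.dttt] at this
    have h1 : ε₀ = m / a / 6 := by
      change _ = a * ε₀ + _ + _ at this
      field_simp
      linarith
    rw [h1]; positivity
  let Q : Λ → R3 := fun l => (q₀ l, q₁ l, q₂ l)
  have hQ : ContDiff ℝ ∞ Q := hq₀.prodMk (hq₁.prodMk hq₂)
  have hQ0 : Q 0 = 0 := by
    have := hcoef 0
    rw [hπ0, hz₀0, hz₁0, hX.zero, hX.dt_zero, hX.dtt_zero] at this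
    simp only [Q]
    rw [this.1, this.2.1, this.2.2.1]
    simp
  -- derivative of `Q` at the origin
  have hslice : ∀ {B : Λ × ℝ → ℝ}, ContDiff ℝ ∞ B → ContDiff ℝ ∞ fun l => B (l, 0) :=
    fun hB => hB.comp (by fun_prop)
  have hcomp : ∀ {Y : R3 → ℝ}, ContDiff ℝ ∞ Y →
      HasFDerivAt (fun l => Y (π l)) (fderiv ℝ Y 0 ∘L π) 0 := by
    intro Y hY
    have h1 : HasFDerivAt Y (fderiv ℝ Y 0) (π 0) := by
      rw [hπ0]; exact (hY.differentiable (by simp) 0).hasFDerivAt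
    exact h1.comp 0 π.hasFDerivAt
  have hX1 := contDiff_dt hX.smooth
  have hX2 := contDiff_dt hX1
  have hd₀ : HasFDerivAt q₀ (fderiv ℝ X 0 ∘L π - ε₀ • z₀) 0 := by
    rw [show q₀ = fun l => X (π l) - D (l, 0) * z₀ l from funext fun l => (hcoef l).1]
    exact (hcomp hX.smooth).sub (fderiv_mul_of_zero (hslice hD) z₀)
  have hd₁ : HasFDerivAt q₁ (fderiv ℝ (dt X) 0 ∘L π - ε₁ • z₀ - ε₀ • z₁) 0 := by
    rw [show q₁ = fun l => dt X (π l) - pd D (l, 0) * z₀ l - D (l, 0) * z₁ l from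
      funext fun l => (hcoef l).2.1]
    exact ((hcomp hX1).sub (fderiv_mul_of_zero (hslice (contDiff_pd hD)) z₀)).sub
      (fderiv_mul_of_zero (hslice hD) z₁)
  have hd₂ : HasFDerivAt q₂ ((2 : ℝ)⁻¹ • (fderiv ℝ (dt (dt X)) 0 ∘L π) - ε₂ • z₀ - ε₁ • z₁) 0 := by
    rw [show q₂ = fun l => (2 : ℝ)⁻¹ * dt (dt X) (π l) - pd (pd D) (l, 0) / 2 * z₀ l -
      pd D (l, 0) * z₁ l from funext fun l => by rw [(hcoef l).2.2.1]; ring]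
    refine (((hcomp hX2).const_mul (2 : ℝ)⁻¹).sub ?_).sub
      (fderiv_mul_of_zero (hslice (contDiff_pd hD)) z₁)
    exact fderiv_mul_of_zero (e := fun l => pd (pd D) (l, 0) / 2)
      ((hslice (contDiff_pd (contDiff_pd hD))).div_const 2) z₀
  have hQd : ∀ v : Λ, fderiv ℝ Q 0 v = (fderiv ℝ X 0 (π v) - ε₀ * z₀ v,
      fderiv ℝ (dt X) 0 (π v) - ε₁ * z₀ v - ε₀ * z₁ v,
      2⁻¹ * fderiv ℝ (dt (dt X)) 0 (π v) - ε₂ * z₀ v - ε₁ * z₁ v) := by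
    intro v
    have : HasFDerivAt Q _ 0 := hd₀.prodMk (hd₁.prodMk hd₂)
    rw [this.fderiv]
    rfl
  have hπs : ∀ s b c : ℝ, π ((0, 0), (s, b, c)) = s • (0, 0, 1) := by
    intro s b c
    change ((0, 0, s) : R3) = _
    simp
  -- The linearization in `(s, z₀, z₁)` is triangular: since `X`, `∂_τ X` and `∂_τ² X` vanish at `0`
  -- and `∂_τ³ X = m`, its successive pivots are `ε₀`, `ε₀` and a multiple of `m`.
  have hinj : ∀ y : R3, fderiv ℝ Q 0 ((0 : ℝ × ℝ), y) = 0 → y = 0 := by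
    rintro ⟨s, b, c⟩ h
    rw [hQd] at h
    have e0 : fderiv ℝ X 0 (0, 0, 1) = 0 := hX.dt_zero
    have e1 : fderiv ℝ (dt X) 0 (0, 0, 1) = 0 := hX.dtt_zero
    have e2 : fderiv ℝ (dt (dt X)) 0 (0, 0, 1) = m := hX.dttt
    have h' := hπs s b c
    rw [show ((0 : ℝ × ℝ), (s, b, c)) = (((0, 0), (s, b, c)) : Λ) from rfl, h', map_smul, map_smul,
      map_smul, e0, e1, e2] at h
    have hb : z₀ (((0, 0), (s, b, c)) : Λ) = b := rfl
    have hc : z₁ (((0, 0), (s, b, c)) : Λ) = c := rfl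
    rw [hb, hc] at h
    simp only [Prod.mk_eq_zero, smul_eq_mul] at h
    obtain ⟨k0, k1, k2⟩ := h
    have hb0 : b = 0 := by
      have : ε₀ * b = 0 := by linarith
      exact (mul_eq_zero.1 this).resolve_left hε₀pos.ne'
    subst hb0
    have hc0 : c = 0 := by
      have : ε₀ * c = 0 := by linarith
      exact (mul_eq_zero.1 this).resolve_left hε₀pos.ne'
    subst hc0
    have hs0 : s = 0 := by
      have : s * m = 0 := by linarith
      exact (mul_eq_zero.1 this).resolve_right hm
    subst hs0
    rfl
  obtain ⟨ψ, hψ, hψ0, -, hψQ, hψd⟩ := exists_smooth_implicit_of_injective hQ hQ0 hinj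
  -- the change of coordinates
  let u : R3 → ℝ × ℝ := fun w => (w.1, w.2.1)
  have hu : ContDiff ℝ ∞ u := by fun_prop
  have hψu : ContDiff ℝ ∞ fun w => ψ (u w) := hψ.comp hu
  let h : R3 → R3 := fun w => ((ψ (u w)).2.1, (ψ (u w)).2.2, w.2.2 - (ψ (u w)).1)
  have hh : ContDiff ℝ ∞ h := by fun_prop
  have hh0 : h 0 = 0 := by
    have : ψ (u 0) = 0 := hψ0
    simp [h, this]
  have hhd : ∀ w v, fderiv ℝ h w v = ((fderiv ℝ ψ (u w) (u v)).2.1, (fderiv ℝ ψ (u w) (u v)).2.2,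
      v.2.2 - (fderiv ℝ ψ (u w) (u v)).1) := by
    intro w v
    let uL : R3 →L[ℝ] ℝ × ℝ := (ContinuousLinearMap.fst ℝ ℝ (ℝ × ℝ)).prod
      (ContinuousLinearMap.fst ℝ ℝ ℝ ∘L ContinuousLinearMap.snd ℝ ℝ (ℝ × ℝ))
    have k1 : HasFDerivAt (fun w => ψ (u w)) (fderiv ℝ ψ (u w) ∘L uL) w :=
      HasFDerivAt.comp w (f := uL) (hψ.differentiable (by simp) (u w)).hasFDerivAt uL.hasFDerivAt
    have k2 : HasFDerivAt (fun w : R3 => w.2.2)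
      (ContinuousLinearMap.snd ℝ ℝ ℝ ∘L ContinuousLinearMap.snd ℝ ℝ (ℝ × ℝ)) w :=
      (ContinuousLinearMap.snd ℝ ℝ ℝ ∘L ContinuousLinearMap.snd ℝ ℝ (ℝ × ℝ)).hasFDerivAt
    have k3 : HasFDerivAt h _ w := k1.snd.fst.prodMk (k1.snd.snd.prodMk (k2.sub k1.fst))
    rw [k3.fderiv]
    rfl
  -- For a vector in the kernel the derivatives of `z₀` and `z₁` vanish, and the linearized
  -- equations `Q = 0` reduce to `∂_{u₀} X v₀ = 0` and `∂_{u₁} ∂_τ X v₁ = 0`. This is where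
  -- versality of the unfolding enters.
  have hhinj : ∀ v, fderiv ℝ h 0 v = 0 → v = 0 := by
    rintro ⟨v₀, v₁, t⟩ hv
    rw [hhd] at hv
    have hu0 : u 0 = 0 := rfl
    have huv : u (v₀, v₁, t) = (v₀, v₁) := rfl
    rw [hu0, huv] at hv
    have hd := hψd (v₀, v₁)
    set y := fderiv ℝ ψ 0 (v₀, v₁) with hy
    obtain ⟨s, b, c⟩ := y
    simp only [Prod.mk_eq_zero] at hv
    obtain ⟨rfl, rfl, hts⟩ := hv
    rw [hQd] at hd
    have hb : z₀ (((v₀, v₁), (s, 0, 0)) : Λ) = 0 := rfl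
    have hc : z₁ (((v₀, v₁), (s, 0, 0)) : Λ) = 0 := rfl
    have hp : π (((v₀, v₁), (s, 0, 0)) : Λ) = v₀ • (1, 0, 0) + v₁ • (0, 1, 0) + s • (0, 0, 1) := by
      change ((v₀, v₁, s) : R3) = _
      simp
    rw [hb, hc, hp] at hd
    have e0 : fderiv ℝ X 0 (0, 0, 1) = 0 := hX.dt_zero
    have e1 : fderiv ℝ (dt X) 0 (0, 0, 1) = 0 := hX.dtt_zero
    simp only [map_add, map_smul, e0, e1, hX.du₁, smul_eq_mul, mul_zero, add_zero, sub_zero,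
      Prod.mk_eq_zero] at hd
    have hv0 : v₀ = 0 := (mul_eq_zero.1 hd.1).resolve_right hX.du₀
    have hv1 : v₁ = 0 := by
      have := hd.2.1
      rw [hv0, zero_mul, zero_add] at this
      exact (mul_eq_zero.1 this).resolve_right hX.du₁_dt
    subst hv0 hv1
    have hs : s = 0 := by
      have : fderiv ℝ ψ 0 ((0, 0) : ℝ × ℝ) = 0 := map_zero _
      rw [this] at hy
      exact congrArg Prod.fst hy
    have ht : t = 0 := by linarith
    subst ht
    rfl
  obtain ⟨e, h0e, heh, hes⟩ := exists_smooth_inverse_of_injective hh hhinj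
  -- the factor and the remainder
  let l : R3 → Λ := fun w => (u w, ψ (u w))
  have hl : ContDiff ℝ ∞ l := hu.prodMk hψu
  let ζ : R3 → ℝ := fun w => w.2.2 - (ψ (u w)).1
  have hζ : ContDiff ℝ ∞ ζ := by fun_prop
  let μ : R3 → ℝ := fun w => D (l w, ζ w)
  have hμ : ContDiff ℝ ∞ μ := hD.comp (hl.prodMk hζ)
  let ρ : R3 → ℝ := fun w => R (l w, ζ w)
  have hρ : ContDiff ℝ ∞ ρ := hR.comp (hl.prodMk hζ)
  have hl0 : l 0 = 0 := by
    have : ψ (u 0) = 0 := hψ0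
    simp only [l, this]; rfl
  have hζ0 : ζ 0 = 0 := by
    have : ψ (u 0) = 0 := hψ0
    simp [ζ, this]
  have hμ0 : 0 < μ 0 := by
    simp only [μ, hl0, hζ0]; exact hε₀pos
  have ev1 : ∀ᶠ w in 𝓝 (0 : R3), 0 < μ w := hμ.continuous.continuousAt.eventually (lt_mem_nhds hμ0)
  have ev2 : ∀ᶠ w in 𝓝 (0 : R3), |ζ w ^ 4 * ρ w / μ w| < 1 := by
    have hc : ContinuousAt (fun w => |ζ w ^ 4 * ρ w / μ w|) 0 :=
      (((hζ.continuous.pow 4).mul hρ.continuous).continuousAt.div hμ.continuous.continuousAt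
        hμ0.ne').abs
    refine hc.eventually (gt_mem_nhds ?_)
    simp [hζ0]
  have ev3 : ∀ᶠ w in 𝓝 (0 : R3), Q (l w) = 0 := (hu.continuous.tendsto 0).eventually hψQ
  obtain ⟨s, hss, hso, h0s⟩ := eventually_nhds_iff.1 (ev1.and (ev2.and ev3))
  let H := e.restrOpen s hso
  have hHs : ∀ w ∈ H.source, w ∈ s := fun w hw => hw.2
  have hHh : ∀ w, H w = h w := heh
  have hHh' : (H : R3 → R3) = h := funext hHh
  have hsymm : ContDiffOn ℝ ∞ H.symm H.target := hes.mono fun z hz => hz.1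
  let ρ' : R3 → ℝ := fun w => ζ w ^ (N + 4) * ρ w / μ w
  have hρ' : ContDiffOn ℝ ∞ ρ' H.source :=
    ((hζ.pow _).mul hρ).contDiffOn.div hμ.contDiffOn (fun w hw => (hss w (hHs w hw)).1.ne')
  refine ⟨H, μ, fun z => ρ' (H.symm z), ⟨h0e, h0s⟩, by rw [hHh, hh0], ?_, hsymm, hμ.contDiffOn,
    fun w hw => (hss w (hHs w hw)).1, hρ'.comp hsymm (fun z hz => H.map_target hz), ?_, ?_⟩
  · rw [hHh']; exact hh.contDiffOn
  · intro z hz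
    have hw := H.map_target hz
    set w := H.symm z with hwz
    have hzw : h w = z := by rw [← hHh, hwz, H.right_inv hz]
    have hz2 : z.2.2 = ζ w := by rw [← hzw]
    rw [hz2]
    have h1 : ρ' w = ζ w ^ N * (ζ w ^ 4 * ρ w / μ w) := by simp only [ρ']; ring
    change |ρ' w| ≤ _
    rw [h1, abs_mul, abs_pow]
    exact mul_le_of_le_one_right (by positivity) (hss w (hHs w hw)).2.1.le
  · intro w hw
    obtain ⟨hμw, -, hQw⟩ := hss w (hHs w hw)
    have hinv : H.symm (H w) = w := H.left_inv hw
    have hXw : X w = μ w * (a * ζ w ^ 3 + (ψ (u w)).2.2 * ζ w + (ψ (u w)).2.1) +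
        ζ w ^ (N + 4) * ρ w := by
      have e1 := hdiv (l w) (ζ w)
      have e2 : A (l w, ζ w) = X w := by
        change X (w.1, w.2.1, (ψ (u w)).1 + (w.2.2 - (ψ (u w)).1)) = X w
        congr 3
        ring
      simp only [Q, Prod.mk_eq_zero] at hQw
      rw [e2, hQw.1, hQw.2.1, hQw.2.2] at e1
      rw [e1]
      change _ = D (l w, ζ w) * (a * ζ w ^ 3 + z₁ (l w) * ζ w + z₀ (l w)) + _
      simp only [ρ]
      ring
    rw [hHh', hhd]
    have hu0 : u (0, 0, X w) = 0 := rfl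
    rw [hu0, map_zero]
    simp only [cuspField]
    rw [← hHh w, hinv, hHh w]
    have h3 : X w = μ w * (a * ζ w ^ 3 + (ψ (u w)).2.2 * ζ w + (ψ (u w)).2.1 + ρ' w) := by
      rw [hXw]
      simp only [ρ']
      field_simp
    ext
    · simp
    · simp
    · simp only [Prod.smul_mk, smul_eq_mul, Prod.fst_zero, sub_zero]
      rw [h3]

end DriftSing

namespace DriftSing

/-! ### Uniqueness and global existence of trajectories. -/

section ODE

variable {E : Type*} [NormedAddCommGroup E] [NormedSpace ℝ E]

theorem hasDerivWithinAt_Ici {F : E → E} {φ : ℝ → E}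
    (hφ : IsIntegralCurveOn φ (fun _ => F) (Ici 0)) {t : ℝ} (ht : 0 ≤ t) :
    HasDerivWithinAt φ (F (φ t)) (Ici t) t :=
  (hφ t ht).mono (Ici_subset_Ici.2 ht)

/-- Forward trajectories of a `C¹` field are unique. -/
theorem integralCurve_unique {F : E → E} (hF : ContDiff ℝ 1 F) {φ ψ : ℝ → E}
    (hφ : IsIntegralCurveOn φ (fun _ => F) (Ici 0)) (hψ : IsIntegralCurveOn ψ (fun _ => F) (Ici 0))
    (h0 : φ 0 = ψ 0) : EqOn φ ψ (Ici 0) := by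
  intro T hT
  have hIcc : Icc 0 T ⊆ Ici 0 := Icc_subset_Ici_self
  have hφc : ContinuousOn φ (Icc 0 T) := hφ.continuousOn.mono hIcc
  have hψc : ContinuousOn ψ (Icc 0 T) := hψ.continuousOn.mono hIcc
  have hcomp : IsCompact (φ '' Icc 0 T ∪ ψ '' Icc 0 T) :=
    (isCompact_Icc.image_of_continuousOn hφc).union (isCompact_Icc.image_of_continuousOn hψc)
  obtain ⟨K, hK⟩ := hF.locallyLipschitz.locallyLipschitzOn.exists_lipschitzOnWith_of_compact hcomp
  exact ODE_solution_unique_of_mem_Icc_right (v := fun _ => F) (fun _ _ => hK) hφc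
    (fun t ht => hasDerivWithinAt_Ici hφ ht.1)
    (fun t ht => Or.inl (mem_image_of_mem _ (Ico_subset_Icc_self ht))) hψc
    (fun t ht => hasDerivWithinAt_Ici hψ ht.1)
    (fun t ht => Or.inr (mem_image_of_mem _ (Ico_subset_Icc_self ht))) h0 ⟨hT, le_rfl⟩

/-- A trajectory that reaches an equilibrium of a locally Lipschitz field starts there. -/
theorem eq_of_reaches_equilibrium {F : E → E} (hF : LocallyLipschitz F) {φ : ℝ → E} {q : E}
    (hq : F q = 0) (hφ : IsIntegralCurveOn φ (fun _ => F) (Ici 0)) {T : ℝ} (hT : 0 ≤ T)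
    (h : φ T = q) : φ 0 = q := by
  have hIcc : Icc 0 T ⊆ Ici 0 := Icc_subset_Ici_self
  have hφc : ContinuousOn φ (Icc 0 T) := hφ.continuousOn.mono hIcc
  have hcomp : IsCompact (φ '' Icc 0 T ∪ {q}) :=
    (isCompact_Icc.image_of_continuousOn hφc).union isCompact_singleton
  obtain ⟨K, hK⟩ := hF.locallyLipschitzOn.exists_lipschitzOnWith_of_compact hcomp
  refine ODE_solution_unique_of_mem_Icc_left (v := fun _ => F) (g := fun _ => q)
    (fun _ _ => hK) hφc ?_
    (fun t ht => Or.inl (mem_image_of_mem _ (Ioc_subset_Icc_self ht))) continuousOn_const ?_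
    (fun t ht => Or.inr rfl) h ⟨le_rfl, hT⟩
  · intro t ht
    exact ((hφ t ht.1.le).hasDerivAt (Ici_mem_nhds ht.1)).hasDerivWithinAt
  · intro t _
    simp only [hq]
    exact hasDerivWithinAt_const _ _ _

/-- Global existence of trajectories for bounded Lipschitz fields. -/
theorem exists_integralCurve [CompleteSpace E] {F : E → E} {K M : NNReal} (hK : LipschitzWith K F)
    (hM : ∀ x, ‖F x‖ ≤ M) (x₀ : E) :
    ∃ φ : ℝ → E, φ 0 = x₀ ∧ IsIntegralCurveOn φ (fun _ => F) (Ici 0) := by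
  have hsol : ∀ n : ℕ, ∃ α : ℝ → E, α 0 = x₀ ∧
      ∀ t ∈ Icc (0 : ℝ) n, HasDerivWithinAt α (F (α t)) (Icc (0 : ℝ) n) t := by
    intro n
    -- Speed at most `M` keeps a solution on `[0, n]` within radius `M * n`, so the interval of
    -- existence is not shortened.
    have hPL : IsPicardLindelof (fun _ => F) (⟨0, le_rfl, Nat.cast_nonneg n⟩ : Icc (0 : ℝ) n) x₀
        (M * n) 0 M K := IsPicardLindelof.of_time_independent (fun x _ => hM x)
          hK.lipschitzOnWith (by simp)
    exact hPL.exists_eq_forall_mem_Icc_hasDerivWithinAt₀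
  choose α hα0 hα using hsol
  have hcont : ∀ n, ContinuousOn (α n) (Icc 0 n) := fun n t ht => (hα n t ht).continuousWithinAt
  have hder : ∀ n : ℕ, ∀ t ∈ Ico (0 : ℝ) n, HasDerivWithinAt (α n) (F (α n t)) (Ici t) t := by
    intro n t ht
    refine (hα n t ⟨ht.1, ht.2.le⟩).mono_of_mem_nhdsWithin ?_
    exact mem_of_superset (Icc_mem_nhdsGE ht.2) (Icc_subset_Icc_left ht.1)
  have hagree : ∀ n m : ℕ, n ≤ m → EqOn (α n) (α m) (Icc 0 n) := by
    intro n m hnm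
    have hnm' : (n : ℝ) ≤ m := Nat.cast_le.2 hnm
    exact ODE_solution_unique_of_mem_Icc_right (v := fun _ => F) (s := fun _ => univ)
      (fun _ _ => hK.lipschitzOnWith) (hcont n) (hder n) (fun _ _ => mem_univ _)
      ((hcont m).mono (Icc_subset_Icc_right hnm'))
      (fun t ht => hder m t ⟨ht.1, ht.2.trans_le hnm'⟩) (fun _ _ => mem_univ _)
      ((hα0 n).trans (hα0 m).symm)
  let φ : ℝ → E := fun t => α (⌈t⌉₊) t
  have hφ : ∀ n : ℕ, EqOn φ (α n) (Icc 0 n) := by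
    intro n t ht
    exact hagree _ _ (Nat.ceil_le.2 ht.2) ⟨ht.1, Nat.le_ceil t⟩
  refine ⟨φ, by simp [φ, hα0], ?_⟩
  intro t ht
  rw [mem_Ici] at ht
  set n := ⌈t⌉₊ + 1 with hn
  have htn : t < n := by
    have := Nat.le_ceil t
    rw [hn]; push_cast; linarith
  have h1 : HasDerivWithinAt φ (F (φ t)) (Icc 0 n) t := by
    have := (hα n t ⟨ht, htn.le⟩).congr (hφ n) (hφ n ⟨ht, htn.le⟩)
    rwa [← hφ n ⟨ht, htn.le⟩] at this
  refine h1.mono_of_mem_nhdsWithin ?_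
  have : Icc (0 : ℝ) n = Ici 0 ∩ Iic (n : ℝ) := rfl
  rw [this]
  exact inter_mem_nhdsWithin _ (Iic_mem_nhds htn)

end ODE

/-! ### Scalar equations: convergence to equilibria and unstable sets. -/

section Scalar

variable {g : ℝ → ℝ} {y : ℝ → ℝ} {r : ℝ}

/-- By continuity a crossing would hit `r` in finite time, and backward uniqueness would then force
the trajectory to be constant. -/
theorem lt_equilibrium (hg : LocallyLipschitz g) (hr : g r = 0)
    (hy : IsIntegralCurveOn y (fun _ => g) (Ici 0)) (h0 : y 0 < r) {t : ℝ} (ht : 0 ≤ t) :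
    y t < r := by
  by_contra hlt
  rw [not_lt] at hlt
  have hc : ContinuousOn y (Icc 0 t) := hy.continuousOn.mono Icc_subset_Ici_self
  obtain ⟨s, hs, hsr⟩ := intermediate_value_Icc ht hc ⟨h0.le, hlt⟩
  exact h0.ne (eq_of_reaches_equilibrium hg hr hy hs.1 hsr)

theorem monotoneOn_of_field_nonneg (hy : IsIntegralCurveOn y (fun _ => g) (Ici 0))
    (h : ∀ t, 0 ≤ t → 0 ≤ g (y t)) : MonotoneOn y (Ici 0) := by
  refine monotoneOn_of_deriv_nonneg (convex_Ici 0) hy.continuousOn ?_ ?_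
  · intro t ht
    rw [interior_Ici] at ht
    exact ((hy t (mem_Ici.2 (mem_Ioi.1 ht).le)).hasDerivAt (Ici_mem_nhds ht)).differentiableAt.differentiableWithinAt
  · intro t ht
    rw [interior_Ici] at ht
    rw [((hy t (mem_Ici.2 (mem_Ioi.1 ht).le)).hasDerivAt (Ici_mem_nhds ht)).deriv]
    exact h t (mem_Ioi.1 ht).le

/-- A trajectory below an equilibrium, in the region where the field is positive, converges
to that equilibrium. -/
theorem exists_solution_tendsto (hg : ContDiff ℝ 1 g) {y₀ : ℝ} (h : y₀ < r)
    (hpos : ∀ x ∈ Ico y₀ r, 0 < g x) (hr : g r = 0) :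
    ∃ y : ℝ → ℝ, y 0 = y₀ ∧ IsIntegralCurveOn y (fun _ => g) (Ici 0) ∧
      (∀ t, 0 ≤ t → y t ∈ Ico y₀ r) ∧ Tendsto y atTop (𝓝 r) := by
  obtain ⟨K, hK⟩ := hg.locallyLipschitz.locallyLipschitzOn.exists_lipschitzOnWith_of_compact
    (isCompact_Icc (a := y₀) (b := r))
  -- Clamping to `[y₀, r]` makes the field bounded and globally Lipschitz. The trajectory never
  -- leaves that interval, so it also solves the original equation.
  let cl : ℝ → ℝ := fun x => (projIcc y₀ r h.le x : ℝ)
  have hcl : LipschitzWith 1 cl := LipschitzWith.subtype_val _ |>.comp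
    (LipschitzWith.projIcc h.le) |>.weaken (by simp)
  have hclmem : ∀ x, cl x ∈ Icc y₀ r := fun x => (projIcc y₀ r h.le x).2
  have hcl_of : ∀ x ∈ Icc y₀ r, cl x = x := fun x hx => by simp [cl, projIcc_of_mem h.le hx]
  have hgc : LipschitzWith K (fun x => g (cl x)) := by
    have := hK.comp (hcl.lipschitzOnWith (s := univ)) (fun x _ => hclmem x)
    rw [mul_one] at this
    exact lipschitzOnWith_univ.1 this
  obtain ⟨M, hM⟩ := (isCompact_Icc (a := y₀) (b := r)).exists_bound_of_continuousOn
    hg.continuous.continuousOn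
  have hM0 : 0 ≤ M := (norm_nonneg _).trans (hM y₀ ⟨le_rfl, h.le⟩)
  obtain ⟨y, hy0, hy⟩ := exists_integralCurve (M := ⟨M, hM0⟩) hgc (fun x => hM _ (hclmem x)) y₀
  have hnonneg : ∀ x, 0 ≤ g (cl x) := by
    intro x
    rcases (hclmem x).2.lt_or_eq with h1 | h1
    · exact (hpos _ ⟨(hclmem x).1, h1⟩).le
    · rw [h1, hr]
  have hmono : MonotoneOn y (Ici 0) := monotoneOn_of_field_nonneg hy fun t _ => hnonneg _
  have hrr : g (cl r) = 0 := by rw [hcl_of r ⟨h.le, le_rfl⟩, hr]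
  have hmem : ∀ t, 0 ≤ t → y t ∈ Ico y₀ r := by
    intro t ht
    refine ⟨?_, lt_equilibrium hgc.locallyLipschitz hrr hy (by rw [hy0]; exact h) ht⟩
    rw [← hy0]
    exact hmono self_mem_Ici ht ht
  have hy' : IsIntegralCurveOn y (fun _ => g) (Ici 0) := by
    intro t ht
    have h1 := hy t ht
    have h2 := hmem t ht
    simp only at h1
    rwa [hcl_of _ ⟨h2.1, h2.2.le⟩] at h1
  refine ⟨y, hy0, hy', hmem, ?_⟩
  rw [tendsto_order]
  refine ⟨fun b hb => ?_, fun b hb => ?_⟩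
  · -- otherwise `y` would grow at least linearly
    have hex : ∃ T, 0 ≤ T ∧ b < y T := by
      by_contra hne
      push Not at hne
      have hyb : y₀ ≤ b := by rw [← hy0]; exact hne 0 le_rfl
      obtain ⟨c, hc, hcmin⟩ := (isCompact_Icc (a := y₀) (b := b)).exists_isMinOn
        ⟨y₀, le_rfl, hyb⟩ hg.continuous.continuousOn
      have hgc0 : 0 < g c := hpos c ⟨hc.1, hc.2.trans_lt hb⟩
      have hgrow : ∀ t, 0 ≤ t → g c * t ≤ y t - y₀ := by
        intro t ht
        have := (convex_Ici (0 : ℝ)).mul_sub_le_image_sub_of_le_deriv (f := y) (C := g c)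
          hy'.continuousOn (fun s hs => by
            rw [interior_Ici] at hs
            exact ((hy' s (mem_Ici.2 (mem_Ioi.1 hs).le)).hasDerivAt
              (Ici_mem_nhds hs)).differentiableAt.differentiableWithinAt)
          (fun s hs => by
            rw [interior_Ici] at hs
            rw [((hy' s (mem_Ici.2 (mem_Ioi.1 hs).le)).hasDerivAt (Ici_mem_nhds hs)).deriv]
            exact hcmin ⟨(hmem s (mem_Ioi.1 hs).le).1, hne s (mem_Ioi.1 hs).le⟩) 0 self_mem_Ici t ht ht
        rwa [sub_zero, hy0] at this
      have h3 := hgrow ((b - y₀ + 1) / g c) (by apply div_nonneg <;> linarith)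
      have h4 := hne ((b - y₀ + 1) / g c) (by apply div_nonneg <;> linarith)
      rw [mul_div_cancel₀ _ hgc0.ne'] at h3
      linarith
    obtain ⟨T, hT, hbT⟩ := hex
    filter_upwards [eventually_ge_atTop T] with t ht
    exact hbT.trans_le (hmono hT (hT.trans ht) ht)
  · filter_upwards [eventually_ge_atTop 0] with t ht
    exact (hmem t ht).2.trans hb

/-- The trajectory of `y₀` under the scalar field `g` stays in `(-δ, δ)` and converges to `L`. -/
def ScalarConverges (g : ℝ → ℝ) (δ y₀ L : ℝ) : Prop :=
  ∃ y : ℝ → ℝ, y 0 = y₀ ∧ IsIntegralCurveOn y (fun _ => g) (Ici 0) ∧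
    (∀ t, 0 ≤ t → |y t| < δ) ∧ Tendsto y atTop (𝓝 L)

variable {δ y₀ L : ℝ}

theorem ScalarConverges.const (h : g y₀ = 0) (hy₀ : |y₀| < δ) : ScalarConverges g δ y₀ y₀ := by
  refine ⟨fun _ => y₀, rfl, fun t _ => ?_, fun _ _ => hy₀, tendsto_const_nhds⟩
  simp only [h]
  exact hasDerivWithinAt_const _ _ _

theorem ScalarConverges.of_pos (hg : ContDiff ℝ 1 g) (h0 : -δ < y₀) (h : y₀ < r) (hrδ : r ≤ δ)
    (hpos : ∀ x ∈ Ico y₀ r, 0 < g x) (hr : g r = 0) : ScalarConverges g δ y₀ r := by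
  obtain ⟨y, hy0, hy, hmem, hlim⟩ := exists_solution_tendsto hg h hpos hr
  refine ⟨y, hy0, hy, fun t ht => abs_lt.2 ⟨?_, ?_⟩, hlim⟩
  · exact h0.trans_le (hmem t ht).1
  · exact (hmem t ht).2.trans_le hrδ

/-- The symmetry `x ↦ -x` derives each statement about decreasing trajectories from the increasing
one. -/
theorem ScalarConverges.reflect (h : ScalarConverges (fun x => -g (-x)) δ (-y₀) (-L)) :
    ScalarConverges g δ y₀ L := by
  obtain ⟨y, hy0, hy, hmem, hlim⟩ := h
  refine ⟨fun t => -y t, by simp [hy0], fun t ht => ?_, fun t ht => by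
    rw [abs_neg]; exact hmem t ht, by simpa using hlim.neg⟩
  have := (hy t ht).neg
  simp only [neg_neg] at this
  exact this

theorem ScalarConverges.reflect_iff :
    ScalarConverges (fun x => -g (-x)) δ (-y₀) (-L) ↔ ScalarConverges g δ y₀ L := by
  refine ⟨ScalarConverges.reflect, fun h => ScalarConverges.reflect ?_⟩
  simpa using h

theorem contDiff_reflect {n : WithTop ℕ∞} (hg : ContDiff ℝ n g) :
    ContDiff ℝ n (fun x => -g (-x)) := (hg.comp contDiff_neg).neg

theorem ScalarConverges.of_neg (hg : ContDiff ℝ 1 g) (h0 : y₀ < δ) (h : r < y₀) (hrδ : -δ ≤ r)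
    (hneg : ∀ x ∈ Ioc r y₀, g x < 0) (hr : g r = 0) : ScalarConverges g δ y₀ r := by
  refine ScalarConverges.reflect (ScalarConverges.of_pos (contDiff_reflect hg) (by linarith)
    (by linarith) (by linarith) (fun x hx => ?_) (by simp [hr]))
  have := hneg (-x) ⟨by linarith [hx.2], by linarith [hx.1]⟩
  linarith

/-- The limit is the first zero of `g` above `y₀`, which exists because `g` is negative at `δ`. -/
theorem exists_converges_of_pos (hg : ContDiff ℝ 1 g) (hδ : g δ < 0) (hy₀ : |y₀| < δ)
    (hpos : 0 < g y₀) : ∃ L, |L| < δ ∧ g L = 0 ∧ ScalarConverges g δ y₀ L := by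
  rw [abs_lt] at hy₀
  let Z : Set ℝ := {x ∈ Icc y₀ δ | g x ≤ 0}
  have hZc : IsClosed Z := isClosed_Icc.inter (isClosed_le hg.continuous continuous_const)
  have hZne : Z.Nonempty := ⟨δ, ⟨hy₀.2.le, le_rfl⟩, hδ.le⟩
  have hZb : BddBelow Z := ⟨y₀, fun x hx => hx.1.1⟩
  have hL : sInf Z ∈ Z := hZc.csInf_mem hZne hZb
  set L := sInf Z with hLdef
  have hyL : y₀ < L := lt_of_le_of_ne hL.1.1 (by rintro h; rw [← h] at hL; linarith [hL.2])
  have hposL : ∀ x ∈ Ico y₀ L, 0 < g x := by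
    intro x hx
    by_contra hle
    rw [not_lt] at hle
    have : L ≤ x := csInf_le hZb ⟨⟨hx.1, hx.2.le.trans hL.1.2⟩, hle⟩
    linarith [hx.2]
  have hgL : g L = 0 := by
    refine le_antisymm hL.2 ?_
    have hc : ContinuousWithinAt g (Iio L) L := hg.continuous.continuousWithinAt
    refine ge_of_tendsto hc ?_
    filter_upwards [Ioo_mem_nhdsLT hyL] with x hx
    exact (hposL x ⟨hx.1.le, hx.2⟩).le
  have hLδ : L < δ := lt_of_le_of_ne hL.1.2 (by rintro h; rw [h] at hgL; linarith)
  exact ⟨L, abs_lt.2 ⟨by linarith, hLδ⟩, hgL,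
    ScalarConverges.of_pos hg hy₀.1 hyL hLδ.le hposL hgL⟩

/-- If the field points inwards at both ends, all trajectories converge to equilibria. -/
theorem exists_scalarConverges (hg : ContDiff ℝ 1 g) (hδ : g δ < 0) (hδ' : 0 < g (-δ))
    (hy₀ : |y₀| < δ) : ∃ L, |L| < δ ∧ g L = 0 ∧ ScalarConverges g δ y₀ L := by
  rcases lt_trichotomy (g y₀) 0 with h | h | h
  · obtain ⟨L, h1, h2, h3⟩ := exists_converges_of_pos (contDiff_reflect hg) (δ := δ) (y₀ := -y₀)
      (by linarith) (by rwa [abs_neg]) (by simpa using h)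
    refine ⟨-L, by rwa [abs_neg], by linarith, ScalarConverges.reflect ?_⟩
    rwa [neg_neg]
  · exact ⟨y₀, hy₀, h, ScalarConverges.const h hy₀⟩
  · exact exists_converges_of_pos hg hδ hy₀ h

/-- The unstable set of a half-stable equilibrium `t` above an equilibrium `r`. -/
theorem unstable_iff (hg : ContDiff ℝ 1 g) {t : ℝ} (hrδ : -δ < r) (hrt : r < t) (htδ : t < δ)
    (hr : g r = 0) (ht : g t = 0) (h1 : ∀ x ∈ Ioo r t, g x < 0) (h2 : ∀ x ∈ Ioo t δ, g x < 0)
    (hy₀ : |y₀| < δ) : ScalarConverges (fun x => -g x) δ y₀ t ↔ r < y₀ ∧ y₀ ≤ t := by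
  have hng : ContDiff ℝ 1 (fun x => -g x) := hg.neg
  constructor
  · rintro ⟨y, hy0, hy, hmem, hlim⟩
    constructor
    · by_contra hle
      rw [not_lt] at hle
      have hr' : -g r = 0 := by rw [hr, neg_zero]
      have hyr : ∀ s, 0 ≤ s → y s ≤ r := by
        rcases hle.lt_or_eq with hlt | heq
        · intro s hs
          exact (lt_equilibrium hng.locallyLipschitz hr' hy (by rwa [hy0]) hs).le
        · intro s hs
          have hcst : IsIntegralCurveOn (fun _ => r) (fun _ x => -g x) (Ici 0) := by
            intro s _
            simp only [hr']
            exact hasDerivWithinAt_const _ _ _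
          exact (integralCurve_unique hng hy hcst (hy0.trans heq) hs).le
      have : t ≤ r := le_of_tendsto hlim (by
        filter_upwards [eventually_ge_atTop 0] with s hs using hyr s hs)
      linarith
    · by_contra hlt
      rw [not_le] at hlt
      -- above `t` the trajectory increases
      have habove : ∀ s, 0 ≤ s → t < y s := by
        intro s hs
        have hyn : IsIntegralCurveOn (fun s => -y s) (fun _ x => g (-x)) (Ici 0) := by
          intro s hs
          have := (hy s hs).neg
          simp only [neg_neg] at this
          simp only [neg_neg]
          exact this
        have hgn : ContDiff ℝ 1 (fun x => g (-x)) := hg.comp contDiff_neg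
        have := lt_equilibrium hgn.locallyLipschitz (r := -t) (by simpa using ht) hyn
          (by rw [hy0]; linarith) hs
        linarith
      have hmono : MonotoneOn y (Ici 0) := monotoneOn_of_field_nonneg hy fun s hs => by
        have := h2 (y s) ⟨habove s hs, (abs_lt.1 (hmem s hs)).2⟩
        linarith
      have : y₀ ≤ t := ge_of_tendsto hlim (by
        filter_upwards [eventually_ge_atTop 0] with s hs
        rw [← hy0]
        exact hmono self_mem_Ici hs hs)
      linarith
  · rintro ⟨hr0, h0t⟩
    rcases h0t.lt_or_eq with hlt | heq
    · refine ScalarConverges.of_pos hng (by linarith) hlt htδ.le (fun x hx => ?_) (by simp [ht])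
      have := h1 x ⟨hr0.trans_le hx.1, hx.2⟩
      linarith
    · subst heq
      exact ScalarConverges.const (by simp [ht]) hy₀

/-- The unstable set of a half-stable equilibrium `t` below an equilibrium `r`. -/
theorem unstable_iff' (hg : ContDiff ℝ 1 g) {t : ℝ} (hrδ : r < δ) (hrt : t < r) (htδ : -δ < t)
    (hr : g r = 0) (ht : g t = 0) (h1 : ∀ x ∈ Ioo t r, 0 < g x) (h2 : ∀ x ∈ Ioo (-δ) t, 0 < g x)
    (hy₀ : |y₀| < δ) : ScalarConverges (fun x => -g x) δ y₀ t ↔ y₀ < r ∧ t ≤ y₀ := by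
  rw [← ScalarConverges.reflect_iff]
  have := unstable_iff (contDiff_reflect hg) (δ := δ) (r := -r) (t := -t) (y₀ := -y₀)
    (by linarith) (by linarith) (by linarith) (by simp [hr]) (by simp [ht])
    (fun x hx => by
      have := h1 (-x) ⟨by linarith [hx.2], by linarith [hx.1]⟩
      linarith)
    (fun x hx => by
      have := h2 (-x) ⟨by linarith [hx.2], by linarith [hx.1]⟩
      linarith) (by rwa [abs_neg])
  rw [this]
  constructor <;> rintro ⟨h3, h4⟩ <;> constructor <;> linarith

end Scalar

/-- Reversal of time: every statement on backward trajectories is reduced to forward trajectories of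
`-F`. -/
theorem convergesBackward_iff {F : R3 → R3} {U : Set R3} {p q : R3} :
    ConvergesBackward F U p q ↔ ConvergesForward (fun x => -F x) U p q := by
  have aux : ∀ {F : R3 → R3} {φ : ℝ → R3} {s s' : Set ℝ}, (∀ t ∈ s', -t ∈ s) →
      IsIntegralCurveOn φ (fun _ => F) s →
      IsIntegralCurveOn (fun t => φ (-t)) (fun _ x => -F x) s' := by
    intro F φ s s' hs hφ t ht
    have h1 := (hφ (-t) (hs t ht)).scomp t (hasDerivWithinAt_neg t s') hs
    simp only [neg_smul, one_smul] at h1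
    exact h1
  constructor
  · rintro ⟨φ, h0, hφ, hU, hlim⟩
    exact ⟨fun t => φ (-t), by simp [h0], aux (by simp) hφ,
      fun t ht => hU _ (by simpa using ht), hlim.comp tendsto_neg_atTop_atBot⟩
  · rintro ⟨φ, h0, hφ, hU, hlim⟩
    have h1 := aux (s' := Iic 0) (by simp) hφ
    simp only [neg_neg] at h1
    exact ⟨fun t => φ (-t), by simp [h0], h1,
      fun t ht => hU _ (by simpa using ht), hlim.comp tendsto_neg_atBot_atTop⟩

theorem ConvergesForward.unique {F : R3 → R3} (hF : ContDiff ℝ 1 F) {U : Set R3} {p q q' : R3}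
    (h : ConvergesForward F U p q) (h' : ConvergesForward F U p q') : q = q' := by
  obtain ⟨y, hy0, hy, -, hlim⟩ := h
  obtain ⟨z, hz0, hz, -, hlim'⟩ := h'
  have heq := integralCurve_unique hF hy hz (hy0.trans hz0.symm)
  refine tendsto_nhds_unique hlim (hlim'.congr' ?_)
  filter_upwards [eventually_ge_atTop 0] with t ht using (heq ht).symm

/-! ### Convergence of trajectories in box-shaped charts. -/

/-- The box `{|u₀| < ε₀, |u₁| < ε₁, |τ| < δ}`. -/
def box (ε₀ ε₁ δ : ℝ) : Set R3 := {w | |w.1| < ε₀ ∧ |w.2.1| < ε₁ ∧ |w.2.2| < δ}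

theorem isOpen_box (ε₀ ε₁ δ : ℝ) : IsOpen (box ε₀ ε₁ δ) :=
  (isOpen_lt (f := fun w : R3 => |w.1|) (by fun_prop) continuous_const).inter
    ((isOpen_lt (f := fun w : R3 => |w.2.1|) (by fun_prop) continuous_const).inter
      (isOpen_lt (f := fun w : R3 => |w.2.2|) (by fun_prop) continuous_const))

/-- Convergence of trajectories, in straightening coordinates. -/
theorem convergesForward_iff {F : R3 → R3} {Θ : OpenPartialHomeomorph R3 R3} {Y : R3 → ℝ}
    (hΘ : ContDiffOn ℝ ∞ Θ Θ.source) (hΘs : ContDiffOn ℝ ∞ Θ.symm Θ.target)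
    (hsymm : ∀ w ∈ Θ.target, fderiv ℝ Θ.symm w (0, 0, Y w) = F (Θ.symm w))
    (hmap : ∀ p ∈ Θ.source, fderiv ℝ Θ p (F p) = (0, 0, Y (Θ p)))
    {ε₀ ε₁ δ : ℝ} (hB : box ε₀ ε₁ δ ⊆ Θ.target) {w w' : R3} (hw : w ∈ box ε₀ ε₁ δ)
    (hw' : w' ∈ box ε₀ ε₁ δ) :
    ConvergesForward F (Θ.symm '' box ε₀ ε₁ δ) (Θ.symm w) (Θ.symm w') ↔
      w.1 = w'.1 ∧ w.2.1 = w'.2.1 ∧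
        ScalarConverges (fun y => Y (w.1, w.2.1, y)) δ w.2.2 w'.2.2 := by
  have hUs : Θ.symm '' box ε₀ ε₁ δ ⊆ Θ.source := by
    rintro _ ⟨v, hv, rfl⟩
    exact Θ.map_target (hB hv)
  have hΘU : ∀ p ∈ Θ.symm '' box ε₀ ε₁ δ, Θ p ∈ box ε₀ ε₁ δ := by
    rintro _ ⟨v, hv, rfl⟩
    rwa [Θ.right_inv (hB hv)]
  constructor
  · rintro ⟨φ, h0, hφ, hU, hlim⟩
    -- In the chart the trajectory satisfies `u' = 0` and `τ' = Y`, so `u` is frozen and a scalar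
    -- equation is left.
    have hd : ∀ t ∈ Ici (0 : ℝ), HasDerivWithinAt (fun t => Θ (φ t)) (0, 0, Y (Θ (φ t))) (Ici 0) t := by
      intro t ht
      have hp := hUs (hU t ht)
      have h1 : HasFDerivAt Θ (fderiv ℝ Θ (φ t)) (φ t) :=
        ((hΘ.contDiffAt (Θ.open_source.mem_nhds hp)).differentiableAt (by simp)).hasFDerivAt
      have h2 := h1.comp_hasDerivWithinAt t (hφ t ht)
      rwa [hmap _ hp] at h2
    have hstart : Θ (φ 0) = w := by rw [h0, Θ.right_inv (hB hw)]
    have hconst : ∀ {c : ℝ → ℝ}, (∀ t ∈ Ici (0 : ℝ), HasDerivWithinAt c 0 (Ici 0) t) →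
        ∀ t ∈ Ici (0 : ℝ), c t = c 0 := by
      intro c hc t ht
      refine constant_of_has_deriv_right_zero (a := 0) (b := t) ?_ ?_ t ⟨ht, le_rfl⟩
      · exact fun s hs => (hc s hs.1).continuousWithinAt.mono Icc_subset_Ici_self
      · exact fun s hs => (hc s hs.1).mono (Ici_subset_Ici.2 hs.1)
    have hu0 : ∀ t ∈ Ici (0 : ℝ), (Θ (φ t)).1 = w.1 := by
      intro t ht
      rw [hconst (c := fun t => (Θ (φ t)).1) (fun t ht => (hd t ht).fst) t ht, hstart]
    have hu1 : ∀ t ∈ Ici (0 : ℝ), (Θ (φ t)).2.1 = w.2.1 := by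
      intro t ht
      rw [hconst (c := fun t => (Θ (φ t)).2.1) (fun t ht => (hd t ht).snd.fst) t ht, hstart]
    have hlim' : Tendsto (fun t => Θ (φ t)) atTop (𝓝 w') := by
      have h1 : ContinuousAt Θ (Θ.symm w') := Θ.continuousAt (Θ.map_target (hB hw'))
      have h2 := h1.tendsto.comp hlim
      rwa [Θ.right_inv (hB hw')] at h2
    have hev : ∀ᶠ t in atTop, t ∈ Ici (0 : ℝ) := eventually_ge_atTop 0
    refine ⟨?_, ?_, fun t => (Θ (φ t)).2.2, by simp [hstart], ?_, ?_, ?_⟩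
    · refine tendsto_nhds_unique ?_ ((continuous_fst.tendsto w').comp hlim')
      refine tendsto_const_nhds.congr' ?_
      filter_upwards [hev] with t ht using (hu0 t ht).symm
    · refine tendsto_nhds_unique ?_ (((continuous_fst.comp continuous_snd).tendsto w').comp hlim')
      refine tendsto_const_nhds.congr' ?_
      filter_upwards [hev] with t ht using (hu1 t ht).symm
    · intro t ht
      have h1 := (hd t ht).snd.snd
      have h2 : Θ (φ t) = (w.1, w.2.1, (Θ (φ t)).2.2) :=
        Prod.ext (hu0 t ht) (Prod.ext (hu1 t ht) rfl)
      simp only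
      rw [← h2]
      exact h1
    · intro t ht
      exact (hΘU _ (hU t ht)).2.2
    · exact ((continuous_snd.comp continuous_snd).tendsto w').comp hlim'
  · rintro ⟨e0, e1, y, hy0, hy, hmem, hlim⟩
    have hin : ∀ t, 0 ≤ t → ((w.1, w.2.1, y t) : R3) ∈ box ε₀ ε₁ δ :=
      fun t ht => ⟨hw.1, hw.2.1, hmem t ht⟩
    refine ⟨fun t => Θ.symm (w.1, w.2.1, y t), by simp only [hy0], ?_, ?_, ?_⟩
    · intro t ht
      have hwt := hB (hin t ht)
      have h1 : HasFDerivAt Θ.symm (fderiv ℝ Θ.symm (w.1, w.2.1, y t)) (w.1, w.2.1, y t) :=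
        ((hΘs.contDiffAt (Θ.open_target.mem_nhds hwt)).differentiableAt (by simp)).hasFDerivAt
      have h2 : HasDerivWithinAt (fun t => ((w.1, w.2.1, y t) : R3))
          (0, 0, Y (w.1, w.2.1, y t)) (Ici 0) t :=
        (hasDerivWithinAt_const _ _ _).prodMk ((hasDerivWithinAt_const _ _ _).prodMk (hy t ht))
      have h3 := h1.comp_hasDerivWithinAt t h2
      rwa [hsymm _ hwt] at h3
    · intro t ht
      exact mem_image_of_mem _ (hin t ht)
    · have h1 : ContinuousAt Θ.symm w' := Θ.continuousAt_symm (hB hw')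
      refine h1.tendsto.comp ?_
      rw [e0, e1]
      exact tendsto_const_nhds.prodMk_nhds (tendsto_const_nhds.prodMk_nhds hlim)

end DriftSing

/-! ### The curve of double zeros and the third zero of a cusp unfolding. -/

namespace DriftSing

/-- With `k = -1` this is time reversal, which allows the third derivative to be taken negative from
here on. -/
theorem IsCuspUnfolding.const_mul {X : R3 → ℝ} {m : ℝ} (hX : IsCuspUnfolding X m) {k : ℝ}
    (hk : k ≠ 0) : IsCuspUnfolding (fun w => k * X w) (k * m) := by
  have hd : ∀ {Y : R3 → ℝ}, ContDiff ℝ ∞ Y → ∀ w v,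
      fderiv ℝ (fun w => k * Y w) w v = k * fderiv ℝ Y w v := by
    intro Y hY w v
    rw [fderiv_const_mul (hY.differentiable (by simp) w)]
    rfl
  have h1 : dt (fun w => k * X w) = fun w => k * dt X w := funext fun w => hd hX.smooth w _
  have h2 : dt (dt (fun w => k * X w)) = fun w => k * dt (dt X) w := by
    rw [h1]; exact funext fun w => hd (contDiff_dt hX.smooth) w _
  have h3 : dt (dt (dt (fun w => k * X w))) = fun w => k * dt (dt (dt X)) w := by
    rw [h2]; exact funext fun w => hd (contDiff_dt (contDiff_dt hX.smooth)) w _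
  refine ⟨contDiff_const.mul hX.smooth, by simp [hX.zero], ?_, ?_, ?_, ?_, ?_, ?_⟩
  · rw [hd hX.smooth]; exact mul_ne_zero hk hX.du₀
  · rw [hd hX.smooth, hX.du₁, mul_zero]
  · rw [h1]; simp [hX.dt_zero]
  · rw [h2]; simp [hX.dtt_zero]
  · rw [h3]; simp [hX.dttt]
  · rw [h1, hd (contDiff_dt hX.smooth)]; exact mul_ne_zero hk hX.du₁_dt

theorem fderiv_R3_apply (L : R3 →L[ℝ] ℝ) (x y z : ℝ) :
    L (x, y, z) = x * L (1, 0, 0) + y * L (0, 1, 0) + z * L (0, 0, 1) := by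
  have : ((x, y, z) : R3) = x • (1, 0, 0) + y • (0, 1, 0) + z • (0, 0, 1) := by ext <;> simp
  rw [this]
  simp only [map_add, map_smul, smul_eq_mul]

/-- The curve `t ↦ (a(t), b(t), t)` of double zeros of a cusp unfolding `Y`, and the position
`ρ(t)` of the third zero on the line through the point with parameter `t`. -/
structure IsFoldCurve (Y : R3 → ℝ) (a b ρ : ℝ → ℝ) (k : ℝ) : Prop where
  smooth_a : ContDiff ℝ ∞ a
  smooth_b : ContDiff ℝ ∞ b
  smooth_ρ : ContDiff ℝ ∞ ρ
  a_zero : a 0 = 0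
  b_zero : b 0 = 0
  ρ_zero : ρ 0 = 0
  deriv_a : deriv a 0 = 0
  deriv_b : deriv b 0 = 0
  deriv_ρ : deriv ρ 0 < 0
  k_ne : k ≠ 0
  double_zero : ∀ᶠ w in 𝓝 (0 : R3), (Y w = 0 ∧ dt Y w = 0) ↔ (w.1 = a w.2.2 ∧ w.2.1 = b w.2.2)
  deriv_b_sign : ∀ᶠ t in 𝓝 (0 : ℝ), t ≠ 0 → 0 < k * t * deriv b t
  zeros : ∀ᶠ p in 𝓝 (0 : ℝ × ℝ), (p.2 = ρ p.1 → Y (a p.1, b p.1, p.2) = 0) ∧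
    (p.2 = p.1 → Y (a p.1, b p.1, p.2) = 0) ∧
    (p.2 ≠ p.1 → p.2 < ρ p.1 → 0 < Y (a p.1, b p.1, p.2)) ∧
    (p.2 ≠ p.1 → ρ p.1 < p.2 → Y (a p.1, b p.1, p.2) < 0)

/-- The equations `Y = ∂_τ Y = 0` are solved for `(u₀, u₁)` in terms of `τ`. Along the resulting
curve Taylor's formula gives `Y = h² S (t, h)` with `h = τ - t`. The linear part of `S` at the
origin is `m / 6 * (3 t + h)`, so the implicit function theorem yields a unique further zero near `h
= -3 t`. -/
theorem exists_foldCurve {Y : R3 → ℝ} {m : ℝ} (hY : IsCuspUnfolding Y m) (hm : m < 0) :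
    ∃ (a b ρ : ℝ → ℝ) (k : ℝ), IsFoldCurve Y a b ρ k := by
  have hY0 := hY.smooth
  have hY1 := contDiff_dt hY0
  have hY2 := contDiff_dt hY1
  have hY3 := contDiff_dt hY2
  -- the curve of double zeros
  let J : ℝ × (ℝ × ℝ) →L[ℝ] R3 :=
    (ContinuousLinearMap.fst ℝ ℝ ℝ ∘L ContinuousLinearMap.snd ℝ ℝ (ℝ × ℝ)).prod
      ((ContinuousLinearMap.snd ℝ ℝ ℝ ∘L ContinuousLinearMap.snd ℝ ℝ (ℝ × ℝ)).prod
        (ContinuousLinearMap.fst ℝ ℝ (ℝ × ℝ)))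
  have hJ : ∀ p, J p = (p.2.1, p.2.2, p.1) := fun p => rfl
  let Q : ℝ × (ℝ × ℝ) → ℝ × ℝ := fun p => (Y (J p), dt Y (J p))
  have hQ : ContDiff ℝ ∞ Q := (hY0.comp J.contDiff).prodMk (hY1.comp J.contDiff)
  have hJ0 : J 0 = 0 := map_zero _
  have hQ0 : Q 0 = 0 := by
    simp only [Q, hJ0, hY.zero, hY.dt_zero]; rfl
  have hcompJ : ∀ {Z : R3 → ℝ}, ContDiff ℝ ∞ Z →
      HasFDerivAt (fun p => Z (J p)) (fderiv ℝ Z 0 ∘L J) 0 := by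
    intro Z hZ
    have h1 : HasFDerivAt Z (fderiv ℝ Z 0) (J 0) := by
      rw [hJ0]; exact (hZ.differentiable (by simp) 0).hasFDerivAt
    exact h1.comp 0 J.hasFDerivAt
  have hQd : ∀ v, fderiv ℝ Q 0 v = (fderiv ℝ Y 0 (J v), fderiv ℝ (dt Y) 0 (J v)) := by
    intro v
    have : HasFDerivAt Q _ 0 := (hcompJ hY0).prodMk (hcompJ hY1)
    rw [this.fderiv]; rfl
  have e0 : fderiv ℝ Y 0 (0, 0, 1) = 0 := hY.dt_zero
  have e1 : fderiv ℝ (dt Y) 0 (0, 0, 1) = 0 := hY.dtt_zero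
  have e2 : fderiv ℝ (dt (dt Y)) 0 (0, 0, 1) = m := hY.dttt
  have hlin : ∀ t x y : ℝ, fderiv ℝ Q 0 (t, (x, y)) = 0 → x = 0 ∧ y = 0 := by
    intro t x y h
    rw [hQd, show J (t, (x, y)) = (x, y, t) from rfl, fderiv_R3_apply (fderiv ℝ Y 0) x y t,
      fderiv_R3_apply (fderiv ℝ (dt Y) 0) x y t, e0, e1, hY.du₁] at h
    simp only [mul_zero, add_zero, Prod.mk_eq_zero] at h
    have hx : x = 0 := (mul_eq_zero.1 h.1).resolve_right hY.du₀
    refine ⟨hx, ?_⟩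
    have h2 := h.2
    rw [hx, zero_mul, zero_add] at h2
    exact (mul_eq_zero.1 h2).resolve_right hY.du₁_dt
  obtain ⟨ψ, hψ, hψ0, hψiff, hψQ, hψd⟩ := exists_smooth_implicit_of_injective hQ hQ0
    (fun y h => Prod.ext (hlin 0 y.1 y.2 h).1 (hlin 0 y.1 y.2 h).2)
  let a : ℝ → ℝ := fun t => (ψ t).1
  let b : ℝ → ℝ := fun t => (ψ t).2
  have ha : ContDiff ℝ ∞ a := contDiff_fst.comp hψ
  have hb : ContDiff ℝ ∞ b := contDiff_snd.comp hψ
  have hψder : ∀ t, HasDerivAt ψ (fderiv ℝ ψ t 1) t := fun t =>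
    (hψ.differentiable (by simp) t).hasFDerivAt.hasDerivAt
  have had : ∀ t, HasDerivAt a (deriv a t) t := fun t =>
    (ha.differentiable (by simp) t).hasDerivAt
  have hbd : ∀ t, HasDerivAt b (deriv b t) t := fun t =>
    (hb.differentiable (by simp) t).hasDerivAt
  have hd0 := hψd 1
  have ha0 : deriv a 0 = 0 := by
    have h1 : HasDerivAt a (fderiv ℝ ψ 0 1).1 0 := (hψder 0).fst
    rw [h1.deriv]
    exact (hlin 1 _ _ hd0).1
  have hb0 : deriv b 0 = 0 := by
    have h1 : HasDerivAt b (fderiv ℝ ψ 0 1).2 0 := (hψder 0).snd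
    rw [h1.deriv]
    exact (hlin 1 _ _ hd0).2
  have ha00 : a 0 = 0 := by simp [a, hψ0]
  have hb00 : b 0 = 0 := by simp [b, hψ0]
  let c : ℝ → R3 := fun t => (a t, b t, t)
  have hc : ContDiff ℝ ∞ c := ha.prodMk (hb.prodMk contDiff_id)
  have hc0 : c 0 = 0 := by simp [c, ha00, hb00]
  have hcd : ∀ t, HasDerivAt c (deriv a t, deriv b t, 1) t := fun t =>
    (had t).prodMk ((hbd t).prodMk (hasDerivAt_id t))
  have hcomp : ∀ {Z : R3 → ℝ}, ContDiff ℝ ∞ Z → ∀ t, HasDerivAt (fun t => Z (c t))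
      (deriv a t * fderiv ℝ Z (c t) (1, 0, 0) + deriv b t * fderiv ℝ Z (c t) (0, 1, 0) +
        1 * fderiv ℝ Z (c t) (0, 0, 1)) t := by
    intro Z hZ t
    rw [← fderiv_R3_apply]
    exact (hZ.differentiable (by simp) (c t)).hasFDerivAt.comp_hasDerivAt t (hcd t)
  have hYc : ∀ᶠ t in 𝓝 (0 : ℝ), Y (c t) = 0 ∧ dt Y (c t) = 0 := by
    filter_upwards [hψQ] with t ht
    exact Prod.mk_eq_zero.1 ht
  -- the derivative of `b`
  let D : ℝ → ℝ := fun t => dt (dt Y) (c t)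
  have hD : ContDiff ℝ ∞ D := hY2.comp hc
  have hD0 : D 0 = 0 := by simp only [D, hc0, hY.dtt_zero]
  have hDd : HasDerivAt D m 0 := by
    have := hcomp hY2 0
    rw [ha0, hb0, hc0, e2] at this
    simpa using this
  have hDsign : ∀ᶠ t in 𝓝 (0 : ℝ), t ≠ 0 → 0 < m * t * D t := by
    have h1 := hasDerivAt_iff_tendsto_slope.1 hDd
    have h2 := h1.eventually (gt_mem_nhds hm)
    rw [eventually_nhdsWithin_iff] at h2
    filter_upwards [h2] with t ht hne
    have h3 := ht hne
    rw [slope_def_field, hD0, sub_zero, sub_zero] at h3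
    have h4 : m * t * D t = m * (D t / t) * t ^ 2 := by field_simp
    rw [h4]
    exact mul_pos (mul_pos_of_neg_of_neg hm h3) (by positivity)
  let α₀ : ℝ → ℝ := fun t => fderiv ℝ Y (c t) (1, 0, 0)
  let β₀ : ℝ → ℝ := fun t => fderiv ℝ Y (c t) (0, 1, 0)
  let α₁ : ℝ → ℝ := fun t => fderiv ℝ (dt Y) (c t) (1, 0, 0)
  let β₁ : ℝ → ℝ := fun t => fderiv ℝ (dt Y) (c t) (0, 1, 0)
  have hcf : ∀ {Z : R3 → ℝ}, ContDiff ℝ ∞ Z → ∀ v, Continuous fun t => fderiv ℝ Z (c t) v :=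
    fun hZ v => ((hZ.continuous_fderiv (by simp)).comp hc.continuous).clm_apply continuous_const
  have hα₀c : Continuous α₀ := hcf hY0 _
  have hβ₀c : Continuous β₀ := hcf hY0 _
  have hα₁c : Continuous α₁ := hcf hY1 _
  have hβ₁c : Continuous β₁ := hcf hY1 _
  let Δ : ℝ → ℝ := fun t => α₁ t * β₀ t - α₀ t * β₁ t
  have hΔc : Continuous Δ := (hα₁c.mul hβ₀c).sub (hα₀c.mul hβ₁c)
  have hα₀0 : α₀ 0 ≠ 0 := by simp only [α₀, hc0]; exact hY.du₀
  have hΔ0 : Δ 0 ≠ 0 := by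
    have h1 : β₀ 0 = 0 := by simp only [β₀, hc0]; exact hY.du₁
    have h2 : β₁ 0 ≠ 0 := by simp only [β₁, hc0]; exact hY.du₁_dt
    simp only [Δ, h1, mul_zero, zero_sub]
    exact neg_ne_zero.2 (mul_ne_zero hα₀0 h2)
  -- Differentiate `Y = 0` and `∂_τ Y = 0` along the curve and eliminate `deriv a t`. Since `D` has
  -- slope `m` at `0`, this makes `deriv b` change sign exactly once there.
  have hrel : ∀ᶠ t in 𝓝 (0 : ℝ), Δ t * deriv b t = α₀ t * D t := by
    filter_upwards [hYc.eventually_nhds] with t ht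
    have h1 : HasDerivAt (fun t => Y (c t)) 0 t :=
      (hasDerivAt_const t (0 : ℝ)).congr_of_eventuallyEq (ht.mono fun s hs => hs.1)
    have h2 : HasDerivAt (fun t => dt Y (c t)) 0 t :=
      (hasDerivAt_const t (0 : ℝ)).congr_of_eventuallyEq (ht.mono fun s hs => hs.2)
    have k1 := h1.unique (hcomp hY0 t)
    have k2 := h2.unique (hcomp hY1 t)
    have k3 : fderiv ℝ Y (c t) (0, 0, 1) = 0 := ht.self_of_nhds.2
    have k4 : fderiv ℝ (dt Y) (c t) (0, 0, 1) = D t := rfl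
    rw [k3] at k1
    rw [k4] at k2
    simp only [Δ, α₀, β₀, α₁, β₁]
    linear_combination (-fderiv ℝ (dt Y) (c t) (1, 0, 0)) * k1 + fderiv ℝ Y (c t) (1, 0, 0) * k2
  have hbsign : ∀ᶠ t in 𝓝 (0 : ℝ), t ≠ 0 → 0 < m * α₀ 0 * Δ 0 * t * deriv b t := by
    have ev1 : ∀ᶠ t in 𝓝 (0 : ℝ), 0 < α₀ 0 * α₀ t :=
      (continuous_const.mul hα₀c).continuousAt.eventually
        (lt_mem_nhds (mul_self_pos.2 hα₀0))
    have ev2 : ∀ᶠ t in 𝓝 (0 : ℝ), 0 < Δ 0 * Δ t :=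
      (continuous_const.mul hΔc).continuousAt.eventually (lt_mem_nhds (mul_self_pos.2 hΔ0))
    filter_upwards [ev1, ev2, hrel, hDsign] with t h1 h2 h3 h4 hne
    have hΔt : Δ t ≠ 0 := by rintro h; rw [h, mul_zero] at h2; exact lt_irrefl _ h2
    have h5 : m * α₀ 0 * Δ 0 * t * deriv b t * Δ t ^ 2 =
        (m * t * D t) * (α₀ 0 * α₀ t) * (Δ 0 * Δ t) := by
      linear_combination (m * α₀ 0 * Δ 0 * t * Δ t) * h3
    have h6 : 0 < m * α₀ 0 * Δ 0 * t * deriv b t * Δ t ^ 2 := by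
      rw [h5]; exact mul_pos (mul_pos (h4 hne) h1) h2
    exact pos_of_mul_pos_left h6 (by positivity)
  -- the third zero
  obtain ⟨R, hR, htay⟩ := exists_taylor_shift hY0
  let S : ℝ × ℝ → ℝ := fun p => dt (dt Y) (c p.1) / 2 + p.2 * (dt (dt (dt Y)) (c p.1) / 6) +
    p.2 ^ 2 * R (c p.1, p.2)
  have hc1 : ContDiff ℝ ∞ fun p : ℝ × ℝ => c p.1 := hc.comp contDiff_fst
  have hS : ContDiff ℝ ∞ S := by
    refine (((hY2.comp hc1).div_const 2).add (contDiff_snd.mul ((hY3.comp hc1).div_const 6))).add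
      ((contDiff_snd.pow 2).mul (hR.comp (hc1.prodMk contDiff_snd)))
  have hYS : ∀ᶠ t in 𝓝 (0 : ℝ), ∀ h, Y (a t, b t, t + h) = h ^ 2 * S (t, h) := by
    filter_upwards [hYc] with t ht h
    have := htay (c t) h
    rw [ht.1, ht.2] at this
    simp only [c] at this
    rw [this]
    simp only [S, c]
    ring
  have hS0 : S 0 = 0 := by
    simp only [S, Prod.fst_zero, Prod.snd_zero, hc0, hY.dtt_zero]
    simp
  have hSt : fderiv ℝ S 0 (1, 0) = m / 2 := by
    have h1 : HasDerivAt (fun t : ℝ => (t, (0 : ℝ))) (1, 0) 0 :=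
      (hasDerivAt_id _).prodMk (hasDerivAt_const _ _)
    have h2 : HasDerivAt (fun t : ℝ => S (t, 0)) (fderiv ℝ S 0 (1, 0)) 0 :=
      HasFDerivAt.comp_hasDerivAt (0 : ℝ) (f := fun t : ℝ => (t, (0 : ℝ)))
        (hS.differentiable (by simp) ((0 : ℝ), (0 : ℝ))).hasFDerivAt h1
    have h3 : (fun t : ℝ => S (t, 0)) = fun t => D t / 2 := by
      funext t; simp [S, D]
    rw [h3] at h2
    exact h2.unique (hDd.div_const 2)
  have hSh : fderiv ℝ S 0 (0, 1) = m / 6 := by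
    have h1 := hasDerivAt_slice hS 0 0
    have h3 : (fun t : ℝ => S (0, t)) = fun t => t * (m / 6 + t * R (0, t)) := by
      funext t
      simp only [S, hc0, hY.dtt_zero, hY.dttt]
      ring
    rw [h3] at h1
    let u : ℝ → ℝ := fun t => m / 6 + t * R (0, t)
    have hu : ContDiff ℝ ∞ u :=
      contDiff_const.add (contDiff_id.mul (hR.comp (contDiff_const.prodMk contDiff_id)))
    have h5 : pd S (0, 0) = 1 * u 0 + 0 * deriv u 0 :=
      h1.unique ((hasDerivAt_id' (0 : ℝ)).mul (hu.differentiable (by simp) 0).hasDerivAt)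
    rw [show fderiv ℝ S 0 (0, 1) = pd S (0, 0) from rfl, h5]
    simp [u]
  have hSlin : ∀ x y : ℝ, fderiv ℝ S 0 (x, y) = x * (m / 2) + y * (m / 6) := by
    intro x y
    have : ((x, y) : ℝ × ℝ) = x • (1, 0) + y • (0, 1) := by ext <;> simp
    rw [this, map_add, map_smul, map_smul, hSt, hSh]
    rfl
  obtain ⟨η, hη, hη0, hηiff, hηS, hηd⟩ := exists_smooth_implicit_of_injective hS hS0 (fun y hy => by
    rw [hSlin] at hy
    have : y * (m / 6) = 0 := by linarith
    exact (mul_eq_zero.1 this).resolve_right (by linarith))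
  let ρ : ℝ → ℝ := fun t => t + η t
  have hρ : ContDiff ℝ ∞ ρ := contDiff_id.add hη
  have hρd : deriv ρ 0 = -2 := by
    have h1 := hηd 1
    rw [hSlin] at h1
    -- From `m / 2 + η'(0) * m / 6 = 0`; consequently `ρ' = 1 - 3 = -2`.
    have h2 : fderiv ℝ η 0 1 = -3 := by
      have h3 : m * (3 + fderiv ℝ η 0 1) = 0 := by linarith
      have := (mul_eq_zero.1 h3).resolve_left hm.ne
      linarith
    have h3 : HasDerivAt η (fderiv ℝ η 0 1) 0 :=
      (hη.differentiable (by simp) 0).hasFDerivAt.hasDerivAt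
    have h4 : HasDerivAt ρ (1 + fderiv ℝ η 0 1) 0 := (hasDerivAt_id (0 : ℝ)).add h3
    rw [h4.deriv, h2]
    norm_num
  -- sign of `S`
  have hpdS : ∀ᶠ p in 𝓝 (0 : ℝ × ℝ), pd S p < 0 := by
    refine (contDiff_pd hS).continuous.continuousAt.eventually (gt_mem_nhds ?_)
    change fderiv ℝ S 0 (0, 1) < 0
    rw [hSh]; linarith
  obtain ⟨r, hr, hrball⟩ := Metric.eventually_nhds_iff_ball.1 hpdS
  have hanti : ∀ t, |t| < r → StrictAntiOn (fun h => S (t, h)) (Ioo (-r) r) := by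
    intro t ht
    refine strictAntiOn_of_deriv_neg (convex_Ioo _ _)
      (hS.continuous.comp (by fun_prop)).continuousOn ?_
    intro h hh
    rw [interior_Ioo] at hh
    rw [(hasDerivAt_slice hS t h).deriv]
    refine hrball _ ?_
    rw [mem_ball_zero_iff, Prod.norm_def, max_lt_iff]
    exact ⟨ht, abs_lt.2 hh⟩
  have hηsmall : ∀ᶠ t in 𝓝 (0 : ℝ), |η t| < r := by
    refine hη.continuous.abs.continuousAt.eventually (gt_mem_nhds ?_)
    simp only [hη0, abs_zero]; exact hr
  have hsmall : ∀ᶠ t in 𝓝 (0 : ℝ), |t| < r :=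
    continuous_abs.continuousAt.eventually (gt_mem_nhds (by rwa [abs_zero]))
  have hdiff : ∀ᶠ p in 𝓝 (0 : ℝ × ℝ), |p.2 - p.1| < r := by
    have : Continuous fun p : ℝ × ℝ => |p.2 - p.1| := by fun_prop
    exact this.continuousAt.eventually (gt_mem_nhds (by simpa using hr))
  have hfst : Tendsto (fun p : ℝ × ℝ => p.1) (𝓝 0) (𝓝 0) := continuous_fst.tendsto _
  refine ⟨a, b, ρ, m * α₀ 0 * Δ 0, ha, hb, hρ, ha00, hb00, by simp [ρ, hη0], ha0, hb0,
    by rw [hρd]; norm_num, mul_ne_zero (mul_ne_zero hm.ne hα₀0) hΔ0, ?_, hbsign, ?_⟩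
  · have hK : Continuous fun w : R3 => ((w.2.2, (w.1, w.2.1)) : ℝ × (ℝ × ℝ)) := by fun_prop
    filter_upwards [(hK.tendsto 0).eventually hψiff] with w hw
    have h1 : Q (w.2.2, (w.1, w.2.1)) = (Y w, dt Y w) := rfl
    rw [h1, Prod.mk_eq_zero] at hw
    rw [hw, Prod.ext_iff]
  · filter_upwards [hfst.eventually hYS, hfst.eventually hηS, hfst.eventually hηsmall,
      hfst.eventually hsmall, hdiff] with ⟨t, τ⟩ h1 h2 h3 h4 h5
    simp only at h1 h2 h3 h4 h5 ⊢
    have hYτ : Y (a t, b t, τ) = (τ - t) ^ 2 * S (t, τ - t) := by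
      have := h1 (τ - t)
      rwa [add_sub_cancel] at this
    have hsq : τ ≠ t → 0 < (τ - t) ^ 2 := fun hne => by
      have := sub_ne_zero.2 hne
      positivity
    have hη' : η t = ρ t - t := by simp [ρ]
    refine ⟨fun hτ => ?_, fun hτ => ?_, fun hne hτ => ?_, fun hne hτ => ?_⟩
    · rw [hYτ, hτ, ← hη', h2, mul_zero]
    · rw [hYτ, hτ, sub_self]; ring
    · rw [hYτ]
      have := hanti t h4 (abs_lt.1 h5) (abs_lt.1 h3) (by rw [hη']; linarith)
      simp only [h2] at this
      exact mul_pos (hsq hne) this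
    · rw [hYτ]
      have := hanti t h4 (abs_lt.1 h3) (abs_lt.1 h5) (by rw [hη']; linarith)
      simp only [h2] at this
      exact mul_neg_of_pos_of_neg (hsq hne) this

end DriftSing

/-! ### Boxes adapted to the fold curve. -/

namespace DriftSing

/-- A box adapted to a fold curve: the field `Y` points inwards at the ends `τ = ±δ`, and the
part of the fold curve in the box is parametrized by the interval `(t₁, t₂)`. -/
structure IsCuspBox (Y : R3 → ℝ) (a b ρ : ℝ → ℝ) (k ε₀ ε₁ δ t₁ t₂ : ℝ) : Prop where
  ε₀_pos : 0 < ε₀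
  ε₁_pos : 0 < ε₁
  δ_pos : 0 < δ
  t₁_neg : t₁ < 0
  t₂_pos : 0 < t₂
  inward : ∀ u₀ u₁, |u₀| < ε₀ → |u₁| < ε₁ → Y (u₀, u₁, δ) < 0 ∧ 0 < Y (u₀, u₁, -δ)
  double_zero : ∀ w ∈ box ε₀ ε₁ δ, (Y w = 0 ∧ dt Y w = 0) ↔
    ∃ t ∈ Ioo t₁ t₂, w = (a t, b t, t)
  curve_mem : ∀ t ∈ Ioo t₁ t₂, |a t| < ε₀ ∧ |b t| < ε₁ ∧ |t| < δ ∧ |ρ t| < δ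
  ρ_neg : ∀ t ∈ Ioo 0 t₂, ρ t < 0
  ρ_pos : ∀ t ∈ Ioo t₁ 0, 0 < ρ t
  zeros : ∀ t ∈ Ioo t₁ t₂, Y (a t, b t, ρ t) = 0 ∧ Y (a t, b t, t) = 0 ∧ ∀ τ, |τ| < δ → τ ≠ t →
    (τ < ρ t → 0 < Y (a t, b t, τ)) ∧ (ρ t < τ → Y (a t, b t, τ) < 0)
  deriv_b_pos : ∀ t ∈ Ioo 0 t₂, 0 < k * deriv b t
  deriv_b_neg : ∀ t ∈ Ioo t₁ 0, 0 < -k * deriv b t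

theorem abs_lt_of_mem_ball_R3 {w : R3} {r : ℝ} (h0 : |w.1| < r) (h1 : |w.2.1| < r)
    (h2 : |w.2.2| < r) : w ∈ Metric.ball (0 : R3) r := by
  rw [mem_ball_zero_iff, Prod.norm_def, max_lt_iff, Prod.norm_def, max_lt_iff]
  exact ⟨h0, h1, h2⟩

/-- The sizes are chosen in the order `δ`, `ε₀`, `ε₁`. First `δ` fixes inward-pointing ends on the
central line; `ε₀` preserves this for nearby lines; then `ε₁` is so small that the fold curve leaves
the box only through the sides `|u₁| = ε₁`. As `k * b` decreases before `0` and increases after it,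
the curve meets the box in a single parameter interval. -/
theorem IsFoldCurve.exists_cuspBox {Y : R3 → ℝ} (hY : ContDiff ℝ ∞ Y) {a b ρ : ℝ → ℝ} {k : ℝ}
    (h : IsFoldCurve Y a b ρ k) {η : ℝ} (hη : 0 < η) {O : Set R3} (hO : O ∈ 𝓝 (0 : R3)) :
    ∃ ε₀ ε₁ δ t₁ t₂ : ℝ, IsCuspBox Y a b ρ k ε₀ ε₁ δ t₁ t₂ ∧ box ε₀ ε₁ δ ⊆ O ∧ -η < t₁ ∧
      t₂ < η := by
  obtain ⟨r₁, hr₁, hb₁⟩ := Metric.eventually_nhds_iff_ball.1 (h.double_zero.and hO)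
  obtain ⟨r₂, hr₂, hb₂⟩ := Metric.eventually_nhds_iff_ball.1 h.zeros
  have hρ' : ∀ᶠ t in 𝓝 (0 : ℝ), deriv ρ t < 0 :=
    (h.smooth_ρ.continuous_deriv (by simp)).continuousAt.eventually (gt_mem_nhds h.deriv_ρ)
  obtain ⟨r₃, hr₃, hb₃⟩ := Metric.eventually_nhds_iff_ball.1 (h.deriv_b_sign.and hρ')
  set r := min (min r₁ r₂) r₃ with hr
  have hr0 : 0 < r := lt_min (lt_min hr₁ hr₂) hr₃
  have hrr₁ : r ≤ r₁ := (min_le_left _ _).trans (min_le_left _ _)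
  have hrr₂ : r ≤ r₂ := (min_le_left _ _).trans (min_le_right _ _)
  have hrr₃ : r ≤ r₃ := min_le_right _ _
  have hzeros : ∀ t τ, |t| < r → |τ| < r → (τ = ρ t → Y (a t, b t, τ) = 0) ∧
      (τ = t → Y (a t, b t, τ) = 0) ∧ (τ ≠ t → τ < ρ t → 0 < Y (a t, b t, τ)) ∧
      (τ ≠ t → ρ t < τ → Y (a t, b t, τ) < 0) := by
    intro t τ ht hτ
    refine hb₂ (t, τ) ?_
    rw [mem_ball_zero_iff, Prod.norm_def, max_lt_iff]
    exact ⟨ht.trans_le hrr₂, hτ.trans_le hrr₂⟩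
  have hder : ∀ t, |t| < r → (t ≠ 0 → 0 < k * t * deriv b t) ∧ deriv ρ t < 0 := by
    intro t ht
    exact hb₃ t (by rw [mem_ball_zero_iff]; exact ht.trans_le hrr₃)
  set δ := r / 2 with hδ
  have hδ0 : 0 < δ := by positivity
  have hδr : δ < r := by linarith
  -- the field points inwards
  have hin : Y (0, 0, δ) < 0 ∧ 0 < Y (0, 0, -δ) := by
    have h1 := hzeros 0 δ (by simpa using hr0) (by rw [abs_of_pos hδ0]; exact hδr)
    have h2 := hzeros 0 (-δ) (by simpa using hr0) (by rw [abs_neg, abs_of_pos hδ0]; exact hδr)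
    rw [h.a_zero, h.b_zero, h.ρ_zero] at h1 h2
    exact ⟨h1.2.2.2 hδ0.ne' hδ0, h2.2.2.1 (by linarith) (by linarith)⟩
  have hev : ∀ᶠ u in 𝓝 (0 : ℝ × ℝ), Y (u.1, u.2, δ) < 0 ∧ 0 < Y (u.1, u.2, -δ) := by
    have c1 : Continuous fun u : ℝ × ℝ => Y (u.1, u.2, δ) := hY.continuous.comp (by fun_prop)
    have c2 : Continuous fun u : ℝ × ℝ => Y (u.1, u.2, -δ) := hY.continuous.comp (by fun_prop)
    exact (c1.continuousAt.eventually (gt_mem_nhds hin.1)).and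
      (c2.continuousAt.eventually (lt_mem_nhds hin.2))
  obtain ⟨e, he, heb⟩ := Metric.eventually_nhds_iff_ball.1 hev
  set ε₀ := min e r with hε₀
  have hε₀0 : 0 < ε₀ := lt_min he hr0
  -- a small parameter interval
  have hsmall : ∀ᶠ t in 𝓝 (0 : ℝ), |a t| < ε₀ ∧ |ρ t| < δ := by
    refine (h.smooth_a.continuous.abs.continuousAt.eventually (gt_mem_nhds ?_)).and
      (h.smooth_ρ.continuous.abs.continuousAt.eventually (gt_mem_nhds ?_))
    · simpa [h.a_zero] using hε₀0
    · simpa [h.ρ_zero] using hδ0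
  obtain ⟨s, hs, hsb⟩ := Metric.eventually_nhds_iff_ball.1 hsmall
  set T := min (min s η) δ / 2 with hT
  have hm0 : 0 < min (min s η) δ := lt_min (lt_min hs hη) hδ0
  have hT0 : 0 < T := by positivity
  have hTs : T < s := by
    have : min (min s η) δ ≤ s := (min_le_left _ _).trans (min_le_left _ _)
    linarith
  have hTη : T < η := by
    have : min (min s η) δ ≤ η := (min_le_left _ _).trans (min_le_right _ _)
    linarith
  have hTδ : T < δ := by
    have : min (min s η) δ ≤ δ := min_le_right _ _
    linarith
  -- monotonicity of `k * b`
  let β : ℝ → ℝ := fun t => k * b t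
  have hβc : Continuous β := continuous_const.mul h.smooth_b.continuous
  have hβd : ∀ t, deriv β t = k * deriv b t := fun t =>
    deriv_const_mul k (h.smooth_b.differentiable (by simp) t)
  have hβ0 : β 0 = 0 := by simp [β, h.b_zero]
  have hdpos : ∀ t, 0 < t → t < r → 0 < k * deriv b t := by
    intro t h0 h1
    have := (hder t (by rwa [abs_of_pos h0])).1 h0.ne'
    have h2 : 0 < t * (k * deriv b t) := by linarith
    exact pos_of_mul_pos_right h2 h0.le
  have hdneg : ∀ t, t < 0 → -r < t → 0 < -k * deriv b t := by
    intro t h0 h1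
    have := (hder t (by rw [abs_of_neg h0]; linarith)).1 h0.ne
    have h2 : 0 < (-t) * (-k * deriv b t) := by linarith
    exact pos_of_mul_pos_right h2 (by linarith)
  have hmono : StrictMonoOn β (Icc 0 δ) := by
    refine strictMonoOn_of_deriv_pos (convex_Icc _ _) hβc.continuousOn fun t ht => ?_
    rw [interior_Icc] at ht
    rw [hβd]
    exact hdpos t ht.1 (ht.2.trans hδr)
  have hanti : StrictAntiOn β (Icc (-δ) 0) := by
    refine strictAntiOn_of_deriv_neg (convex_Icc _ _) hβc.continuousOn fun t ht => ?_
    rw [interior_Icc] at ht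
    rw [hβd]
    have := hdneg t ht.2 (by linarith [ht.1])
    linarith
  have hk : 0 < |k| := abs_pos.2 h.k_ne
  have hβT : 0 < β T := by
    rw [← hβ0]
    exact hmono ⟨le_rfl, hδ0.le⟩ ⟨hT0.le, hTδ.le⟩ hT0
  have hβT' : 0 < β (-T) := by
    rw [← hβ0]
    exact hanti ⟨by linarith, by linarith⟩ ⟨by linarith, le_rfl⟩ (by linarith)
  -- With this `ε₁`, both branches of `|k * b|` reach the level `|k| * ε₁` no later than `±T`. The
  -- parameters where they do so are `t₁` and `t₂`.
  set ε₁ := min ε₀ (min (β T) (β (-T)) / |k|) with hε₁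
  have hε₁0 : 0 < ε₁ := lt_min hε₀0 (div_pos (lt_min hβT hβT') hk)
  have hkε : |k| * ε₁ ≤ min (β T) (β (-T)) := by
    have : ε₁ ≤ min (β T) (β (-T)) / |k| := min_le_right _ _
    rw [le_div_iff₀ hk] at this
    linarith
  have hkε0 : 0 < |k| * ε₁ := mul_pos hk hε₁0
  obtain ⟨t₂, ht₂, hβt₂⟩ := intermediate_value_Icc hT0.le hβc.continuousOn
    (show |k| * ε₁ ∈ Icc (β 0) (β T) from ⟨by rw [hβ0]; exact hkε0.le, hkε.trans (min_le_left _ _)⟩)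
  obtain ⟨t₁, ht₁, hβt₁⟩ := intermediate_value_Icc' (show -T ≤ 0 by linarith) hβc.continuousOn
    (show |k| * ε₁ ∈ Icc (β 0) (β (-T)) from
      ⟨by rw [hβ0]; exact hkε0.le, hkε.trans (min_le_right _ _)⟩)
  have ht₂0 : 0 < t₂ := lt_of_le_of_ne ht₂.1 (by rintro rfl; rw [hβ0] at hβt₂; linarith)
  have ht₁0 : t₁ < 0 := lt_of_le_of_ne ht₁.2 (by rintro rfl; rw [hβ0] at hβt₁; linarith)
  have habs : ∀ t, |t| < δ → (|b t| < ε₁ ↔ t ∈ Ioo t₁ t₂) := by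
    intro t ht
    rw [abs_lt] at ht
    have h1 : |b t| < ε₁ ↔ |β t| < |k| * ε₁ := by
      simp only [β, abs_mul]
      exact (mul_lt_mul_iff_right₀ hk).symm
    rw [h1]
    rcases le_total 0 t with h0 | h0
    · have hm : t ∈ Icc 0 δ := ⟨h0, ht.2.le⟩
      have h2 : 0 ≤ β t := by
        rw [← hβ0]; exact hmono.monotoneOn ⟨le_rfl, hδ0.le⟩ hm h0
      rw [abs_of_nonneg h2, ← hβt₂, hmono.lt_iff_lt hm ⟨ht₂.1, by linarith [ht₂.2]⟩]
      exact ⟨fun h3 => ⟨by linarith, h3⟩, fun h3 => h3.2⟩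
    · have hm : t ∈ Icc (-δ) 0 := ⟨ht.1.le, h0⟩
      have h2 : 0 ≤ β t := by
        rw [← hβ0]; exact hanti.antitoneOn hm ⟨by linarith, le_rfl⟩ h0
      rw [abs_of_nonneg h2, ← hβt₁, hanti.lt_iff_gt hm ⟨by linarith [ht₁.1], ht₁.2⟩]
      exact ⟨fun h3 => ⟨h3, by linarith⟩, fun h3 => h3.1⟩
  have hIoo : ∀ t ∈ Ioo t₁ t₂, |t| < T := fun t ht =>
    abs_lt.2 ⟨by linarith [ht.1, ht₁.1], by linarith [ht.2, ht₂.2]⟩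
  have hcurve : ∀ t ∈ Ioo t₁ t₂, |a t| < ε₀ ∧ |b t| < ε₁ ∧ |t| < δ ∧ |ρ t| < δ := by
    intro t ht
    have h1 := hIoo t ht
    have h2 := hsb t (by rw [mem_ball_zero_iff]; exact h1.trans hTs)
    exact ⟨h2.1, (habs t (h1.trans hTδ)).2 ht, h1.trans hTδ, h2.2⟩
  have hε₀r : ε₀ ≤ r := min_le_right _ _
  have hε₁r : ε₁ ≤ r := (min_le_left _ _).trans hε₀r
  have hbox : ∀ w ∈ box ε₀ ε₁ δ, w ∈ Metric.ball (0 : R3) r₁ := fun w hw =>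
    abs_lt_of_mem_ball_R3 (by linarith [hw.1]) (by linarith [hw.2.1]) (by linarith [hw.2.2])
  have hρanti : StrictAntiOn ρ (Icc (-δ) δ) := by
    refine strictAntiOn_of_deriv_neg (convex_Icc _ _) h.smooth_ρ.continuous.continuousOn
      fun t ht => ?_
    rw [interior_Icc] at ht
    exact (hder t (abs_lt.2 ⟨by linarith [ht.1], by linarith [ht.2]⟩)).2
  refine ⟨ε₀, ε₁, δ, t₁, t₂, ⟨hε₀0, hε₁0, hδ0, ht₁0, ht₂0, ?_, ?_, hcurve, ?_, ?_, ?_, ?_, ?_⟩,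
    fun w hw => (hb₁ w (hbox w hw)).2, by linarith [ht₁.1], by linarith [ht₂.2]⟩
  · intro u₀ u₁ h0 h1
    refine heb (u₀, u₁) ?_
    rw [mem_ball_zero_iff, Prod.norm_def, max_lt_iff]
    exact ⟨h0.trans_le (min_le_left _ _),
      h1.trans_le ((min_le_left _ _).trans (min_le_left _ _))⟩
  · intro w hw
    rw [(hb₁ w (hbox w hw)).1]
    constructor
    · rintro ⟨h0, h1⟩
      refine ⟨w.2.2, (habs _ hw.2.2).1 ?_, Prod.ext h0 (Prod.ext h1 rfl)⟩
      rw [← h1]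
      exact hw.2.1
    · rintro ⟨t, -, rfl⟩
      exact ⟨rfl, rfl⟩
  · intro t ht
    have h1 := (hcurve t ⟨ht₁0.trans ht.1, ht.2⟩).2.2.1
    rw [abs_lt] at h1
    rw [← h.ρ_zero]
    exact hρanti ⟨by linarith, hδ0.le⟩ ⟨h1.1.le, h1.2.le⟩ ht.1
  · intro t ht
    have h1 := (hcurve t ⟨ht.1, ht.2.trans ht₂0⟩).2.2.1
    rw [abs_lt] at h1
    rw [← h.ρ_zero]
    exact hρanti ⟨h1.1.le, h1.2.le⟩ ⟨by linarith, hδ0.le⟩ ht.2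
  · intro t ht
    have h1 := hcurve t ht
    have htr := h1.2.2.1.trans hδr
    refine ⟨(hzeros t (ρ t) htr (h1.2.2.2.trans hδr)).1 rfl, (hzeros t t htr htr).2.1 rfl,
      fun τ hτ hne => ?_⟩
    have h2 := hzeros t τ htr (hτ.trans hδr)
    exact ⟨h2.2.2.1 hne, h2.2.2.2 hne⟩
  · intro t ht
    exact hdpos t ht.1 (by linarith [ht.2, ht₂.2])
  · intro t ht
    exact hdneg t ht.2 (by linarith [ht.1, ht₁.1])

/-! ### Inverses on intervals, and planar curves as graphs. -/

section OneDim

/-- A smooth function with nonvanishing derivative on an interval has a smooth inverse. -/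
theorem exists_inverse_on_interval {b : ℝ → ℝ} (hb : ContDiff ℝ ∞ b) {s t k : ℝ}
    (hpos : ∀ x ∈ Ioo s t, 0 < k * deriv b x) :
    ∃ κ : ℝ → ℝ, IsOpen (b '' Ioo s t) ∧ ContDiffOn ℝ ∞ κ (b '' Ioo s t) ∧
      ∀ x ∈ Ioo s t, κ (b x) = x := by
  have hmono : StrictMonoOn (fun x => k * b x) (Ioo s t) := by
    refine strictMonoOn_of_deriv_pos (convex_Ioo _ _)
      (continuous_const.mul hb.continuous).continuousOn fun x hx => ?_
    rw [interior_Ioo] at hx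
    rw [deriv_const_mul k (hb.differentiable (by simp) x)]
    exact hpos x hx
  have hinj : InjOn b (Ioo s t) := fun x hx y hy hxy => hmono.injOn hx hy (by simp [hxy])
  let κ := Function.invFunOn b (Ioo s t)
  have hκ : ∀ x ∈ Ioo s t, κ (b x) = x := fun x hx => hinj.leftInvOn_invFunOn hx
  have key : ∀ x ∈ Ioo s t, (b '' Ioo s t) ∈ 𝓝 (b x) ∧ ContDiffAt ℝ ∞ κ (b x) := by
    intro x hx
    have hne : deriv b x ≠ 0 := by
      rintro h
      have := hpos x hx
      rw [h, mul_zero] at this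
      exact lt_irrefl _ this
    obtain ⟨e, hxe, heb, hes⟩ := exists_smooth_inverse_of_injective hb (a := x) (fun v hv => by
      rw [fderiv_eq_smul_deriv, smul_eq_mul] at hv
      exact (mul_eq_zero.1 hv).resolve_right hne)
    have hbt : b x ∈ e.target := by rw [← heb]; exact e.map_source hxe
    have hex : e.symm (b x) = x := by rw [← heb, e.left_inv hxe]
    have hev : ∀ᶠ y in 𝓝 (b x), e.symm y ∈ Ioo s t ∧ b (e.symm y) = y := by
      have h1 : ContinuousAt e.symm (b x) := e.continuousAt_symm hbt
      have h2 : Ioo s t ∈ 𝓝 (e.symm (b x)) := by rw [hex]; exact isOpen_Ioo.mem_nhds hx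
      filter_upwards [h1 h2, e.open_target.mem_nhds hbt] with y hy hyt
      exact ⟨hy, by rw [← heb, e.right_inv hyt]⟩
    refine ⟨?_, ?_⟩
    · filter_upwards [hev] with y hy
      exact ⟨_, hy.1, hy.2⟩
    · refine (hes.contDiffAt (e.open_target.mem_nhds hbt)).congr_of_eventuallyEq ?_
      filter_upwards [hev] with y hy
      have := hκ _ hy.1
      rwa [hy.2] at this
  refine ⟨κ, isOpen_iff_mem_nhds.2 ?_, ?_, hκ⟩
  · rintro _ ⟨x, hx, rfl⟩
    exact (key x hx).1
  · rintro _ ⟨x, hx, rfl⟩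
    exact (key x hx).2.contDiffWithinAt

theorem image_Ioo_of_strictMonoOn {b : ℝ → ℝ} (hb : Continuous b) {t₁ t₂ s₁ s₂ : ℝ}
    (hmono : StrictMonoOn b (Icc t₁ t₂)) (hs : s₁ ≤ s₂) (h1 : t₁ ≤ s₁) (h2 : s₂ ≤ t₂) :
    b '' Ioo s₁ s₂ = Ioo (b s₁) (b s₂) := by
  have hm : ∀ x ∈ Icc s₁ s₂, x ∈ Icc t₁ t₂ := fun x hx => ⟨h1.trans hx.1, hx.2.trans h2⟩
  apply Subset.antisymm
  · rintro _ ⟨x, hx, rfl⟩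
    exact ⟨hmono (hm _ ⟨le_rfl, hs⟩) (hm _ (Ioo_subset_Icc_self hx)) hx.1,
      hmono (hm _ (Ioo_subset_Icc_self hx)) (hm _ ⟨hs, le_rfl⟩) hx.2⟩
  · exact intermediate_value_Ioo hs hb.continuousOn

/-- A smooth curve in the plane `{x = 0}` with monotone last coordinate is a graph. -/
theorem exists_graph {A B : ℝ → ℝ} (hA : ContDiff ℝ ∞ A) (hB : ContDiff ℝ ∞ B) {t₁ t₂ : ℝ}
    (h1 : t₁ < 0) (h2 : 0 < t₂) (hA0 : A 0 = 0) (hB0 : B 0 = 0)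
    (hpos : ∀ t ∈ Icc t₁ t₂, 0 < deriv B t) :
    ∃ (θ : ℝ → ℝ) (α β : ℝ), α < 0 ∧ 0 < β ∧ ContDiffOn ℝ ∞ θ (Ioo α β) ∧ θ 0 = 0 ∧
      deriv θ 0 * deriv B 0 = deriv A 0 ∧
      planeGraph θ (Ioo α β) = (fun t => ((0, A t, B t) : R3)) '' Ioo t₁ t₂ ∧
      planeGraph θ (Ioo α 0) = (fun t => ((0, A t, B t) : R3)) '' Ioo t₁ 0 ∧
      planeGraph θ (Ioo 0 β) = (fun t => ((0, A t, B t) : R3)) '' Ioo 0 t₂ := by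
  obtain ⟨κ, hopen, hκ, hκB⟩ := exists_inverse_on_interval hB (k := 1) (s := t₁) (t := t₂)
    (fun x hx => by rw [one_mul]; exact hpos x (Ioo_subset_Icc_self hx))
  have hmono : StrictMonoOn B (Icc t₁ t₂) := by
    refine strictMonoOn_of_deriv_pos (convex_Icc _ _) hB.continuous.continuousOn fun t ht => ?_
    rw [interior_Icc] at ht
    exact hpos t (Ioo_subset_Icc_self ht)
  have h0 : (0 : ℝ) ∈ Icc t₁ t₂ := ⟨h1.le, h2.le⟩
  have hBt₁ : B t₁ < 0 := by
    rw [← hB0]; exact hmono ⟨le_rfl, (h1.trans h2).le⟩ h0 h1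
  have hBt₂ : 0 < B t₂ := by
    rw [← hB0]; exact hmono h0 ⟨(h1.trans h2).le, le_rfl⟩ h2
  have him : ∀ s₁ s₂, s₁ ≤ s₂ → t₁ ≤ s₁ → s₂ ≤ t₂ → B '' Ioo s₁ s₂ = Ioo (B s₁) (B s₂) :=
    fun s₁ s₂ hs h1 h2 => image_Ioo_of_strictMonoOn hB.continuous hmono hs h1 h2
  have hgraph : ∀ s₁ s₂, s₁ ≤ s₂ → t₁ ≤ s₁ → s₂ ≤ t₂ →
      planeGraph (fun s => A (κ s)) (Ioo (B s₁) (B s₂)) =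
        (fun t => ((0, A t, B t) : R3)) '' Ioo s₁ s₂ := by
    intro s₁ s₂ hs h1 h2
    rw [planeGraph, ← him s₁ s₂ hs h1 h2, image_image]
    refine image_congr fun t ht => ?_
    simp only [hκB t ⟨h1.trans_lt ht.1, ht.2.trans_le h2⟩]
  have hfull := him t₁ t₂ (h1.trans h2).le le_rfl le_rfl
  have hθ : ContDiffOn ℝ ∞ (fun s => A (κ s)) (Ioo (B t₁) (B t₂)) := by
    rw [← hfull]; exact hA.comp_contDiffOn hκ
  have hκ0 : κ 0 = 0 := by
    have := hκB 0 ⟨h1, h2⟩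
    rwa [hB0] at this
  refine ⟨fun s => A (κ s), B t₁, B t₂, hBt₁, hBt₂, hθ, by simp [hκ0, hA0], ?_,
    hgraph _ _ (h1.trans h2).le le_rfl le_rfl, ?_, ?_⟩
  · have d1 : HasDerivAt (fun s => A (κ s)) (deriv (fun s => A (κ s)) 0) (B 0) := by
      rw [hB0]
      exact ((hθ.contDiffAt (Ioo_mem_nhds hBt₁ hBt₂)).differentiableAt (by simp)).hasDerivAt
    have d2 := d1.comp (0 : ℝ) (hB.differentiable (by simp) 0).hasDerivAt
    have d3 : ((fun s => A (κ s)) ∘ B) =ᶠ[𝓝 0] A := by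
      filter_upwards [Ioo_mem_nhds h1 h2] with t ht
      simp only [Function.comp_apply, hκB t ht]
    rw [← d3.deriv_eq, d2.deriv]
  · have := hgraph t₁ 0 h1.le le_rfl h2.le
    rwa [hB0] at this
  · have := hgraph 0 t₂ h2.le h1.le le_rfl
    rwa [hB0] at this

end OneDim

end DriftSing

/-! ### The surfaces of heteroclinic orbits over one branch of the fold curve. -/

namespace DriftSing

theorem hasDerivAt_line {f : R3 → ℝ} {w : R3} (hf : DifferentiableAt ℝ f w) (v : R3) :
    HasDerivAt (fun s : ℝ => f (w + s • v)) (fderiv ℝ f w v) 0 := by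
  have h1 : HasDerivAt (fun s : ℝ => w + s • v) v 0 := by
    simpa using ((hasDerivAt_id (0 : ℝ)).smul_const v).const_add w
  have h2 : HasFDerivAt f (fderiv ℝ f w) (w + (0 : ℝ) • v) := by
    simpa using hf.hasFDerivAt
  exact h2.comp_hasDerivAt (0 : ℝ) h1

theorem symm_mem_image_iff (Θ : OpenPartialHomeomorph R3 R3) {A : Set R3} (hA : A ⊆ Θ.target)
    {w : R3} (hw : w ∈ Θ.target) : Θ.symm w ∈ Θ.symm '' A ↔ w ∈ A := by
  constructor
  · rintro ⟨v, hv, hvw⟩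
    rwa [← Θ.symm.injOn (hA hv) hw hvw]
  · exact mem_image_of_mem _

/-- The derivative of a function expressed in the coordinates `Θ`. -/
theorem fderiv_comp_chart {Θ : OpenPartialHomeomorph R3 R3}
    (hΘ : ContDiffOn ℝ ∞ Θ Θ.source) (hΘs : ContDiffOn ℝ ∞ Θ.symm Θ.target) {f : R3 → ℝ} {w : R3}
    (hw : w ∈ Θ.target) (hf : DifferentiableAt ℝ f w) (v : R3) :
    fderiv ℝ (fun p => f (Θ p)) (Θ.symm w) (fderiv ℝ Θ.symm w v) = fderiv ℝ f w v := by
  have d1 : DifferentiableAt ℝ Θ.symm w :=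
    (hΘs.contDiffAt (Θ.open_target.mem_nhds hw)).differentiableAt (by simp)
  have d2 : DifferentiableAt ℝ Θ (Θ.symm w) :=
    (hΘ.contDiffAt (Θ.open_source.mem_nhds (Θ.map_target hw))).differentiableAt (by simp)
  have d3 : DifferentiableAt ℝ f (Θ (Θ.symm w)) := by rwa [Θ.right_inv hw]
  have d4 : DifferentiableAt ℝ (fun p => f (Θ p)) (Θ.symm w) := d3.comp _ d2
  have h1 : (fun p => f (Θ p)) ∘ Θ.symm =ᶠ[𝓝 w] f := by
    filter_upwards [Θ.open_target.mem_nhds hw] with u hu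
    simp only [Function.comp_apply, Θ.right_inv hu]
  rw [← h1.fderiv_eq, fderiv_comp w d4 d1]
  rfl

/-- The points of the box between the curve `τ = ρ` (excluded) and the fold curve (included). -/
def foldStrip (a b ρ : ℝ → ℝ) (s t ε : ℝ) (B : Set R3) : Set R3 :=
  {w ∈ B | ∃ x ∈ Ioo s t, w.1 = a x ∧ w.2.1 = b x ∧ 0 < ε * (w.2.2 - ρ x) ∧ 0 ≤ ε * (x - w.2.2)}

theorem isSmoothSurface_foldStrip {Θ : OpenPartialHomeomorph R3 R3}
    (hΘ : ContDiffOn ℝ ∞ Θ Θ.source) (hΘs : ContDiffOn ℝ ∞ Θ.symm Θ.target)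
    {B : Set R3} (hBo : IsOpen B) (hB : B ⊆ Θ.target) {a b ρ : ℝ → ℝ} (ha : ContDiff ℝ ∞ a)
    (hb : ContDiff ℝ ∞ b) (hρ : ContDiff ℝ ∞ ρ) {s t k ε : ℝ} (hε : ε ≠ 0)
    (hpos : ∀ x ∈ Ioo s t, 0 < k * deriv b x)
    (hmem : ∀ x ∈ Ioo s t, ((a x, b x, x) : R3) ∈ B ∧ 0 < ε * (x - ρ x)) :
    IsSmoothSurfaceWithBoundary (Θ.symm '' foldStrip a b ρ s t ε B)
      ((fun x => Θ.symm (a x, b x, x)) '' Ioo s t) := by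
  obtain ⟨κ, hopen, hκ, hκb⟩ := exists_inverse_on_interval hb hpos
  let D : Set R3 := {w | w.2.1 ∈ b '' Ioo s t}
  have hDo : IsOpen D := hopen.preimage (by fun_prop)
  have hκD : ContDiffOn ℝ ∞ (fun w : R3 => κ w.2.1) D :=
    hκ.comp (by fun_prop : ContDiff ℝ ∞ fun w : R3 => w.2.1).contDiffOn fun w hw => hw
  -- On one branch `u₁` determines the fold parameter `κ u₁`. Then `Ψ = 0` is the cylinder over the
  -- branch, `χ ≥ 0` cuts it at the fold curve, which becomes the boundary, and the open condition
  -- `ξ > 0`, excluding the third zero, is absorbed into the neighbourhood `N`.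
  let Ψ : R3 → ℝ := fun w => w.1 - a (κ w.2.1)
  let χ : R3 → ℝ := fun w => ε * (κ w.2.1 - w.2.2)
  let ξ : R3 → ℝ := fun w => ε * (w.2.2 - ρ (κ w.2.1))
  have hΨ : ContDiffOn ℝ ∞ Ψ D := contDiff_fst.contDiffOn.sub (ha.comp_contDiffOn hκD)
  have hτ : ContDiffOn ℝ ∞ (fun w : R3 => w.2.2) D :=
    (by fun_prop : ContDiff ℝ ∞ fun w : R3 => w.2.2).contDiffOn
  have hχ : ContDiffOn ℝ ∞ χ D := contDiffOn_const.mul (hκD.sub hτ)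
  have hξ : ContDiffOn ℝ ∞ ξ D := contDiffOn_const.mul (hτ.sub (hρ.comp_contDiffOn hκD))
  let N : Set R3 := B ∩ (D ∩ ξ ⁻¹' Ioi 0)
  have hNo : IsOpen N := hBo.inter (hξ.continuousOn.isOpen_inter_preimage hDo isOpen_Ioi)
  have hNB : N ⊆ B := fun w hw => hw.1
  have hNt : N ⊆ Θ.target := hNB.trans hB
  have hND : N ⊆ D := fun w hw => hw.2.1
  have hSN : foldStrip a b ρ s t ε B ⊆ N := by
    rintro w ⟨hw, x, hx, h1, h2, h3, h4⟩
    refine ⟨hw, ?_, ?_⟩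
    · change w.2.1 ∈ b '' Ioo s t
      rw [h2]; exact mem_image_of_mem _ hx
    · change 0 < ε * (w.2.2 - ρ (κ w.2.1))
      rw [h2, hκb x hx]; exact h3
  have hS_iff : ∀ w ∈ N, w ∈ foldStrip a b ρ s t ε B ↔ Ψ w = 0 ∧ 0 ≤ χ w := by
    rintro w ⟨hwB, ⟨x, hx, hxw⟩, hw⟩
    simp only [ξ, mem_preimage, mem_Ioi] at hw
    simp only [Ψ, χ]
    rw [← hxw, hκb x hx] at hw ⊢
    constructor
    · rintro ⟨-, x', hx', h1, h2, h3, h4⟩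
      have : x' = x := by rw [← hκb x' hx', ← h2, ← hxw, hκb x hx]
      subst this
      exact ⟨by linarith, h4⟩
    · rintro ⟨h1, h2⟩
      exact ⟨hwB, x, hx, by linarith, hxw.symm, hw, h2⟩
  let Γ : Set R3 := (fun x => ((a x, b x, x) : R3)) '' Ioo s t
  have hΓN : Γ ⊆ N := by
    rintro _ ⟨x, hx, rfl⟩
    refine hSN ⟨(hmem x hx).1, x, hx, rfl, rfl, (hmem x hx).2, ?_⟩
    simp
  have hΓ_iff : ∀ w ∈ N, w ∈ Γ ↔ Ψ w = 0 ∧ χ w = 0 := by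
    rintro w ⟨hwB, ⟨x, hx, hxw⟩, hw⟩
    simp only [Ψ, χ]
    rw [← hxw, hκb x hx]
    constructor
    · rintro ⟨x', hx', rfl⟩
      have : x' = x := by
        rw [← hκb x' hx', ← hκb x hx]
        exact congrArg κ hxw.symm
      subst this
      exact ⟨by simp, by simp⟩
    · rintro ⟨h1, h2⟩
      have h3 : x = w.2.2 := by
        have := (mul_eq_zero.1 h2).resolve_left hε
        linarith
      exact ⟨x, hx, Prod.ext (by simp only; linarith) (Prod.ext hxw h3)⟩
  have hΓeq : (fun x => Θ.symm (a x, b x, x)) '' Ioo s t = Θ.symm '' Γ := by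
    rw [image_image]
  rw [hΓeq]
  -- pull back to the original coordinates
  have hOo : ∀ M ⊆ Θ.target, IsOpen M → IsOpen (Θ.symm '' M) := fun M hM hMo =>
    Θ.symm.isOpen_image_of_subset_source hMo hM
  have hpull : ∀ {f : R3 → ℝ}, ContDiffOn ℝ ∞ f D →
      ContDiffOn ℝ ∞ (fun p => f (Θ p)) (Θ.symm '' N) := by
    intro f hf
    refine hf.comp (hΘ.mono ?_) ?_
    · rintro _ ⟨w, hw, rfl⟩
      exact Θ.map_target (hNt hw)
    · rintro _ ⟨w, hw, rfl⟩
      rw [Θ.right_inv (hNt hw)]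
      exact hND hw
  have hdiff : ∀ {f : R3 → ℝ}, ContDiffOn ℝ ∞ f D → ∀ w ∈ N, DifferentiableAt ℝ f w :=
    fun hf w hw => (hf.contDiffAt (hDo.mem_nhds (hND hw))).differentiableAt (by simp)
  have dΨ0 : ∀ w ∈ N, fderiv ℝ Ψ w (1, 0, 0) = 1 := by
    intro w hw
    have h1 := hasDerivAt_line (hdiff hΨ w hw) (1, 0, 0)
    have h2 : HasDerivAt (fun s : ℝ => w.1 + s - a (κ w.2.1)) 1 0 :=
      ((hasDerivAt_id (0 : ℝ)).const_add _).sub_const _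
    refine h1.unique (h2.congr_of_eventuallyEq (Eventually.of_forall fun s => ?_))
    simp [Ψ]
  have dΨτ : ∀ w ∈ N, fderiv ℝ Ψ w (0, 0, 1) = 0 := by
    intro w hw
    have h1 := hasDerivAt_line (hdiff hΨ w hw) (0, 0, 1)
    refine h1.unique ((hasDerivAt_const (0 : ℝ) (Ψ w)).congr_of_eventuallyEq
      (Eventually.of_forall fun s => ?_))
    simp [Ψ]
  have dχτ : ∀ w ∈ N, fderiv ℝ χ w (0, 0, 1) = -ε := by
    intro w hw
    have h1 := hasDerivAt_line (hdiff hχ w hw) (0, 0, 1)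
    have h2 : HasDerivAt (fun s : ℝ => ε * (κ w.2.1 - (w.2.2 + s))) (ε * (-1)) 0 :=
      (((hasDerivAt_id (0 : ℝ)).const_add _).const_sub _).const_mul ε
    rw [mul_neg_one] at h2
    refine h1.unique (h2.congr_of_eventuallyEq (Eventually.of_forall fun s => ?_))
    simp [χ]
  have hSt := hSN.trans hNt
  have hΓt := hΓN.trans hNt
  have hΓS : Γ ⊆ foldStrip a b ρ s t ε B := fun w hw =>
    (hS_iff w (hΓN hw)).2 ⟨((hΓ_iff w (hΓN hw)).1 hw).1, ((hΓ_iff w (hΓN hw)).1 hw).2.ge⟩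
  refine ⟨image_mono hΓS, ?_, ?_⟩
  · rintro _ ⟨⟨w, hw, rfl⟩, hnot⟩
    have hwN := hSN hw
    rw [symm_mem_image_iff Θ hΓt (hNt hwN)] at hnot
    -- Off the boundary curve the inequality for `χ` is strict, so on a smaller open set the surface
    -- is given by `Ψ = 0` alone.
    let M : Set R3 := N ∩ (D ∩ χ ⁻¹' Ioi 0)
    have hMN : M ⊆ N := inter_subset_left
    have hMo : IsOpen M := hNo.inter (hχ.continuousOn.isOpen_inter_preimage hDo isOpen_Ioi)
    have hwM : w ∈ M := by
      refine ⟨hwN, hND hwN, ?_⟩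
      have h1 := (hS_iff w hwN).1 hw
      refine lt_of_le_of_ne h1.2 fun h2 => hnot ((hΓ_iff w hwN).2 ⟨h1.1, h2.symm⟩)
    refine ⟨Θ.symm '' M, hOo M (hMN.trans hNt) hMo, mem_image_of_mem _ hwM, fun p => Ψ (Θ p),
      (hpull hΨ).mono (image_mono hMN), ?_, ?_⟩
    · intro h0
      have h1 := fderiv_comp_chart hΘ hΘs (hNt hwN) (hdiff hΨ w hwN) (1, 0, 0)
      rw [h0, dΨ0 w hwN] at h1
      simp at h1
    · ext q
      constructor
      · rintro ⟨hqS, ⟨v, hv, rfl⟩⟩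
        rw [symm_mem_image_iff Θ hSt (hNt (hMN hv))] at hqS
        refine ⟨mem_image_of_mem _ hv, ?_⟩
        change Ψ (Θ (Θ.symm v)) = 0
        rw [Θ.right_inv (hNt (hMN hv))]
        exact ((hS_iff v (hMN hv)).1 hqS).1
      · rintro ⟨⟨v, hv, rfl⟩, h0⟩
        beta_reduce at h0
        rw [Θ.right_inv (hNt (hMN hv))] at h0
        exact ⟨mem_image_of_mem _ ((hS_iff v (hMN hv)).2 ⟨h0, (show 0 < χ v from hv.2.2).le⟩),
          mem_image_of_mem _ hv⟩
  · rintro _ ⟨w, hw, rfl⟩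
    have hwN := hΓN hw
    refine ⟨Θ.symm '' N, hOo N hNt hNo, mem_image_of_mem _ hwN, fun p => Ψ (Θ p),
      fun p => χ (Θ p), hpull hΨ, hpull hχ, ?_, ?_, ?_⟩
    -- Evaluate on the images of `∂_τ` and `∂_{u₀}`: `Ψ` does not depend on `τ`, `χ` has
    -- `τ`-derivative `-ε`, and `Ψ` has `u₀`-derivative `1`.
    · rw [LinearIndependent.pair_iff]
      intro x y hxy
      have h1 := fderiv_comp_chart hΘ hΘs (hNt hwN) (hdiff hΨ w hwN)
      have h2 := fderiv_comp_chart hΘ hΘs (hNt hwN) (hdiff hχ w hwN)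
      have key : ∀ v, x * fderiv ℝ Ψ w v + y * fderiv ℝ χ w v = 0 := by
        intro v
        rw [← h1 v, ← h2 v]
        have := DFunLike.congr_fun hxy (fderiv ℝ Θ.symm w v)
        simpa using this
      have k1 := key (0, 0, 1)
      rw [dΨτ w hwN, dχτ w hwN, mul_zero, zero_add] at k1
      have hy : y = 0 := (mul_eq_zero.1 k1).resolve_right (neg_ne_zero.2 hε)
      have k2 := key (1, 0, 0)
      rw [dΨ0 w hwN, hy, zero_mul, add_zero, mul_one] at k2
      exact ⟨k2, hy⟩
    · ext q
      constructor
      · rintro ⟨hqS, ⟨v, hv, rfl⟩⟩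
        rw [symm_mem_image_iff Θ hSt (hNt hv)] at hqS
        refine ⟨mem_image_of_mem _ hv, ?_⟩
        change Ψ (Θ (Θ.symm v)) = 0 ∧ 0 ≤ χ (Θ (Θ.symm v))
        rw [Θ.right_inv (hNt hv)]
        exact (hS_iff v hv).1 hqS
      · rintro ⟨⟨v, hv, rfl⟩, h0⟩
        beta_reduce at h0
        rw [Θ.right_inv (hNt hv)] at h0
        exact ⟨mem_image_of_mem _ ((hS_iff v hv).2 h0), mem_image_of_mem _ hv⟩
    · ext q
      constructor
      · rintro ⟨hqS, ⟨v, hv, rfl⟩⟩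
        rw [symm_mem_image_iff Θ hΓt (hNt hv)] at hqS
        refine ⟨mem_image_of_mem _ hv, ?_⟩
        change Ψ (Θ (Θ.symm v)) = 0 ∧ χ (Θ (Θ.symm v)) = 0
        rw [Θ.right_inv (hNt hv)]
        exact (hΓ_iff v hv).1 hqS
      · rintro ⟨⟨v, hv, rfl⟩, h0⟩
        beta_reduce at h0
        rw [Θ.right_inv (hNt hv)] at h0
        exact ⟨mem_image_of_mem _ ((hΓ_iff v hv).2 h0), mem_image_of_mem _ hv⟩

/-- The unstable set of a half-stable equilibrium `t`, on either side of `r`. -/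
theorem unstable_iff_signed {g : ℝ → ℝ} (hg : ContDiff ℝ 1 g) {δ r t ε y₀ : ℝ}
    (hε : ε = 1 ∨ ε = -1) (hrδ : |r| < δ) (htδ : |t| < δ) (hrt : 0 < ε * (t - r)) (hr : g r = 0)
    (ht : g t = 0) (hsign : ∀ x, |x| < δ → x ≠ t → 0 < ε * (x - r) → ε * g x < 0)
    (hy₀ : |y₀| < δ) :
    (ScalarConverges (fun x => -g x) δ y₀ t ↔ 0 < ε * (y₀ - r) ∧ 0 ≤ ε * (t - y₀)) ∧
      (0 < ε * (y₀ - r) → 0 < ε * (t - y₀) → ScalarConverges g δ y₀ r) := by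
  rw [abs_lt] at hrδ htδ
  have hy := abs_lt.1 hy₀
  rcases hε with rfl | rfl
  · simp only [one_mul, sub_pos, sub_nonneg] at *
    refine ⟨unstable_iff hg hrδ.1 hrt htδ.2 hr ht (fun x hx => ?_) (fun x hx => ?_) hy₀,
      fun h1 h2 => ?_⟩
    · exact hsign x (abs_lt.2 ⟨by linarith [hx.1], by linarith [hx.2]⟩) hx.2.ne hx.1
    · exact hsign x (abs_lt.2 ⟨by linarith [hx.1], hx.2⟩) hx.1.ne' (hrt.trans hx.1)
    · refine ScalarConverges.of_neg hg hy.2 h1 hrδ.1.le (fun x hx => ?_) hr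
      exact hsign x (abs_lt.2 ⟨by linarith [hx.1], by linarith [hx.2]⟩)
        (hx.2.trans_lt h2).ne hx.1
  · have e1 : ∀ x y : ℝ, 0 < -1 * (x - y) ↔ x < y := fun x y => by
      constructor <;> intro h <;> linarith
    have e2 : ∀ x y : ℝ, 0 ≤ -1 * (x - y) ↔ x ≤ y := fun x y => by
      constructor <;> intro h <;> linarith
    have e3 : ∀ x : ℝ, -1 * x < 0 ↔ 0 < x := fun x => by
      constructor <;> intro h <;> linarith
    simp only [e1, e2, e3] at *
    refine ⟨unstable_iff' hg hrδ.2 hrt htδ.1 hr ht (fun x hx => ?_) (fun x hx => ?_) hy₀,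
      fun h1 h2 => ?_⟩
    · exact hsign x (abs_lt.2 ⟨by linarith [hx.1], by linarith [hx.2]⟩) hx.1.ne' hx.2
    · exact hsign x (abs_lt.2 ⟨hx.1, by linarith [hx.2]⟩) hx.2.ne (hx.2.trans hrt)
    · refine ScalarConverges.of_pos hg hy.1 h1 hrδ.2.le (fun x hx => ?_) hr
      exact hsign x (abs_lt.2 ⟨by linarith [hx.1], by linarith [hx.2]⟩)
        (h2.trans_le hx.1).ne' hx.2

/-- The dynamics near one branch of the fold curve. -/
theorem fold_branch_dynamics {F : R3 → R3} (hF : ContDiff ℝ 1 F)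
    {Θ : OpenPartialHomeomorph R3 R3} {Y : R3 → ℝ}
    (hΘ : ContDiffOn ℝ ∞ Θ Θ.source) (hΘs : ContDiffOn ℝ ∞ Θ.symm Θ.target)
    (hsymm : ∀ w ∈ Θ.target, fderiv ℝ Θ.symm w (0, 0, Y w) = F (Θ.symm w))
    (hmap : ∀ p ∈ Θ.source, fderiv ℝ Θ p (F p) = (0, 0, Y (Θ p))) (hY : ContDiff ℝ ∞ Y)
    {ε₀ ε₁ δ : ℝ} (hB : box ε₀ ε₁ δ ⊆ Θ.target) {a b ρ : ℝ → ℝ} (ha : ContDiff ℝ ∞ a)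
    (hb : ContDiff ℝ ∞ b) (hρ : ContDiff ℝ ∞ ρ) {s t k ε : ℝ} (hε : ε = 1 ∨ ε = -1)
    (hpos : ∀ x ∈ Ioo s t, 0 < k * deriv b x)
    (hmem : ∀ x ∈ Ioo s t, |a x| < ε₀ ∧ |b x| < ε₁ ∧ |x| < δ ∧ |ρ x| < δ)
    (hxρ : ∀ x ∈ Ioo s t, 0 < ε * (x - ρ x))
    (hzero : ∀ x ∈ Ioo s t, Y (a x, b x, ρ x) = 0 ∧ Y (a x, b x, x) = 0)
    (hsign : ∀ x ∈ Ioo s t, ∀ τ, |τ| < δ → τ ≠ x → 0 < ε * (τ - ρ x) →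
      ε * Y (a x, b x, τ) < 0) {U γ W ς : Set R3} (hU : U = Θ.symm '' box ε₀ ε₁ δ)
    (hγ : γ = (fun x => Θ.symm (a x, b x, x)) '' Ioo s t)
    (hς : ς = (fun x => Θ.symm (a x, b x, ρ x)) '' Ioo s t)
    (hW : W = limitSet (ConvergesBackward F U) U γ) :
    IsSmoothSurfaceWithBoundary W γ ∧
      IsHeteroclinicFamily (ConvergesBackward F U) (ConvergesForward F U) (W \ γ) γ ς ∧
      ς = targets (ConvergesForward F U) (W \ γ) ∧
      ∀ p ∈ W \ γ, ∃ w ∈ Θ.target, p = Θ.symm w ∧ ε * Y w < 0 := by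
  have hε0 : ε ≠ 0 := by rcases hε with rfl | rfl <;> norm_num
  have hslice : ∀ u₀ u₁ : ℝ, ContDiff ℝ 1 fun y => Y (u₀, u₁, y) := fun u₀ u₁ =>
    (hY.of_le (by simp)).comp (by fun_prop)
  have hcm : ∀ x ∈ Ioo s t, ((a x, b x, x) : R3) ∈ box ε₀ ε₁ δ := fun x hx =>
    ⟨(hmem x hx).1, (hmem x hx).2.1, (hmem x hx).2.2.1⟩
  have hrm : ∀ x ∈ Ioo s t, ((a x, b x, ρ x) : R3) ∈ box ε₀ ε₁ δ := fun x hx =>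
    ⟨(hmem x hx).1, (hmem x hx).2.1, (hmem x hx).2.2.2⟩
  -- On the line through the fold point with parameter `x` the equilibria `ρ x` and `x` bound the
  -- unstable segment; `ε` is the sign of `x - ρ x`.
  have hscal := fun (x : ℝ) (hx : x ∈ Ioo s t) (τ : ℝ) (hτ : |τ| < δ) =>
    unstable_iff_signed (hslice (a x) (b x)) hε (hmem x hx).2.2.2 (hmem x hx).2.2.1 (hxρ x hx)
      (hzero x hx).1 (hzero x hx).2 (hsign x hx) hτ
  -- both relations in coordinates
  have hfwd : ∀ {w w' : R3}, w ∈ box ε₀ ε₁ δ → w' ∈ box ε₀ ε₁ δ →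
      (ConvergesForward F U (Θ.symm w) (Θ.symm w') ↔ w.1 = w'.1 ∧ w.2.1 = w'.2.1 ∧
        ScalarConverges (fun y => Y (w.1, w.2.1, y)) δ w.2.2 w'.2.2) := by
    intro w w' hw hw'
    rw [hU]
    exact convergesForward_iff hΘ hΘs hsymm hmap hB hw hw'
  have hneg : ∀ y : ℝ, ((0, 0, -y) : R3) = -(0, 0, y) := fun y => by ext <;> simp
  have hbwd : ∀ {w w' : R3}, w ∈ box ε₀ ε₁ δ → w' ∈ box ε₀ ε₁ δ →
      (ConvergesBackward F U (Θ.symm w) (Θ.symm w') ↔ w.1 = w'.1 ∧ w.2.1 = w'.2.1 ∧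
        ScalarConverges (fun y => -Y (w.1, w.2.1, y)) δ w.2.2 w'.2.2) := by
    intro w w' hw hw'
    rw [convergesBackward_iff, hU]
    exact convergesForward_iff (Y := fun w => -Y w) hΘ hΘs
      (fun w hw => by rw [hneg, map_neg, hsymm w hw])
      (fun p hp => by rw [map_neg, hmap p hp, hneg]) hB hw hw'
  have hsrc : ∀ w ∈ box ε₀ ε₁ δ, ∀ x ∈ Ioo s t,
      (ConvergesBackward F U (Θ.symm w) (Θ.symm (a x, b x, x)) ↔
        w.1 = a x ∧ w.2.1 = b x ∧ 0 < ε * (w.2.2 - ρ x) ∧ 0 ≤ ε * (x - w.2.2)) := by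
    intro w hw x hx
    rw [hbwd hw (hcm x hx)]
    constructor
    · rintro ⟨h1, h2, h3⟩
      simp only at h1 h2 h3
      rw [h1, h2] at h3
      exact ⟨h1, h2, (hscal x hx _ hw.2.2).1.1 h3⟩
    · rintro ⟨h1, h2, h3⟩
      refine ⟨h1, h2, ?_⟩
      rw [h1, h2]
      exact (hscal x hx _ hw.2.2).1.2 h3
  have hWS : W = Θ.symm '' foldStrip a b ρ s t ε (box ε₀ ε₁ δ) := by
    rw [hW, hγ]
    ext p
    constructor
    · rintro ⟨hp, _, ⟨x, hx, rfl⟩, hconv⟩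
      rw [hU] at hp
      obtain ⟨w, hw, rfl⟩ := hp
      exact ⟨w, ⟨hw, x, hx, (hsrc w hw x hx).1 hconv⟩, rfl⟩
    · rintro ⟨w, ⟨hw, x, hx, h⟩, rfl⟩
      exact ⟨by rw [hU]; exact mem_image_of_mem _ hw, _, ⟨x, hx, rfl⟩, (hsrc w hw x hx).2 h⟩
  have hdiffW : ∀ p, p ∈ W \ γ ↔ ∃ w ∈ box ε₀ ε₁ δ, p = Θ.symm w ∧ ∃ x ∈ Ioo s t,
      w.1 = a x ∧ w.2.1 = b x ∧ 0 < ε * (w.2.2 - ρ x) ∧ 0 < ε * (x - w.2.2) := by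
    intro p
    rw [hWS, hγ]
    constructor
    · rintro ⟨⟨w, ⟨hw, x, hx, h1, h2, h3, h4⟩, rfl⟩, hnot⟩
      refine ⟨w, hw, rfl, x, hx, h1, h2, h3, lt_of_le_of_ne h4 fun h5 => hnot ⟨x, hx, ?_⟩⟩
      have h6 : x = w.2.2 := by
        have := (mul_eq_zero.1 h5.symm).resolve_left hε0
        linarith
      exact congrArg Θ.symm (Prod.ext h1.symm (Prod.ext h2.symm h6))
    · rintro ⟨w, hw, rfl, x, hx, h1, h2, h3, h4⟩
      refine ⟨⟨w, ⟨hw, x, hx, h1, h2, h3, h4.le⟩, rfl⟩, ?_⟩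
      rintro ⟨x', hx', heq⟩
      have h5 := Θ.symm.injOn (hB (hcm x' hx')) (hB hw) heq
      -- Injectivity of `b` on the branch excludes that a point of one line is the fold point of
      -- another parameter.
      have hbx : b x' = b x := by rw [← h2, ← h5]
      have hxx : x' = x := by
        obtain ⟨κ, -, -, hκ⟩ := exists_inverse_on_interval hb hpos
        rw [← hκ x' hx', hbx, hκ x hx]
      rw [← h5, hxx] at h4
      simp at h4
  have htgt : ∀ w ∈ box ε₀ ε₁ δ, ∀ x ∈ Ioo s t, w.1 = a x → w.2.1 = b x →
      0 < ε * (w.2.2 - ρ x) → 0 < ε * (x - w.2.2) →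
      ConvergesForward F U (Θ.symm w) (Θ.symm (a x, b x, ρ x)) := by
    intro w hw x hx h1 h2 h3 h4
    rw [hfwd hw (hrm x hx)]
    refine ⟨h1, h2, ?_⟩
    rw [h1, h2]
    exact (hscal x hx _ hw.2.2).2 h3 h4
  -- the midpoint between the two equilibria on a line
  have hmid : ∀ x ∈ Ioo s t, ∃ w ∈ box ε₀ ε₁ δ, w.1 = a x ∧ w.2.1 = b x ∧
      0 < ε * (w.2.2 - ρ x) ∧ 0 < ε * (x - w.2.2) := by
    intro x hx
    have h1 := hmem x hx
    have h2 := hxρ x hx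
    refine ⟨(a x, b x, (x + ρ x) / 2), ⟨h1.1, h1.2.1, ?_⟩, rfl, rfl, ?_, ?_⟩
    · have h3 := abs_lt.1 h1.2.2.1
      have h4 := abs_lt.1 h1.2.2.2
      exact abs_lt.2 ⟨by simp only; linarith, by simp only; linarith⟩
    · have : ε * ((x + ρ x) / 2 - ρ x) = ε * (x - ρ x) / 2 := by ring
      simp only [this]; linarith
    · have : ε * (x - (x + ρ x) / 2) = ε * (x - ρ x) / 2 := by ring
      simp only [this]; linarith
  refine ⟨?_, ⟨?_, ?_⟩, ?_, ?_⟩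
  · rw [hWS, hγ]
    exact isSmoothSurface_foldStrip hΘ hΘs (isOpen_box _ _ _) hB ha hb hρ hε0 hpos
      fun x hx => ⟨hcm x hx, hxρ x hx⟩
  · intro p hp
    obtain ⟨w, hw, rfl, x, hx, h1, h2, h3, h4⟩ := (hdiffW p).1 hp
    refine ⟨_, by rw [hγ]; exact mem_image_of_mem _ hx, _, by rw [hς]; exact mem_image_of_mem _ hx,
      ?_, (hsrc w hw x hx).2 ⟨h1, h2, h3, h4.le⟩, htgt w hw x hx h1 h2 h3 h4⟩
    intro heq
    have h5 := Θ.symm.injOn (hB (hcm x hx)) (hB (hrm x hx)) heq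
    have h6 : x = ρ x := congrArg (fun w : R3 => w.2.2) h5
    have h7 := hxρ x hx
    rw [← h6, sub_self, mul_zero] at h7
    exact lt_irrefl _ h7
  · intro q hq
    rw [hγ] at hq
    obtain ⟨x, hx, rfl⟩ := hq
    obtain ⟨w, hw, h1, h2, h3, h4⟩ := hmid x hx
    exact ⟨Θ.symm w, (hdiffW _).2 ⟨w, hw, rfl, x, hx, h1, h2, h3, h4⟩,
      (hsrc w hw x hx).2 ⟨h1, h2, h3, h4.le⟩⟩
  · rw [hς]
    ext q
    constructor
    · rintro ⟨x, hx, rfl⟩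
      obtain ⟨w, hw, h1, h2, h3, h4⟩ := hmid x hx
      exact ⟨Θ.symm w, (hdiffW _).2 ⟨w, hw, rfl, x, hx, h1, h2, h3, h4⟩,
        htgt w hw x hx h1 h2 h3 h4⟩
    · rintro ⟨p, hp, hpq⟩
      obtain ⟨w, hw, rfl, x, hx, h1, h2, h3, h4⟩ := (hdiffW p).1 hp
      exact ⟨x, hx, (htgt w hw x hx h1 h2 h3 h4).unique hF hpq⟩
  · intro p hp
    obtain ⟨w, hw, rfl, x, hx, h1, h2, h3, h4⟩ := (hdiffW p).1 hp
    refine ⟨w, hB hw, rfl, ?_⟩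
    have h5 := hsign x hx w.2.2 hw.2.2 (by
      intro h
      rw [h, sub_self, mul_zero] at h4
      exact lt_irrefl _ h4) h3
    rwa [← h1, ← h2] at h5

end DriftSing

/-! ### Assembly of the local dynamics. -/

namespace DriftSing

/-- The projection to the plane `{x = 0}` of a smooth curve with vertical tangent at the origin
is locally a graph over the last coordinate. -/
theorem exists_graph_of_curve {q : ℝ → R3} (hq : ContDiff ℝ ∞ q) (hq0 : q 0 = 0) {v : ℝ}
    (hv : 0 < v) (hq' : HasDerivAt q (0, 0, v) 0) :
    ∃ η > 0, ∀ t₁ t₂, -η < t₁ → t₁ < 0 → 0 < t₂ → t₂ < η →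
      ∃ (θ : ℝ → ℝ) (α β : ℝ), α < 0 ∧ 0 < β ∧ ContDiffOn ℝ ∞ θ (Ioo α β) ∧ θ 0 = 0 ∧
        deriv θ 0 = 0 ∧
        planeGraph θ (Ioo α β) = (fun t => ((0, (q t).2) : R3)) '' Ioo t₁ t₂ ∧
        planeGraph θ (Ioo α 0) = (fun t => ((0, (q t).2) : R3)) '' Ioo t₁ 0 ∧
        planeGraph θ (Ioo 0 β) = (fun t => ((0, (q t).2) : R3)) '' Ioo 0 t₂ := by
  have hA : ContDiff ℝ ∞ fun t => (q t).2.1 := by fun_prop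
  have hB : ContDiff ℝ ∞ fun t => (q t).2.2 := by fun_prop
  have hA' : deriv (fun t => (q t).2.1) 0 = 0 := by
    exact (((ContinuousLinearMap.fst ℝ ℝ ℝ).comp
      (ContinuousLinearMap.snd ℝ ℝ (ℝ × ℝ))).hasFDerivAt.comp_hasDerivAt (0 : ℝ) hq').deriv
  have hB' : deriv (fun t => (q t).2.2) 0 = v := by
    exact (((ContinuousLinearMap.snd ℝ ℝ ℝ).comp
      (ContinuousLinearMap.snd ℝ ℝ (ℝ × ℝ))).hasFDerivAt.comp_hasDerivAt (0 : ℝ) hq').deriv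
  have hev : ∀ᶠ t in 𝓝 (0 : ℝ), 0 < deriv (fun t => (q t).2.2) t :=
    (hB.continuous_deriv (by simp)).continuousAt.eventually (lt_mem_nhds (by rwa [hB']))
  obtain ⟨η, hη, hball⟩ := Metric.eventually_nhds_iff_ball.1 hev
  refine ⟨η, hη, fun t₁ t₂ h1 h2 h3 h4 => ?_⟩
  obtain ⟨θ, α, β, k1, k2, k3, k4, k5, k6⟩ := exists_graph hA hB h2 h3 (by simp [hq0])
    (by simp [hq0]) (fun t ht => hball t (by
      rw [mem_ball_zero_iff, Real.norm_eq_abs, abs_lt]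
      exact ⟨by linarith [ht.1], by linarith [ht.2]⟩))
  refine ⟨θ, α, β, k1, k2, k3, k4, ?_, k6⟩
  rw [hA', hB'] at k5
  exact (mul_eq_zero.1 k5).resolve_right hv.ne'

/-- The dynamics of `k F` in the preimage of a small box, where the sign `k` is such that the
boxes are forward invariant. -/
theorem exists_localDynamics {F : R3 → R3} (hF : ContDiff ℝ 1 F)
    {Θ : OpenPartialHomeomorph R3 R3} {X : R3 → ℝ} (hΘ : IsFlowBox F Θ X) {m c k : ℝ}
    (hX : IsCuspUnfolding X m) (hk : k = 1 ∨ k = -1) (hm : k * m < 0) {f : R3 → ℝ}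
    (hdx : ∀ w ∈ Θ.target, X w = 0 → dt X w = dx f (Θ.symm w)) (hc : 0 < c)
    (hΘc : fderiv ℝ Θ.symm 0 (0, 0, 1) = (0, 0, c)) {O : Set R3} (hO : O ∈ 𝓝 (0 : R3)) :
    ∃ B : Set R3, IsOpen B ∧ 0 ∈ B ∧ B ⊆ O ∧ B ⊆ Θ.target ∧
      LocalDynamics (Θ.symm '' B) {p | p.1 = 0 ∧ dx f p = 0}
        (ConvergesBackward (fun p => k • F p) (Θ.symm '' B))
        (ConvergesForward (fun p => k • F p) (Θ.symm '' B)) := by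
  have hk0 : k ≠ 0 := by rcases hk with rfl | rfl <;> norm_num
  have h0t : (0 : R3) ∈ Θ.target := by
    have := Θ.map_source hΘ.zero_mem
    rwa [hΘ.map_zero] at this
  have hs0 : Θ.symm 0 = 0 := by
    have := Θ.left_inv hΘ.zero_mem
    rwa [hΘ.map_zero] at this
  have hYX := hX.const_mul hk0
  set Y : R3 → ℝ := fun w => k * X w with hYdef
  have hY0 : ∀ w, Y w = 0 ↔ X w = 0 := fun w => by simp [hYdef, hk0]
  have hdtY : ∀ w, dt Y w = 0 ↔ dt X w = 0 := by
    intro w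
    have : dt Y w = k * dt X w := by
      simp only [dt, hYdef]
      rw [fderiv_const_mul (hX.smooth.differentiable (by simp) w)]
      simp
    rw [this]
    simp [hk0]
  obtain ⟨a, b, ρ, κ, hfold⟩ := exists_foldCurve hYX hm
  -- A globally smooth extension of the inverse chart, so that the two image curves are smooth on
  -- all of `ℝ`, as `exists_graph_of_curve` asks. It is exact on the box chosen below.
  obtain ⟨P, hP, hPΘ⟩ := exists_contDiff_eventuallyEq (Θ.open_target.mem_nhds h0t) hΘ.smooth_symm
  have hP0 : P 0 = 0 := by rw [hPΘ.eq_of_nhds, hs0]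
  have hP' : HasFDerivAt P (fderiv ℝ Θ.symm 0) 0 := by
    rw [← hPΘ.fderiv_eq]
    exact (hP.differentiable (by simp) 0).hasFDerivAt
  have hcurve : ∀ {s : ℝ → R3} {v : ℝ}, s 0 = 0 → HasDerivAt s (0, 0, v) 0 →
      HasDerivAt (fun t => P (s t)) (0, 0, v * c) 0 := by
    intro s v h0 hs
    have h1 : HasFDerivAt P (fderiv ℝ Θ.symm 0) (s 0) := by rwa [h0]
    have h2 := h1.comp_hasDerivAt (0 : ℝ) hs
    have h3 : ((0, 0, v) : R3) = v • (0, 0, 1) := by simp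
    rw [h3, map_smul, hΘc] at h2
    simpa [Function.comp_def] using h2
  have ha' : HasDerivAt a 0 0 := by
    simpa [hfold.deriv_a] using (hfold.smooth_a.differentiable (by simp) 0).hasDerivAt
  have hb' : HasDerivAt b 0 0 := by
    simpa [hfold.deriv_b] using (hfold.smooth_b.differentiable (by simp) 0).hasDerivAt
  have hρ' : HasDerivAt ρ (deriv ρ 0) 0 := (hfold.smooth_ρ.differentiable (by simp) 0).hasDerivAt
  have hneg : HasDerivAt (fun t : ℝ => -t) (-1) 0 := (hasDerivAt_id (0 : ℝ)).neg
  have hcomp : ∀ {g : ℝ → ℝ} {g' : ℝ}, HasDerivAt g g' 0 →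
      HasDerivAt (fun t => g (-t)) (-g') 0 := by
    intro g g' hg
    have h1 : HasDerivAt g g' (-0) := by rwa [neg_zero]
    simpa [Function.comp_def] using h1.comp (0 : ℝ) hneg
  have hsm := hfold.smooth_a
  have hsb := hfold.smooth_b
  have hsρ := hfold.smooth_ρ
  obtain ⟨η₁, hη₁, hgraph₁⟩ := exists_graph_of_curve (q := fun t => P (a t, b t, t))
    (by fun_prop) (by simp only [hfold.a_zero, hfold.b_zero]; exact hP0) (v := 1 * c) (by linarith)
    (hcurve (by simp [hfold.a_zero, hfold.b_zero])
      (ha'.prodMk (hb'.prodMk (hasDerivAt_id (0 : ℝ)))))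
  -- Since `ρ` decreases, the parameter is reversed to make the last coordinate increase. Thus
  -- targets of the branch `t > 0` have negative last coordinate. Both image curves have velocity
  -- along `y₂` at `0`, so both graphs have slope zero there.
  obtain ⟨η₂, hη₂, hgraph₂⟩ := exists_graph_of_curve (q := fun t => P (a (-t), b (-t), ρ (-t)))
    (by fun_prop) (by simp only [neg_zero, hfold.a_zero, hfold.b_zero, hfold.ρ_zero]; exact hP0)
    (v := -deriv ρ 0 * c) (mul_pos (neg_pos.2 hfold.deriv_ρ) hc)
    (hcurve (by simp [hfold.a_zero, hfold.b_zero, hfold.ρ_zero])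
      (by simpa using (hcomp ha').prodMk ((hcomp hb').prodMk (hcomp hρ'))))
  obtain ⟨ε₀, ε₁, δ, t₁, t₂, hbox, hsub, ht₁, ht₂⟩ := hfold.exists_cuspBox hYX.smooth
    (lt_min hη₁ hη₂) (inter_mem (inter_mem hO (Θ.open_target.mem_nhds h0t)) hPΘ)
  have hη₁' := min_le_left η₁ η₂
  have hη₂' := min_le_right η₁ η₂
  have ht₁0 := hbox.t₁_neg
  have ht₂0 := hbox.t₂_pos
  have hBt : box ε₀ ε₁ δ ⊆ Θ.target := fun w hw => (hsub hw).1.2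
  have hPs : ∀ w ∈ box ε₀ ε₁ δ, P w = Θ.symm w := fun w hw => (hsub hw).2
  -- `Y` is `±x` in these coordinates, so its zeros lie in the plane and dropping the first
  -- component loses nothing.
  have hplane : ∀ w ∈ box ε₀ ε₁ δ, Y w = 0 → ((0, (P w).2) : R3) = Θ.symm w := by
    intro w hw h0
    rw [hPs w hw]
    exact Prod.ext (by rw [hΘ.fst_symm w (hBt hw)]; exact ((hY0 w).1 h0).symm) rfl
  have hcm : ∀ t ∈ Ioo t₁ t₂, ((a t, b t, t) : R3) ∈ box ε₀ ε₁ δ := fun t ht =>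
    ⟨(hbox.curve_mem t ht).1, (hbox.curve_mem t ht).2.1, (hbox.curve_mem t ht).2.2.1⟩
  have hrm : ∀ t ∈ Ioo t₁ t₂, ((a t, b t, ρ t) : R3) ∈ box ε₀ ε₁ δ := fun t ht =>
    ⟨(hbox.curve_mem t ht).1, (hbox.curve_mem t ht).2.1, (hbox.curve_mem t ht).2.2.2⟩
  obtain ⟨ϑ, α, β, hα, hβ, hϑ, hϑ0, hϑ', gϑ, gϑ₂, gϑ₁⟩ :=
    hgraph₁ t₁ t₂ (by linarith) ht₁0 ht₂0 (by linarith)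
  obtain ⟨θ, α', β', hα', hβ', hθ, hθ0, hθ', -, gθ₁, gθ₂⟩ :=
    hgraph₂ (-t₂) (-t₁) (by linarith) (by linarith) (by linarith) (by linarith)
  have himγ : ∀ J ⊆ Ioo t₁ t₂, (fun t => ((0, (P (a t, b t, t)).2) : R3)) '' J =
      (fun t => Θ.symm (a t, b t, t)) '' J := fun J hJ =>
    image_congr fun t ht => hplane _ (hcm t (hJ ht)) (hbox.zeros t (hJ ht)).2.1
  have himσ : ∀ J ⊆ Ioo t₁ t₂, (fun t => ((0, (P (a (-t), b (-t), ρ (-t))).2) : R3)) '' (-J) =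
      (fun t => Θ.symm (a t, b t, ρ t)) '' J := by
    intro J hJ
    rw [← image_neg_eq_neg, image_image]
    refine image_congr fun t ht => ?_
    simp only [neg_neg]
    exact hplane _ (hrm t (hJ ht)) (hbox.zeros t (hJ ht)).1
  have hI₁ : Ioo 0 t₂ ⊆ Ioo t₁ t₂ := Ioo_subset_Ioo_left ht₁0.le
  have hI₂ : Ioo t₁ 0 ⊆ Ioo t₁ t₂ := Ioo_subset_Ioo_right ht₂0.le
  rw [himγ _ subset_rfl] at gϑ
  rw [himγ _ hI₁] at gϑ₁
  rw [himγ _ hI₂] at gϑ₂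
  have hn₁ : Ioo (-t₂) 0 = -Ioo 0 t₂ := by simp
  have hn₂ : Ioo 0 (-t₁) = -Ioo t₁ 0 := by simp
  rw [hn₁, himσ _ hI₁] at gθ₁
  rw [hn₂, himσ _ hI₂] at gθ₂
  have hkF : ContDiff ℝ 1 fun p => k • F p := by fun_prop
  have hsmul : ∀ w, ((0, 0, Y w) : R3) = k • (0, 0, X w) := fun w => by simp [hYdef]
  have hsymm : ∀ w ∈ Θ.target, fderiv ℝ Θ.symm w (0, 0, Y w) = k • F (Θ.symm w) := by
    intro w hw
    rw [hsmul, map_smul, hΘ.fderiv_symm w hw]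
  have hmap : ∀ p ∈ Θ.source, fderiv ℝ Θ p (k • F p) = (0, 0, Y (Θ p)) := by
    intro p hp
    rw [hsmul, map_smul, hΘ.fderiv_map p hp]
  obtain ⟨s₁, d₁, e₁, w₁⟩ := fold_branch_dynamics hkF hΘ.smooth hΘ.smooth_symm hsymm hmap
    hYX.smooth hBt hsm hsb hsρ (s := 0) (t := t₂) (k := κ) (Or.inl rfl : (1 : ℝ) = 1 ∨ _)
    hbox.deriv_b_pos (fun t ht => hbox.curve_mem t (hI₁ ht))
    (fun t ht => by linarith [hbox.ρ_neg t ht, ht.1])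
    (fun t ht => ⟨(hbox.zeros t (hI₁ ht)).1, (hbox.zeros t (hI₁ ht)).2.1⟩)
    (fun t ht τ hτ hne h => by
      have := ((hbox.zeros t (hI₁ ht)).2.2 τ hτ hne).2 (by linarith)
      linarith) rfl gϑ₁ gθ₁ rfl
  obtain ⟨s₂, d₂, e₂, w₂⟩ := fold_branch_dynamics hkF hΘ.smooth hΘ.smooth_symm hsymm hmap
    hYX.smooth hBt hsm hsb hsρ (s := t₁) (t := 0) (k := -κ) (Or.inr rfl : (-1 : ℝ) = 1 ∨ _)
    hbox.deriv_b_neg (fun t ht => hbox.curve_mem t (hI₂ ht))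
    (fun t ht => by linarith [hbox.ρ_pos t ht, ht.2])
    (fun t ht => ⟨(hbox.zeros t (hI₂ ht)).1, (hbox.zeros t (hI₂ ht)).2.1⟩)
    (fun t ht τ hτ hne h => by
      have := ((hbox.zeros t (hI₂ ht)).2.2 τ hτ hne).1 (by linarith)
      linarith) rfl gϑ₂ gθ₂ rfl
  refine ⟨box ε₀ ε₁ δ, isOpen_box _ _ _, ?_, fun w hw => (hsub hw).1.1, hBt, ?_,
    ϑ, θ, α, β, α', β', _, _, _, _, _, _, hα, hβ, hϑ, hϑ0, ?_, rfl, rfl, rfl, rfl, s₁, s₂, d₁, d₂,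
    ?_, e₁, e₂, hα', hβ', hθ, hθ0, rfl, rfl, ?_, hθ'.trans hϑ'.symm⟩
  · simpa [box] using ⟨hbox.ε₀_pos, hbox.ε₁_pos, hbox.δ_pos⟩
  · rintro _ ⟨w, hw, rfl⟩
    have hin := hbox.inward w.1 w.2.1 hw.1 hw.2.1
    obtain ⟨L, hL, hgL, hconv⟩ := exists_scalarConverges (g := fun y => Y (w.1, w.2.1, y))
      ((hYX.smooth.of_le (by simp)).comp (by fun_prop)) hin.1 hin.2 hw.2.2
    have hw' : ((w.1, w.2.1, L) : R3) ∈ box ε₀ ε₁ δ := ⟨hw.1, hw.2.1, hL⟩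
    refine ⟨(P (w.1, w.2.1, L)).2.1, (P (w.1, w.2.1, L)).2.2, ?_⟩
    change ((0, (P (w.1, w.2.1, L)).2) : R3) ∈ _ ∧
      ConvergesForward _ _ _ (0, (P (w.1, w.2.1, L)).2)
    rw [hplane _ hw' hgL]
    exact ⟨mem_image_of_mem _ hw', (convergesForward_iff hΘ.smooth hΘ.smooth_symm hsymm hmap hBt
      hw hw').2 ⟨rfl, rfl, hconv⟩⟩
  · have hT : ∀ w ∈ box ε₀ ε₁ δ, ((Θ.symm w).1 = 0 ∧ dx f (Θ.symm w) = 0) ↔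
        ∃ t ∈ Ioo t₁ t₂, w = (a t, b t, t) := by
      intro w hw
      rw [← hbox.double_zero w hw, hY0, hdtY, hΘ.fst_symm w (hBt hw)]
      refine and_congr_right fun h => ?_
      rw [hdx w (hBt hw) h]
    rw [gϑ]
    ext p
    constructor
    · rintro ⟨hp, w, hw, rfl⟩
      obtain ⟨t, ht, rfl⟩ := (hT w hw).1 hp
      exact ⟨t, ht, rfl⟩
    · rintro ⟨t, ht, rfl⟩
      exact ⟨(hT _ (hcm t ht)).2 ⟨t, ht, rfl⟩, mem_image_of_mem _ (hcm t ht)⟩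
  -- On the heteroclinic orbits `Y` is negative over the branch `t > 0` and positive over `t < 0`;
  -- the sign `k` decides which side of the plane each one is on.
  · have hfst : ∀ w ∈ Θ.target, (Θ.symm w).1 = k * Y w := by
      intro w hw
      rw [hΘ.fst_symm w hw]
      rcases hk with rfl | rfl <;> simp [hYdef]
    rcases hk with rfl | rfl
    · refine Or.inr ⟨fun p hp => ?_, fun p hp => ?_⟩
      · obtain ⟨w, hw, rfl, h⟩ := w₁ p hp
        rw [hfst w hw]; exact h
      · obtain ⟨w, hw, rfl, h⟩ := w₂ p hp
        rw [hfst w hw]; linarith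
    · refine Or.inl ⟨fun p hp => ?_, fun p hp => ?_⟩
      · obtain ⟨w, hw, rfl, h⟩ := w₁ p hp
        rw [hfst w hw]; linarith
      · obtain ⟨w, hw, rfl, h⟩ := w₂ p hp
        rw [hfst w hw]; exact h
  · have h0 : ({0} : Set R3) = planeGraph θ {0} := by
      simp only [planeGraph, image_singleton, hθ0]
      rfl
    rw [h0]
    simp only [planeGraph, ← image_union]
    congr 1
    ext s
    simp only [mem_union, mem_Ioo, mem_singleton_iff]
    constructor
    · rintro ((h | rfl) | h)
      · exact ⟨h.1, h.2.trans hβ'⟩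
      · exact ⟨hα', hβ'⟩
      · exact ⟨hα'.trans h.1, h.2⟩
    · rintro ⟨h1, h2⟩
      rcases lt_trichotomy s 0 with h | h | h
      · exact Or.inl (Or.inl ⟨h1, h⟩)
      · exact Or.inl (Or.inr h)
      · exact Or.inr ⟨h, h2⟩

end DriftSing

/-! ### Flow equivalence and the main theorem. -/

namespace DriftSing

/-- The equivalence is the straightening chart followed by the normal form coordinates, restricted
to the preimage of `B`. The chain rule carries `F` first to `(0, 0, X)` and then to a positive
multiple of the cusp field. -/
theorem IsFlowBox.flowEquivalentOn {F : R3 → R3} {Θ H : OpenPartialHomeomorph R3 R3}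
    {X μ r : R3 → ℝ} {a : ℝ} (hΘ : IsFlowBox F Θ X) (hH0 : H 0 = 0)
    (hH : ContDiffOn ℝ ∞ H H.source) (hHs : ContDiffOn ℝ ∞ H.symm H.target)
    (hμ : ContDiffOn ℝ ∞ μ H.source) (hμ0 : ∀ w ∈ H.source, 0 < μ w)
    (hX : ∀ w ∈ H.source, fderiv ℝ H w (0, 0, X w) = μ w • cuspField a r (H w))
    {B : Set R3} (hB : IsOpen B) (hBH : B ⊆ H.source) (hBΘ : B ⊆ Θ.target) :
    FlowEquivalentOn F (Θ.symm '' B) (cuspField a r) (H '' B) := by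
  have hUo : IsOpen (Θ.symm '' B) := Θ.symm.isOpen_image_of_subset_source hB hBΘ
  have hUs : Θ.symm '' B ⊆ Θ.source := by
    rintro _ ⟨w, hw, rfl⟩
    exact Θ.map_target (hBΘ hw)
  have hUB : ∀ p ∈ Θ.symm '' B, Θ p ∈ B := by
    rintro _ ⟨w, hw, rfl⟩
    rwa [Θ.right_inv (hBΘ hw)]
  have hVs : H '' B ⊆ H.target := by
    rintro _ ⟨w, hw, rfl⟩
    exact H.map_source (hBH hw)
  have hVB : ∀ z ∈ H '' B, H.symm z ∈ B := by
    rintro _ ⟨w, hw, rfl⟩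
    rwa [H.left_inv (hBH hw)]
  let E : OpenPartialHomeomorph R3 R3 := (Θ.trans H).restrOpen (Θ.symm '' B) hUo
  have hEs : E.source = Θ.symm '' B := by
    ext p
    simp only [E, OpenPartialHomeomorph.restrOpen_source, OpenPartialHomeomorph.trans_source,
      mem_inter_iff, mem_preimage]
    exact ⟨fun h => h.2, fun h => ⟨⟨hUs h, hBH (hUB p h)⟩, h⟩⟩
  have hE : ∀ p, E p = H (Θ p) := fun p => rfl
  have hEsymm : ∀ z, E.symm z = Θ.symm (H.symm z) := fun z => rfl
  have hEt : E.target = H '' B := by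
    rw [← E.image_source_eq_target, hEs, image_image]
    exact image_congr fun w hw => by rw [hE, Θ.right_inv (hBΘ hw)]
  refine ⟨E, hEs, hEt, ?_, ?_, ?_, fun p => μ (Θ p), ?_, fun p hp => hμ0 _ (hBH (hUB p hp)), ?_⟩
  · rw [hE, hΘ.map_zero, hH0]
  · exact hH.comp (hΘ.smooth.mono hUs) fun p hp => hBH (hUB p hp)
  · exact hΘ.smooth_symm.comp (hHs.mono hVs) fun z hz => hBΘ (hVB z hz)
  · exact hμ.comp (hΘ.smooth.mono hUs) fun p hp => hBH (hUB p hp)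
  · intro p hp
    have d1 : DifferentiableAt ℝ Θ p :=
      (hΘ.smooth.contDiffAt (Θ.open_source.mem_nhds (hUs hp))).differentiableAt (by simp)
    have hw := hBH (hUB p hp)
    have d2 : DifferentiableAt ℝ H (Θ p) :=
      (hH.contDiffAt (H.open_source.mem_nhds hw)).differentiableAt (by simp)
    have h1 : fderiv ℝ E p = (fderiv ℝ H (Θ p)).comp (fderiv ℝ Θ p) := fderiv_comp p d2 d1
    rw [h1, ContinuousLinearMap.comp_apply, hΘ.fderiv_map p (hUs hp), hX _ hw, hE]

end DriftSing

open DriftSing in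
theorem mainTheorem1 (f g₁ g₂ : R3 → ℝ)
    (hf : ContDiff ℝ ∞ f) (hg₁ : ContDiff ℝ ∞ g₁) (hg₂ : ContDiff ℝ ∞ g₂)
    (h_i : ∀ y₁ y₂ : ℝ, field f g₁ g₂ (0, y₁, y₂) = 0)
    (h_ii : dx f 0 = 0)
    (h_iii : 0 < dy₁ (dx f) 0 ∧ dy₂ (dx f) 0 = 0)
    (h_iv : dx g₁ 0 = 0)
    (h_v : kappa f g₁ g₂ ≠ 0)
    (h_vi : 0 < dx g₂ 0)
    (N : ℕ) (O : Set R3) (hO : O ∈ 𝓝 (0 : R3)) :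
    ∃ U : Set R3, IsOpen U ∧ (0 : R3) ∈ U ∧ U ⊆ O ∧
      (∃ (V : Set R3) (r : R3 → ℝ) (C : ℝ), ContDiffOn ℝ ∞ r V ∧
        (∀ z ∈ V, |r z| ≤ C * |z.2.2| ^ N) ∧
        FlowEquivalentOn (field f g₁ g₂) U (cuspField (Real.sign (kappa f g₁ g₂)) r) V) ∧
      (kappa f g₁ g₂ < 0 →
        LocalDynamics U {p | p.1 = 0 ∧ dx f p = 0}
          (ConvergesBackward (field f g₁ g₂) U) (ConvergesForward (field f g₁ g₂) U)) ∧
      (0 < kappa f g₁ g₂ →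
        LocalDynamics U {p | p.1 = 0 ∧ dx f p = 0}
          (ConvergesForward (field f g₁ g₂) U) (ConvergesBackward (field f g₁ g₂) U)) := by
  obtain ⟨Θ, X, hΘ, hX, hdx, hΘc⟩ := exists_flowBox hf hg₁ hg₂ h_i h_ii h_iii h_iv h_vi
  have hF : ContDiff ℝ 1 (field f g₁ g₂) :=
    (hf.prodMk (hg₁.prodMk hg₂)).of_le (by simp)
  set F := field f g₁ g₂ with hFdef
  set ν := kappa f g₁ g₂ with hν
  have hsign : 0 < dx g₂ 0 * ν / Real.sign ν := by
    rcases lt_or_gt_of_ne h_v with h | h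
    · rw [Real.sign_of_neg h, div_neg, div_one]
      exact neg_pos.2 (mul_neg_of_pos_of_neg h_vi h)
    · rw [Real.sign_of_pos h, div_one]
      exact mul_pos h_vi h
  obtain ⟨H, μ, r, hH0, hH00, hH, hHs, hμ, hμ0, hr, hrN, hHX⟩ := exists_normalForm hX hsign N
  have h0t : (0 : R3) ∈ Θ.target := by
    have := Θ.map_source hΘ.zero_mem
    rwa [hΘ.map_zero] at this
  have hs0 : Θ.symm 0 = 0 := by
    have := Θ.left_inv hΘ.zero_mem
    rwa [hΘ.map_zero] at this
  -- One box `B` must serve both conclusions: inside `H.source` for the normal form, with inverse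
  -- image `U` in `O`, and adapted to the fold curve for the dynamics.
  have hO' : H.source ∩ Θ.symm ⁻¹' O ∈ 𝓝 (0 : R3) :=
    inter_mem (H.open_source.mem_nhds hH0)
      ((Θ.symm.continuousAt h0t).preimage_mem_nhds (by rwa [hs0]))
  -- The sign `k` is opposite to that of `kappa`. For positive `kappa` the dynamics are found for
  -- `-F`, and the two convergence relations are interchanged at the end.
  obtain ⟨k, hk, hkν⟩ : ∃ k : ℝ, (k = 1 ∨ k = -1) ∧ k * (dx g₂ 0 * ν) < 0 := by
    rcases lt_or_gt_of_ne h_v with h | h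
    · exact ⟨1, Or.inl rfl, by rw [one_mul]; exact mul_neg_of_pos_of_neg h_vi h⟩
    · exact ⟨-1, Or.inr rfl, by rw [neg_one_mul]; exact neg_neg_of_pos (mul_pos h_vi h)⟩
  obtain ⟨B, hBo, h0B, hBO, hBt, hdyn⟩ := exists_localDynamics hF hΘ hX hk hkν hdx h_vi hΘc hO'
  refine ⟨Θ.symm '' B, Θ.symm.isOpen_image_of_subset_source hBo hBt, ⟨0, h0B, hs0⟩, ?_,
    ⟨H '' B, r, 1, hr.mono ?_, fun z hz => ?_, hΘ.flowEquivalentOn hH00 hH hHs hμ hμ0 hHX hBo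
      (fun w hw => (hBO hw).1) hBt⟩, fun h => ?_, fun h => ?_⟩
  · rintro _ ⟨w, hw, rfl⟩
    exact (hBO hw).2
  · rintro _ ⟨w, hw, rfl⟩
    exact H.map_source (hBO hw).1
  · obtain ⟨w, hw, rfl⟩ := hz
    rw [one_mul]
    exact hrN _ (H.map_source (hBO hw).1)
  · rcases hk with rfl | rfl
    · simpa only [one_smul] using hdyn
    · nlinarith [mul_neg_of_pos_of_neg h_vi h]
  · rcases hk with rfl | rfl
    · nlinarith [mul_pos h_vi h]
    · have e1 : ConvergesForward (fun p => (-1 : ℝ) • F p) (Θ.symm '' B) =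
          ConvergesBackward F (Θ.symm '' B) := by
        funext p q
        simp only [neg_smul, one_smul, convergesBackward_iff]
      have e2 : ConvergesBackward (fun p => (-1 : ℝ) • F p) (Θ.symm '' B) =
          ConvergesForward F (Θ.symm '' B) := by
        funext p q
        simp only [neg_smul, one_smul, convergesBackward_iff, neg_neg]
      rwa [e1, e2] at hdyn
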